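/- Let $n\ge 1$ and $\frac12<\alpha<1$. Consider the generalized Navier--Stokes equations $$u_t+(u\cdot\nabla)u+(-\Delta)^\alpha u+\nabla p=0,\qquad \nabla\cdot u=0,\qquad u(0)=u_0\qquad\text{on }\mathbb R^n\times(0,\infty),$$ in the mild formulation $$u(t)=S(t)u_0-\int_0^tS(t-s)\,\Pi\nabla\cdot(u\otimes u)(s)\,ds\quad(t>0),\qquad S(t)=e^{-t(-\Delta)^\alpha},$$ where $\Pi$ is the Leray projection, with symbol $\delta_{ij}-\xi_i\xi_j/|\xi|^2$. Let $\mathcal B=\dot B^{1-2\alpha}_{\infty,\infty}(\mathbb R^n)$ be the homogeneous Besov space, i.e. the space of tempered distributions $h$ such that $\|\theta(\lambda D)h\|_{L^\infty}\to0$ as $\lambda\to\infty$ for every $\theta\in C_c^\infty(\mathbb R^n)$ and $\|h\|_{\mathcal B}=\sup_{j\in\mathbb Z}2^{j(1-2\alpha)}\|P_jh\|_{L^\infty}<\infty$, where the $P_j$ are the homogeneous Littlewood--Paley blocks; a vector field is in $\mathcal B$ if its components are. For measurable $u$ on $\mathbb R^n\times(0,\infty)$ and integers $k\ge0$ let $$\|u\|_{GX^k}=\sup_{|\beta|=k}\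 \sup_{t>0}\ t^{(1-\frac1{2\alpha})+\frac k{2\alpha}}\,\|\partial_x^\beta u(t)\|_{L^\infty(\mathbb R^n)} .$$ Then there are $\varepsilon>0$ and $\delta>0$, depending only on $n$ and $\alpha$, such that for every real vector field $u_0\in\mathcal B$ with $\nabla\cdot u_0=0$ and $\|u_0\|_{\mathcal B}<\varepsilon$ there is a mild solution $u$ with $\|u\|_{GX^0}\le\delta$, it is the only mild solution with $\|u\|_{GX^0}\le\delta$, and for every integer $k\ge0$ it has continuous space derivatives of order $k$ at each time $t>0$ and satisfies $$\sup_{t>0}\,t^{(1-\frac1{2\alpha})+\frac k{2\alpha}}\,\|\nabla^ku(t)\|_{L^\infty(\mathbb R^n)}<\infty,\qquad\text{i.e. } u\in GX^k .$$ -/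

import Mathlib

open MeasureTheory Filter Topology
open scoped ENNReal ContDiff SchwartzMap FourierTransform LineDeriv

namespace FracNS

noncomputable section

/-- Euclidean space `ℝⁿ`. -/
abbrev Space (n : ℕ) := EuclideanSpace ℝ (Fin n)

/-- The `i`-th standard basis vector of `ℝⁿ`. -/
abbrev basisVec {n : ℕ} (i : Fin n) : Space n := EuclideanSpace.single i 1

/-! ### The homogeneous Besov space -/

/-- The `L^∞` norm of a tempered distribution: the norm of the essentially bounded function which
represents it, and `∞` if there is no such function. -/
def linftyNorm {n : ℕ} (T : 𝓢'(Space n, ℂ)) : ℝ≥0∞ :=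
  ⨅ (f : Lp ℂ ⊤ (volume : Measure (Space n))) (_ : Lp.toTemperedDistribution f = T), ‖f‖ₑ

/-- A smooth cut-off function, equal to `1` on the unit ball and to `0` off the ball of
radius `2`. -/
def cutoff (n : ℕ) : ContDiffBump (0 : Space n) := ⟨1, 2, one_pos, one_lt_two⟩

/-- The dyadic partition of unity on `ℝⁿ ∖ {0}`: the `j`-th function is supported in the annulus
`2 ^ (j - 1) ≤ |ξ| ≤ 2 ^ (j + 1)`. -/
def dyadic (n : ℕ) (j : ℤ) (ξ : Space n) : ℂ :=
  ((cutoff n ((2 : ℝ) ^ (-j) • ξ) - cutoff n ((2 : ℝ) ^ (-j + 1) • ξ) : ℝ) : ℂ)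

theorem dyadic_contDiff (n : ℕ) (j : ℤ) : ContDiff ℝ ∞ (dyadic n j) := by
  have h (c : ℝ) : ContDiff ℝ ∞ (fun ξ : Space n => cutoff n (c • ξ)) :=
    (cutoff n).contDiff.comp (contDiff_const_smul c)
  exact Complex.ofRealCLM.contDiff.comp ((h _).sub (h _))

theorem dyadic_hasCompactSupport (n : ℕ) (j : ℤ) : HasCompactSupport (dyadic n j) := by
  have h (c : ℝ) (hc : c ≠ 0) : HasCompactSupport (fun ξ : Space n => cutoff n (c • ξ)) :=
    (cutoff n).hasCompactSupport.comp_smul hc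
  exact ((h _ (by positivity)).sub (h _ (by positivity))).comp_left
    (g := fun x : ℝ => (x : ℂ)) (by simp)

/-- The homogeneous dyadic (Littlewood–Paley) block `P_j h`, the Fourier multiplier whose symbol is
the `j`-th function of the dyadic partition of unity. -/
def block {n : ℕ} (j : ℤ) (h : 𝓢'(Space n, ℂ)) : 𝓢'(Space n, ℂ) :=
  TemperedDistribution.fourierMultiplierCLM ℂ (dyadic n j) h

/-- The norm of the homogeneous Besov space with exponents `∞`, `∞` and regularity `1 - 2 * α`. -/
def besovNorm {n : ℕ} (α : ℝ) (h : 𝓢'(Space n, ℂ)) : ℝ≥0∞ :=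
  ⨆ j : ℤ, ENNReal.ofReal ((2 : ℝ) ^ ((j : ℝ) * (1 - 2 * α))) * linftyNorm (block j h)

/-- The space `𝓢'_h` of tempered distributions `h` such that `θ(lD) h → 0` in `L^∞` as `l → ∞`,
for each smooth compactly supported `θ`. -/
def IsHomogeneous {n : ℕ} (h : 𝓢'(Space n, ℂ)) : Prop :=
  ∀ θ : Space n → ℂ, ContDiff ℝ ∞ θ → HasCompactSupport θ →
    Tendsto (fun l : ℝ =>
      linftyNorm (TemperedDistribution.fourierMultiplierCLM ℂ (fun ξ => θ (l • ξ)) h))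
      atTop (𝓝 0)

/-- The space `𝓑` of vector-valued tempered distributions all of whose components belong to the
homogeneous Besov space with exponents `∞`, `∞` and regularity `1 - 2 * α`. -/
def MemB {n : ℕ} (α : ℝ) (u₀ : Fin n → 𝓢'(Space n, ℂ)) : Prop :=
  ∀ i, IsHomogeneous (u₀ i) ∧ besovNorm α (u₀ i) < ⊤

/-- The norm of `𝓑`. -/
def normB {n : ℕ} (α : ℝ) (u₀ : Fin n → 𝓢'(Space n, ℂ)) : ℝ≥0∞ :=
  ⨆ i, besovNorm α (u₀ i)

/-- A distribution is real if it is real on real test functions. -/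
def IsReal {n : ℕ} (h : 𝓢'(Space n, ℂ)) : Prop :=
  ∀ g : 𝓢(Space n, ℂ), (∀ x, (g x).im = 0) → (h g).im = 0

/-- `∇ · u₀ = 0` in the sense of distributions. -/
def IsDivFree {n : ℕ} (u₀ : Fin n → 𝓢'(Space n, ℂ)) : Prop :=
  ∑ i, ∂_{basisVec i} (u₀ i) = 0

/-! ### The fractional heat semigroup and the Leray projection

In Mathlib `𝓕⁻ f x = ∫ exp (2πi ⟨ξ, x⟩) f ξ dξ`, so that `-Δ` has the symbol `(2π|ξ|)²` and
`∂_k` has the symbol `2πi ξ_k`. -/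

/-- The symbol of `S(t) = exp (-t (-Δ)^α)`. -/
def heatSymbol {n : ℕ} (α t : ℝ) (ξ : Space n) : ℂ :=
  (Real.exp (-t * (2 * Real.pi * ‖ξ‖) ^ (2 * α)) : ℂ)

/-- The kernel `Φ(t, ·)` of `S(t)`. -/
def heatKernel {n : ℕ} (α t : ℝ) : Space n → ℂ := 𝓕⁻ (heatSymbol α t)

open Classical in
/-- The bounded function which represents the block `P_j h` (`0` if there is none). -/
def blockFun {n : ℕ} (j : ℤ) (h : 𝓢'(Space n, ℂ)) : Lp ℂ ⊤ (volume : Measure (Space n)) :=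
  if H : ∃ f : Lp ℂ ⊤ (volume : Measure (Space n)), Lp.toTemperedDistribution f = block j h
  then H.choose else 0

/-- `S(t) h` for `h` in the homogeneous Besov space: the sum over all `j` of `S(t) P_j h`, where
`S(t)` acts on bounded functions by convolution with its kernel. -/
def heatFlow {n : ℕ} (α t : ℝ) (h : 𝓢'(Space n, ℂ)) (x : Space n) : ℂ :=
  ∑' j : ℤ, ∫ y, heatKernel α t (x - y) * blockFun j h y

/-- The symbol `δ_ij - ξ_i ξ_j / |ξ|²` of the Leray projection `Π` to the divergence free
vector fields. -/
def leraySymbol {n : ℕ} (i j : Fin n) (ξ : Space n) : ℝ :=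
  (if i = j then 1 else 0) - ξ i * ξ j / ‖ξ‖ ^ 2

/-- The kernel of `∂_k Π_ij S(t)`. -/
def lerayHeatKernel {n : ℕ} (α t : ℝ) (i j k : Fin n) : Space n → ℂ :=
  𝓕⁻ (fun ξ : Space n =>
    (2 * Real.pi * Complex.I * (ξ k : ℂ)) * (leraySymbol i j ξ : ℂ) * heatSymbol α t ξ)

/-- The `i`-th component of `(V ∇Π N(u))(x, t) = ∫₀ᵗ S(t - s) Π ∇ · (u ⊗ u)(s) ds`. -/
def duhamel {n : ℕ} (α : ℝ) (u : ℝ → Space n → Space n) (t : ℝ) (x : Space n) (i : Fin n) : ℂ :=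
  ∫ s in (0 : ℝ)..t, ∫ y, ∑ j, ∑ k,
    lerayHeatKernel α (t - s) i j k (x - y) * ((u s y j * u s y k : ℝ) : ℂ)

/-! ### Solutions -/

/-- The norm of the space `GX^k`: the supremum over all partial derivatives `∂` of order `k` in the
space variable and all times `t > 0` of `t ^ (1 - 1/(2α) + k/(2α)) ‖∂ u(t)‖_∞`. -/
def normGX {n : ℕ} (α : ℝ) (k : ℕ) (u : ℝ → Space n → Space n) : ℝ≥0∞ :=
  ⨆ (β : Fin k → Fin n) (t : ℝ) (_ : 0 < t),
    ENNReal.ofReal (t ^ ((1 - 1 / (2 * α)) + k / (2 * α))) *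
      eLpNorm (fun x => iteratedFDeriv ℝ k (u t) x (fun l => basisVec (β l))) ⊤ volume

/-- `u ∈ GX^k`: the field `u` on `ℝⁿ × (0, ∞)` is measurable, has continuous space derivatives up to
the order `k` at each time `t > 0`, and its norm is finite. -/
def MemGX {n : ℕ} (α : ℝ) (k : ℕ) (u : ℝ → Space n → Space n) : Prop :=
  AEStronglyMeasurable (fun p : ℝ × Space n => u p.1 p.2)
    (volume.restrict (Set.Ioi (0 : ℝ) ×ˢ Set.univ)) ∧
  (∀ t, 0 < t → ContDiff ℝ k (u t)) ∧ normGX α k u < ⊤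

/-- A global mild solution of the generalized Navier–Stokes equations with initial datum `u₀`:
a measurable field with `sup_t t ^ (1 - 1/(2α)) ‖u(t)‖_∞ < ∞` which satisfies
`u = S(t) u₀ - V ∇Π N(u)`. -/
structure IsMildSolution {n : ℕ} (α : ℝ) (u₀ : Fin n → 𝓢'(Space n, ℂ))
    (u : ℝ → Space n → Space n) : Prop where
  measurable : AEStronglyMeasurable (fun p : ℝ × Space n => u p.1 p.2)
    (volume.restrict (Set.Ioi (0 : ℝ) ×ˢ Set.univ))
  norm_lt_top : normGX α 0 u < ⊤
  eqn : ∀ t, 0 < t → ∀ x i, (u t x i : ℂ) = heatFlow α t (u₀ i) x - duhamel α u t x i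

end

end FracNS

/-! The solution is the fixed point of the mild map in a small ball of the scale-invariant norm
`sup_t t ^ (1 - r) ‖u(t)‖_∞`, where `r = 1/(2α)`. The linear term lies in this space with all its
derivatives (`exists_smoothBound_heatFlow`): on the block `P_j` the flow acts through a kernel
localized at frequency `2 ^ j`, which decays in `t * 2 ^ (2αj)`, and summation of `2 ^ (j(2α - 1))`
against that decay gives `t ^ (-(1 - r))`.

The kernel of `∂_k Π S(t)` has `L¹` norm of order `t ^ (-r)` (`exists_integral_leray_le`), so the
Duhamel term is controlled by `∫₀ᵗ (t - s) ^ (-r) s ^ (-2(1 - r)) ds`, a multiple of `t ^ (-(1 -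
r))`. Integrability at `s = t` requires `α > 1/2`, and at `s = 0` it requires `α < 1`. Hence the
quadratic term is bounded (`exists_duhamel_sub_le`), and on a small ball the mild map is a
contraction.

Regularity must hold for every order with `ε` and `δ` independent of the order. Near `s = t` the
kernel cannot carry more derivatives, since `(t - s) ^ (-(k + 1) r)` stops being integrable. The
integral is therefore split at `s = (1 - η)t`. Before that time all derivatives fall on the kernel,
which costs a power of `η` but uses only the sup norm of `u ⊗ u`; after it they fall on `u ⊗ u`,
with a factor `η ^ (1 - r)`. Thus the derivatives of `u ⊗ u` of top order enter with an arbitrarily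
small coefficient `κ` (`exists_smoothBound_lerayDuhamel`). In the Leibniz sum only the two end terms
contain the bound of top order, each multiplied by `δ`, and they are absorbed once `κδ ≤ 1/4`. The
bounds of higher order are then defined recursively (`majorantSeq`, `le_majorantSeq`) and are
preserved by the mild map.

All Picard iterates obey the same derivative bounds and converge uniformly at each time, so by
interpolation the limit obeys them too (`smoothBound_of_tendsto`). For uniqueness, a competing
solution, bounded only almost everywhere, is the image under the mild map of an everywhere bounded
representative (`IsMildSolution.exists_admissible`), and so it is itself a fixed point in the ball.
-/

namespace FracNS

noncomputable section

/-! ### Calculus of functions with bounded derivatives of all orders. -/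

section SmoothBounds

variable {E F : Type} [NormedAddCommGroup E] [NormedSpace ℝ E]
  [NormedAddCommGroup F] [NormedSpace ℝ F]

/-- `f` is of class `C^N` and its derivatives of order `k ≤ N` are bounded by `M k`. -/
def SmoothBoundUpTo (N : ℕ) (f : E → F) (M : ℕ → ℝ) : Prop :=
  ContDiff ℝ N f ∧ ∀ k ≤ N, ∀ x, ‖iteratedFDeriv ℝ k f x‖ ≤ M k

/-- `f` is smooth and its derivatives of order `k` are bounded by `M k`. -/
def SmoothBound (f : E → F) (M : ℕ → ℝ) : Prop :=
  ContDiff ℝ ∞ f ∧ ∀ k x, ‖iteratedFDeriv ℝ k f x‖ ≤ M k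

theorem smoothBound_iff_upTo {f : E → F} {M : ℕ → ℝ} :
    SmoothBound f M ↔ ∀ N, SmoothBoundUpTo N f M := by
  refine ⟨fun h N => ⟨h.1.of_le (by exact_mod_cast le_top), fun k _ x => h.2 k x⟩, fun h =>
    ⟨contDiff_infty.2 fun N => (h N).1, fun k x => (h k).2 k le_rfl x⟩⟩

/-- This is the inductive step for the order. The derivative takes values in a new space, so the
inductions that use it quantify over the target `F`. -/
theorem SmoothBoundUpTo.succ {N : ℕ} {f : E → F} {M : ℕ → ℝ} (hf : Differentiable ℝ f)
    (h0 : ∀ x, ‖f x‖ ≤ M 0) (h : SmoothBoundUpTo N (fderiv ℝ f) (fun k => M (k + 1))) :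
    SmoothBoundUpTo (N + 1) f M := by
  refine ⟨?_, fun k hk x => ?_⟩
  · have : ((N + 1 : ℕ) : WithTop ℕ∞) = (N : WithTop ℕ∞) + 1 := by norm_cast
    rw [this, contDiff_succ_iff_fderiv]
    exact ⟨hf, by simp, h.1⟩
  · cases k with
    | zero => simpa using h0 x
    | succ k =>
      rw [← norm_iteratedFDeriv_fderiv]
      exact h.2 k (by omega) x

theorem SmoothBound.norm_le {f : E → F} {M : ℕ → ℝ} (h : SmoothBound f M) (x : E) :
    ‖f x‖ ≤ M 0 := by
  simpa using h.2 0 x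

theorem SmoothBound.fderiv {f : E → F} {M : ℕ → ℝ} (h : SmoothBound f M) :
    SmoothBound (fderiv ℝ f) (fun k => M (k + 1)) :=
  ⟨h.1.fderiv_right (by simp), fun k x => by
    rw [norm_iteratedFDeriv_fderiv]; exact h.2 _ x⟩

theorem SmoothBound.differentiable {f : E → F} {M : ℕ → ℝ} (h : SmoothBound f M) :
    Differentiable ℝ f := h.1.differentiable (by simp)

theorem SmoothBound.norm_fderiv_le {f : E → F} {M : ℕ → ℝ} (h : SmoothBound f M) (x : E) :
    ‖_root_.fderiv ℝ f x‖ ≤ M 1 := h.fderiv.norm_le x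

theorem SmoothBound.mono {f : E → F} {M M' : ℕ → ℝ} (h : SmoothBound f M) (hM : ∀ k, M k ≤ M' k) :
    SmoothBound f M' := ⟨h.1, fun k x => (h.2 k x).trans (hM k)⟩

theorem smoothBound_zero : SmoothBound (fun _ : E => (0 : F)) (fun _ => 0) :=
  ⟨contDiff_const, fun k x => by simp⟩

theorem SmoothBound.sub {f g : E → F} {M M' : ℕ → ℝ} (hf : SmoothBound f M)
    (hg : SmoothBound g M') : SmoothBound (fun x => f x - g x) (fun k => M k + M' k) := by
  refine ⟨hf.1.sub hg.1, fun k x => ?_⟩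
  have hf' := (hf.1.of_le (m := k) (by exact_mod_cast le_top)).contDiffAt (x := x)
  have hg' := (hg.1.of_le (m := k) (by exact_mod_cast le_top)).contDiffAt (x := x)
  have := iteratedFDeriv_sub_apply hf' hg'
  change ‖iteratedFDeriv ℝ k (f - g) x‖ ≤ _
  rw [this]
  exact (norm_sub_le _ _).trans (add_le_add (hf.2 k x) (hg.2 k x))

theorem SmoothBound.sum {ι : Type*} (s : Finset ι) {f : ι → E → F} {M : ι → ℕ → ℝ}
    (hf : ∀ i ∈ s, SmoothBound (f i) (M i)) :
    SmoothBound (fun x => ∑ i ∈ s, f i x) (fun k => ∑ i ∈ s, M i k) := by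
  refine ⟨ContDiff.sum fun i hi => (hf i hi).1, fun k x => ?_⟩
  have := iteratedFDeriv_sum_apply (𝕜 := ℝ) (f := f) (u := s) (n := k) (x := x)
    (fun i hi => ((hf i hi).1.of_le (m := k) (by exact_mod_cast le_top)).contDiffAt)
  rw [← Finset.sum_fn, this]
  exact (norm_sum_le _ _).trans (Finset.sum_le_sum fun i hi => (hf i hi).2 k x)

theorem SmoothBound.clm_comp {G : Type} [NormedAddCommGroup G] [NormedSpace ℝ G] {f : E → F}
    {M : ℕ → ℝ} (hf : SmoothBound f M) (L : F →L[ℝ] G) :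
    SmoothBound (fun x => L (f x)) (fun k => ‖L‖ * M k) := by
  refine ⟨L.contDiff.comp hf.1, fun k x => ?_⟩
  refine (L.norm_iteratedFDeriv_comp_left (f := f) (hf.1.of_le (m := k) (by exact_mod_cast le_top)).contDiffAt le_rfl).trans ?_
  exact mul_le_mul_of_nonneg_left (hf.2 k x) (norm_nonneg _)

theorem SmoothBound.mul {f g : E → ℝ} {M M' : ℕ → ℝ} (hf : SmoothBound f M)
    (hg : SmoothBound g M') : SmoothBound (fun x => f x * g x)
      (fun k => ∑ i ∈ Finset.range (k + 1), (k.choose i : ℝ) * M i * M' (k - i)) := by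
  refine ⟨hf.1.mul hg.1, fun k x => ?_⟩
  refine (norm_iteratedFDeriv_mul_le hf.1 hg.1 x (n := k) (by exact_mod_cast le_top)).trans ?_
  refine Finset.sum_le_sum fun i _ => ?_
  have : 0 ≤ M i := (norm_nonneg _).trans (hf.2 i x)
  gcongr
  · exact hf.2 i x
  · exact hg.2 _ x

theorem SmoothBound.tsum [CompleteSpace F] {ι : Type*} {f : ι → E → F} {M : ι → ℕ → ℝ}
    (hf : ∀ i, SmoothBound (f i) (M i)) (hM : ∀ k, Summable fun i => M i k) :
    SmoothBound (fun x => ∑' i, f i x) (fun k => ∑' i, M i k) := by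
  refine ⟨contDiff_tsum (v := fun k i => M i k) (fun i => (hf i).1) (fun k _ => hM k)
    (fun k i x _ => (hf i).2 k x), fun k x => ?_⟩
  rw [iteratedFDeriv_tsum_apply (N := ⊤) (v := fun k i => M i k) (fun i => (hf i).1)
    (fun k _ => hM k) (fun k i x _ => (hf i).2 k x) le_top]
  exact tsum_of_norm_bounded (hM k).hasSum fun i => (hf i).2 k x

/-- An interpolation inequality for the first derivative. -/
theorem SmoothBound.norm_fderiv_le_of_norm_le {f : E → F} {M : ℕ → ℝ} (hf : SmoothBound f M)
    {e h : ℝ} (he : ∀ x, ‖f x‖ ≤ e) (hh : 0 < h) (x : E) :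
    ‖_root_.fderiv ℝ f x‖ ≤ 2 * e / h + M 2 * h := by
  have he0 : 0 ≤ e := (norm_nonneg _).trans (he x)
  have hM2 : 0 ≤ M 2 := (norm_nonneg _).trans (hf.2 2 x)
  -- The bound on the second derivative makes the first one Lipschitz, so the first-order Taylor
  -- expansion on the ball of radius `h` has an error of at most `M 2 * h * h`.
  have hlip : ∀ y, ‖_root_.fderiv ℝ f y - _root_.fderiv ℝ f x‖ ≤ M 2 * ‖y - x‖ := fun y =>
    convex_univ.norm_image_sub_le_of_norm_fderiv_le (𝕜 := ℝ)
      (fun z _ => hf.fderiv.differentiable z)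
      (fun z _ => hf.fderiv.norm_fderiv_le z) (Set.mem_univ _) (Set.mem_univ _)
  have key : ∀ v : E, ‖v‖ = h → ‖_root_.fderiv ℝ f x v‖ ≤ 2 * e + M 2 * h * h := by
    intro v hv
    have h1 := (convex_closedBall x h).norm_image_sub_le_of_norm_fderiv_le' (𝕜 := ℝ) (f := f)
      (φ := _root_.fderiv ℝ f x) (C := M 2 * h) (x := x) (y := x + v)
      (fun z _ => hf.differentiable z)
      (fun z hz => (hlip z).trans (by
        have : ‖z - x‖ ≤ h := by simpa [dist_eq_norm] using hz
        gcongr)) (by simp [hh.le]) (by simp [hv])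
    have h2 : x + v - x = v := by abel
    rw [h2, hv] at h1
    have h3 : ‖_root_.fderiv ℝ f x v‖ ≤ ‖f (x + v) - f x - _root_.fderiv ℝ f x v‖
        + ‖f (x + v)‖ + ‖f x‖ := by
      have : _root_.fderiv ℝ f x v
        = -(f (x + v) - f x - _root_.fderiv ℝ f x v) + f (x + v) - f x := by abel
      calc ‖_root_.fderiv ℝ f x v‖
        = ‖-(f (x + v) - f x - _root_.fderiv ℝ f x v) + f (x + v) - f x‖ := by rw [← this]
        _ ≤ _ := by
          refine (norm_sub_le _ _).trans ?_
          gcongr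
          refine (norm_add_le _ _).trans ?_
          rw [norm_neg]
    linarith [he x, he (x + v)]
  refine ContinuousLinearMap.opNorm_le_bound _ (by positivity) fun v => ?_
  by_cases hv : v = 0
  · simp [hv]
  have hv' : 0 < ‖v‖ := norm_pos_iff.2 hv
  have h4 := key ((h / ‖v‖) • v) (by
    rw [norm_smul, Real.norm_of_nonneg (by positivity)]; field_simp)
  rw [map_smul, norm_smul, Real.norm_of_nonneg (by positivity)] at h4
  have h5 : ‖_root_.fderiv ℝ f x v‖ = (h / ‖v‖ * ‖_root_.fderiv ℝ f x v‖) * (‖v‖ / h) := by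
    field_simp
  rw [h5]
  calc _ ≤ (2 * e + M 2 * h * h) * (‖v‖ / h) := by gcongr
    _ = _ := by field_simp

/-- Uniform convergence together with a common bound on second derivatives forces the first
derivatives to be uniformly Cauchy, by interpolation. They then satisfy the same hypotheses with
shifted bounds, and the induction continues. -/
theorem smoothBoundUpTo_of_tendsto (N : ℕ) : ∀ {F : Type} [NormedAddCommGroup F]
    [NormedSpace ℝ F] [CompleteSpace F] {f : ℕ → E → F} {g : E → F} {M e : ℕ → ℝ}
    (_ : ∀ m, SmoothBound (f m) M) (_ : Tendsto e atTop (𝓝 0))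
    (_ : ∀ m x, ‖f m x - g x‖ ≤ e m), SmoothBoundUpTo N g M := by
  induction N with
  | zero =>
    intro F _ _ _ f g M e hf he hfg
    have hu : TendstoUniformly f g atTop := by
      rw [Metric.tendstoUniformly_iff]
      intro ε hε
      filter_upwards [he.eventually_lt_const hε] with m hm x
      rw [dist_comm, dist_eq_norm]
      exact (hfg m x).trans_lt hm
    have hlim : ∀ x, Tendsto (fun m => f m x) atTop (𝓝 (g x)) := fun x => hu.tendsto_at x
    refine ⟨?_, fun k hk x => ?_⟩
    · rw [Nat.cast_zero, contDiff_zero]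
      exact hu.continuous (Frequently.of_forall fun m => (hf m).1.continuous)
    · obtain rfl : k = 0 := by omega
      rw [norm_iteratedFDeriv_zero]
      exact le_of_tendsto (hlim x).norm (Eventually.of_forall fun m => (hf m).norm_le x)
  | succ N ih =>
    intro F _ _ _ f g M e hf he hfg
    have hM2 : 0 ≤ M 2 := (norm_nonneg _).trans ((hf 0).2 2 0)
    have hlim : ∀ x, Tendsto (fun m => f m x) atTop (𝓝 (g x)) := fun x => by
      rw [tendsto_iff_norm_sub_tendsto_zero]
      exact squeeze_zero (fun _ => norm_nonneg _) (fun m => hfg m x) he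
    have he0 : ∀ m, 0 ≤ e m := fun m => (norm_nonneg _).trans (hfg m 0)
    have hdiff : ∀ m l x h, 0 < h →
        ‖fderiv ℝ (f m) x - fderiv ℝ (f l) x‖ ≤ 2 * (e m + e l) / h + (M 2 + M 2) * h := by
      intro m l x h hh
      have h1 := ((hf m).sub (hf l)).norm_fderiv_le_of_norm_le (e := e m + e l) (fun y => by
        have : f m y - f l y = (f m y - g y) - (f l y - g y) := by abel
        rw [this]
        exact (norm_sub_le _ _).trans (add_le_add (hfg m y) (hfg l y))) hh x
      have h2 : fderiv ℝ (fun y => f m y - f l y) x = fderiv ℝ (f m) x - fderiv ℝ (f l) x :=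
        fderiv_fun_sub ((hf m).differentiable x) ((hf l).differentiable x)
      rwa [h2] at h1
    have hcau : ∀ ε > 0, ∃ m₀, ∀ m ≥ m₀, ∀ l ≥ m₀, ∀ x,
        ‖fderiv ℝ (f m) x - fderiv ℝ (f l) x‖ ≤ ε := by
      intro ε hε
      -- This step length makes the term `2 * M 2 * h` at most `ε / 2`; the other term is small for
      -- large indices once `h` is fixed.
      set h := ε / (4 * (M 2 + 1)) with hh
      have hh0 : 0 < h := by positivity
      obtain ⟨m₀, hm₀⟩ := eventually_atTop.1 (he.eventually_lt_const
        (show 0 < ε * h / 8 by positivity))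
      refine ⟨m₀, fun m hm l hl x => (hdiff m l x h hh0).trans ?_⟩
      have h1 : 2 * (e m + e l) / h ≤ ε / 2 := by
        rw [div_le_iff₀ hh0]
        linarith [hm₀ m hm, hm₀ l hl]
      have h2 : (M 2 + M 2) * h ≤ ε / 2 := by
        rw [hh]
        rw [mul_div_assoc', div_le_iff₀ (by positivity)]
        nlinarith
      linarith
    have hpt : ∀ x, ∃ L, Tendsto (fun m => fderiv ℝ (f m) x) atTop (𝓝 L) := fun x => by
      refine cauchySeq_tendsto_of_complete (Metric.cauchySeq_iff'.2 fun ε hε => ?_)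
      obtain ⟨m₀, h⟩ := hcau (ε / 2) (by positivity)
      exact ⟨m₀, fun m hm => by rw [dist_eq_norm]; linarith [h m hm m₀ le_rfl x]⟩
    choose G hG using hpt
    have hunif : ∀ ε > 0, ∃ m₀, ∀ m ≥ m₀, ∀ x, ‖fderiv ℝ (f m) x - G x‖ ≤ ε := by
      intro ε hε
      obtain ⟨m₀, h⟩ := hcau ε hε
      refine ⟨m₀, fun m hm x => ?_⟩
      refine le_of_tendsto ((tendsto_const_nhds.sub (hG x)).norm) ?_
      filter_upwards [eventually_ge_atTop m₀] with l hl using h m hm l hl x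
    have htu : TendstoUniformly (fun m => fderiv ℝ (f m)) G atTop := by
      rw [Metric.tendstoUniformly_iff]
      intro ε hε
      obtain ⟨m₀, h⟩ := hunif (ε / 2) (by positivity)
      filter_upwards [eventually_ge_atTop m₀] with m hm x
      rw [dist_comm, dist_eq_norm]
      linarith [h m hm x]
    have hder : ∀ x, HasFDerivAt g (G x) x := fun x =>
      hasFDerivAt_of_tendstoUniformly htu
        (fun m x => ((hf m).differentiable x).hasFDerivAt) hlim x
    have hfg' : fderiv ℝ g = G := funext fun x => (hder x).fderiv
    refine SmoothBoundUpTo.succ (fun x => (hder x).differentiableAt) (fun x =>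
      le_of_tendsto (hlim x).norm (Eventually.of_forall fun m => (hf m).norm_le x)) ?_
    rw [hfg']
    choose! m₀ hm₀ using hunif
    -- The induction hypothesis asks for an explicit null sequence of errors; a choice of indices
    -- supplies one.
    have hφ : ∃ φ : ℕ → ℕ, ∀ j x, ‖fderiv ℝ (f (φ j)) x - G x‖ ≤ 1 / ((j : ℝ) + 1) :=
      ⟨fun j => m₀ (1 / ((j : ℝ) + 1)), fun j x => hm₀ _ (by positivity) _ le_rfl x⟩
    obtain ⟨φ, hφ⟩ := hφ
    exact ih (fun j => (hf (φ j)).fderiv) tendsto_one_div_add_atTop_nhds_zero_nat hφ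

/-- A uniform limit of smooth functions with uniformly bounded derivatives is smooth, with the
same bounds. -/
theorem smoothBound_of_tendsto [CompleteSpace F] {f : ℕ → E → F} {g : E → F} {M e : ℕ → ℝ}
    (hf : ∀ m, SmoothBound (f m) M) (he : Tendsto e atTop (𝓝 0))
    (hfg : ∀ m x, ‖f m x - g x‖ ≤ e m) : SmoothBound g M :=
  smoothBound_iff_upTo.2 fun N => smoothBoundUpTo_of_tendsto N hf he hfg

end SmoothBounds

end

end FracNS

namespace FracNS

noncomputable section

/-! ### Differentiation under the integral sign, to all orders. -/

section Integrals

variable {E : Type} [NormedAddCommGroup E] [NormedSpace ℝ E] [FiniteDimensional ℝ E]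

theorem aestronglyMeasurable_clm_of_apply {F Ω : Type} [NormedAddCommGroup F] [NormedSpace ℝ F]
    [MeasurableSpace Ω] {μ : Measure Ω} {L : Ω → E →L[ℝ] F}
    (hL : ∀ v, AEStronglyMeasurable (fun a => L a v) μ) : AEStronglyMeasurable L μ := by
  let b := Module.finBasis ℝ E
  have h : L = fun a => ∑ i, (LinearMap.toContinuousLinearMap (b.coord i)).smulRight (L a (b i)) := by
    ext a v
    conv_lhs => rw [← b.sum_repr v, map_sum]
    simp
  rw [h]
  refine Finset.aestronglyMeasurable_fun_sum _ fun i _ => ?_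
  exact (ContinuousLinearMap.smulRightL ℝ E F
    (LinearMap.toContinuousLinearMap (b.coord i))).continuous.comp_aestronglyMeasurable (hL (b i))

/-- In finite dimension it suffices to test each direction, and there the derivative is a pointwise
limit of difference quotients along `1 / (m + 1)`. -/
theorem aestronglyMeasurable_fderiv_param {F Ω : Type} [NormedAddCommGroup F] [NormedSpace ℝ F]
    [MeasurableSpace Ω] {μ : Measure Ω} {f : Ω → E → F} (x : E)
    (hm : ∀ x, AEStronglyMeasurable (fun a => f a x) μ)
    (hd : ∀ᵐ a ∂μ, DifferentiableAt ℝ (f a) x) :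
    AEStronglyMeasurable (fun a => fderiv ℝ (f a) x) μ := by
  refine aestronglyMeasurable_clm_of_apply fun v => ?_
  refine aestronglyMeasurable_of_tendsto_ae atTop
    (f := fun (m : ℕ) a => ((m : ℝ) + 1) • (f a (x + (1 / ((m : ℝ) + 1)) • v) - f a x))
    (fun m => ((hm _).sub (hm x)).const_smul _) ?_
  filter_upwards [hd] with a ha
  have h1 : Tendsto (fun m : ℕ => ‖(m : ℝ) + 1‖) atTop atTop :=
    tendsto_norm_atTop_atTop.comp
      (tendsto_atTop_add_const_right _ _ tendsto_natCast_atTop_atTop)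
  have := ha.hasFDerivAt.lim v h1
  simpa only [one_div] using this

theorem smoothBoundUpTo_integral {Ω : Type} [MeasurableSpace Ω] {μ : Measure Ω} (N : ℕ) :
    ∀ {F : Type} [NormedAddCommGroup F] [NormedSpace ℝ F] [CompleteSpace F]
    {f : Ω → E → F} {g : ℕ → Ω → ℝ} (_ : ∀ x, AEStronglyMeasurable (fun a => f a x) μ)
    (_ : ∀ᵐ a ∂μ, SmoothBound (f a) (fun k => g k a)) (_ : ∀ k, Integrable (g k) μ),
    SmoothBoundUpTo N (fun x => ∫ a, f a x ∂μ) (fun k => ∫ a, g k a ∂μ) := by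
  have base : ∀ {F : Type} [NormedAddCommGroup F] [NormedSpace ℝ F] [CompleteSpace F]
      {f : Ω → E → F} {g : ℕ → Ω → ℝ} (_ : ∀ᵐ a ∂μ, SmoothBound (f a) (fun k => g k a))
      (_ : ∀ k, Integrable (g k) μ), ∀ x, ‖∫ a, f a x ∂μ‖ ≤ ∫ a, g 0 a ∂μ := by
    intro F _ _ _ f g hf hg x
    refine norm_integral_le_of_norm_le (hg 0) ?_
    filter_upwards [hf] with a ha using ha.norm_le x
  have hder : ∀ {F : Type} [NormedAddCommGroup F] [NormedSpace ℝ F] [CompleteSpace F]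
      {f : Ω → E → F} {g : ℕ → Ω → ℝ} (_ : ∀ x, AEStronglyMeasurable (fun a => f a x) μ)
      (_ : ∀ᵐ a ∂μ, SmoothBound (f a) (fun k => g k a)) (_ : ∀ k, Integrable (g k) μ),
      ∀ x, HasFDerivAt (fun x => ∫ a, f a x ∂μ) (∫ a, fderiv ℝ (f a) x ∂μ) x := by
    intro F _ _ _ f g hm hf hg x
    refine hasFDerivAt_integral_of_dominated_of_fderiv_le (s := Set.univ) (bound := g 1)
      (F' := fun x a => fderiv ℝ (f a) x) univ_mem (Eventually.of_forall hm)
      (Integrable.mono' (hg 0) (hm x) ?_)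
      (aestronglyMeasurable_fderiv_param x hm ?_) ?_ (hg 1) ?_
    · filter_upwards [hf] with a ha using ha.norm_le x
    · filter_upwards [hf] with a ha using ha.differentiable x
    · filter_upwards [hf] with a ha y _ using ha.norm_fderiv_le y
    · filter_upwards [hf] with a ha y _ using (ha.differentiable y).hasFDerivAt
  induction N with
  | zero =>
    intro F _ _ _ f g hm hf hg
    refine ⟨?_, fun k hk x => ?_⟩
    · rw [Nat.cast_zero, contDiff_zero]
      exact (show Differentiable ℝ _ from fun x =>
        (hder hm hf hg x).differentiableAt).continuous
    · obtain rfl : k = 0 := by omega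
      simpa using base hf hg x
  | succ N ih =>
    intro F _ _ _ f g hm hf hg
    refine SmoothBoundUpTo.succ (fun x => (hder hm hf hg x).differentiableAt) (base hf hg) ?_
    have : fderiv ℝ (fun x => ∫ a, f a x ∂μ) = fun x => ∫ a, fderiv ℝ (f a) x ∂μ :=
      funext fun x => (hder hm hf hg x).fderiv
    rw [this]
    refine ih (g := fun k => g (k + 1)) (fun x => aestronglyMeasurable_fderiv_param x hm ?_) ?_
      (fun k => hg (k + 1))
    · filter_upwards [hf] with a ha using ha.differentiable x
    · filter_upwards [hf] with a ha using ha.fderiv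

/-- Integration of smooth functions which depend on a parameter. -/
theorem smoothBound_integral {Ω F : Type} [MeasurableSpace Ω] {μ : Measure Ω}
    [NormedAddCommGroup F] [NormedSpace ℝ F] [CompleteSpace F]
    {f : Ω → E → F} {g : ℕ → Ω → ℝ} (hm : ∀ x, AEStronglyMeasurable (fun a => f a x) μ)
    (hf : ∀ᵐ a ∂μ, SmoothBound (f a) (fun k => g k a)) (hg : ∀ k, Integrable (g k) μ) :
    SmoothBound (fun x => ∫ a, f a x ∂μ) (fun k => ∫ a, g k a ∂μ) :=
  smoothBound_iff_upTo.2 fun N => smoothBoundUpTo_integral N hm hf hg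

end Integrals

/-! ### Convolution of bounded functions with Schwartz functions. -/

section Convolution

/-- It provides one integrable majorant in `y`, valid for all `x` in a unit ball, as needed to
differentiate the convolution under the integral. -/
theorem exists_schwartz_norm_le_rpow {E F : Type} [NormedAddCommGroup E] [InnerProductSpace ℝ E]
    [NormedAddCommGroup F] [NormedSpace ℝ F]
    (g : 𝓢(E, F)) : ∃ C, 0 ≤ C ∧ ∀ x y z : E, ‖x - z‖ ≤ 1 →
      ‖g (x - y)‖ ≤ C * (1 + ‖z - y‖) ^ (-((Module.finrank ℝ E : ℝ) + 1)) := by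
  set d := Module.finrank ℝ E + 1
  obtain ⟨C, hC⟩ : ∃ C, ∀ x, (1 + ‖x‖) ^ d * ‖g x‖ ≤ C := by
    refine ⟨2 ^ d * ((Finset.Iic (d, 0)).sup fun m => SchwartzMap.seminorm ℝ m.1 m.2) g,
      fun x => ?_⟩
    have := SchwartzMap.one_add_le_sup_seminorm_apply (𝕜 := ℝ) (m := (d, 0)) le_rfl le_rfl g x
    simpa using this
  have hC0 : 0 ≤ C := le_trans (by positivity) (hC 0)
  refine ⟨2 ^ d * C, by positivity, fun x y z hxz => ?_⟩
  have h1 : (1 + ‖z - y‖) ≤ 2 * (1 + ‖x - y‖) := by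
    have : ‖z - y‖ ≤ ‖x - z‖ + ‖x - y‖ := by
      have h : z - y = -(x - z) + (x - y) := by abel
      rw [h]
      exact (norm_add_le _ _).trans (by rw [norm_neg])
    linarith [norm_nonneg (x - y)]
  have h2 : (1 + ‖z - y‖) ^ (-((Module.finrank ℝ E : ℝ) + 1)) = ((1 + ‖z - y‖) ^ d)⁻¹ := by
    rw [Real.rpow_neg (by positivity), ← Real.rpow_natCast]
    simp [d]
  rw [h2, ← div_eq_mul_inv, le_div_iff₀ (by positivity)]
  calc ‖g (x - y)‖ * (1 + ‖z - y‖) ^ d ≤ ‖g (x - y)‖ * (2 * (1 + ‖x - y‖)) ^ d := by gcongr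
    _ = 2 ^ d * ((1 + ‖x - y‖) ^ d * ‖g (x - y)‖) := by rw [mul_pow]; ring
    _ ≤ _ := by gcongr; exact hC _

variable {E : Type} [NormedAddCommGroup E] [InnerProductSpace ℝ E] [FiniteDimensional ℝ E]
  [MeasurableSpace E] [BorelSpace E]

theorem integrable_bounded_smul_schwartz {F : Type} [NormedAddCommGroup F] [NormedSpace ℝ F]
    [NormedSpace ℂ F] (g : 𝓢(E, F)) {w : E → ℂ} {A : ℝ} (hw : AEStronglyMeasurable w volume)
    (hA : ∀ᵐ y, ‖w y‖ ≤ A) (x : E) : Integrable (fun y => w y • g (x - y)) := by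
  exact ((g.integrable (μ := volume)).comp_sub_left x).bdd_smul A hw hA

theorem smoothBoundUpTo_schwartz_convolution {w : E → ℂ} {A : ℝ}
    (hw : AEStronglyMeasurable w volume) (hA : ∀ᵐ y, ‖w y‖ ≤ A) (N : ℕ) :
    ∀ {F : Type} [NormedAddCommGroup F] [NormedSpace ℝ F] [NormedSpace ℂ F] [SMulCommClass ℝ ℂ F]
    [CompleteSpace F] (g : 𝓢(E, F)), SmoothBoundUpTo N (fun x => ∫ y, w y • g (x - y))
      (fun k => A * ∫ y, ‖iteratedFDeriv ℝ k g y‖) := by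
  have base : ∀ {F : Type} [NormedAddCommGroup F] [NormedSpace ℝ F] [NormedSpace ℂ F]
      (g : 𝓢(E, F)) x, ‖∫ y, w y • g (x - y)‖ ≤ A * ∫ y, ‖iteratedFDeriv ℝ 0 g y‖ := by
    intro F _ _ _ g x
    simp only [norm_iteratedFDeriv_zero]
    rw [← integral_sub_left_eq_self (fun y => ‖g y‖) volume x, ← integral_const_mul]
    refine norm_integral_le_of_norm_le
      (((g.integrable (μ := volume)).norm.comp_sub_left x).const_mul A) ?_
    filter_upwards [hA] with y hy
    rw [norm_smul]
    gcongr
  have hder : ∀ {F : Type} [NormedAddCommGroup F] [NormedSpace ℝ F] [NormedSpace ℂ F]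
      [SMulCommClass ℝ ℂ F] (g : 𝓢(E, F)) x, HasFDerivAt (fun x => ∫ y, w y • g (x - y))
      (∫ y, w y • SchwartzMap.fderivCLM ℝ E F g (x - y)) x := by
    intro F _ _ _ _ g x
    obtain ⟨C, hC0, hC⟩ := exists_schwartz_norm_le_rpow (SchwartzMap.fderivCLM ℝ E F g)
    have hd : ∀ z y, HasFDerivAt (fun z => w y • g (z - y))
        (w y • SchwartzMap.fderivCLM ℝ E F g (z - y)) z := by
      intro z y
      have h1 : HasFDerivAt (fun z => g (z - y)) (SchwartzMap.fderivCLM ℝ E F g (z - y)) z := by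
        have := (g.differentiableAt (x := z - y)).hasFDerivAt
        simpa [Function.comp_def] using this.comp z ((hasFDerivAt_id z).sub_const y)
      exact h1.const_smul (w y)
    refine hasFDerivAt_integral_of_dominated_of_fderiv_le (s := Metric.ball x 1)
      (bound := fun y => A * (C * (1 + ‖x - y‖) ^ (-((Module.finrank ℝ E : ℝ) + 1))))
      (F' := fun z y => w y • SchwartzMap.fderivCLM ℝ E F g (z - y))
      (Metric.ball_mem_nhds x one_pos)
      (Eventually.of_forall fun z => (integrable_bounded_smul_schwartz g hw hA z).1)
      (integrable_bounded_smul_schwartz g hw hA x)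
      (integrable_bounded_smul_schwartz _ hw hA x).1 ?_ ?_
      (ae_of_all _ fun y z _ => hd z y)
    · filter_upwards [hA] with y hy z hz
      rw [norm_smul]
      have h1 := hC z y x (by rw [← dist_eq_norm]; exact (Metric.mem_ball.1 hz).le)
      have : 0 ≤ A := (norm_nonneg _).trans hy
      gcongr
    · have := (integrable_one_add_norm (E := E) (μ := volume)
        (r := (Module.finrank ℝ E : ℝ) + 1) (by linarith)).comp_sub_left x
      exact (this.const_mul C).const_mul A
  induction N with
  | zero =>
    intro F _ _ _ _ _ g
    refine ⟨?_, fun k hk x => ?_⟩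
    · rw [Nat.cast_zero, contDiff_zero]
      exact (show Differentiable ℝ _ from fun x => (hder g x).differentiableAt).continuous
    · obtain rfl : k = 0 := by omega
      simpa using base g x
  | succ N ih =>
    intro F _ _ _ _ _ g
    refine SmoothBoundUpTo.succ (fun x => (hder g x).differentiableAt) (base g) ?_
    have h1 : fderiv ℝ (fun x => ∫ y, w y • g (x - y))
        = fun x => ∫ y, w y • SchwartzMap.fderivCLM ℝ E F g (x - y) :=
      funext fun x => (hder g x).fderiv
    rw [h1]
    have h2 : (fun k => A * ∫ y, ‖iteratedFDeriv ℝ (k + 1) g y‖)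
        = fun k => A * ∫ y, ‖iteratedFDeriv ℝ k (SchwartzMap.fderivCLM ℝ E F g) y‖ := by
      funext k
      congr 2
      funext y
      rw [← norm_iteratedFDeriv_fderiv]
      rfl
    rw [h2]
    exact ih _

/-- The convolution of a bounded function with a Schwartz function is smooth. -/
theorem smoothBound_schwartz_convolution {F : Type} [NormedAddCommGroup F] [NormedSpace ℝ F]
    [NormedSpace ℂ F] [SMulCommClass ℝ ℂ F] [CompleteSpace F] (g : 𝓢(E, F)) {w : E → ℂ} {A : ℝ}
    (hw : AEStronglyMeasurable w volume) (hA : ∀ᵐ y, ‖w y‖ ≤ A) :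
    SmoothBound (fun x => ∫ y, w y • g (x - y))
      (fun k => A * ∫ y, ‖iteratedFDeriv ℝ k g y‖) :=
  smoothBound_iff_upTo.2 fun N => smoothBoundUpTo_schwartz_convolution hw hA N g

end Convolution

end

end FracNS

namespace FracNS

noncomputable section

/-! ### Functions of `(-Δ)^α` localized to an annulus, as Schwartz functions. -/

section Profile

/-- The symbol of `(-Δ)^α`. -/
def fracSymbol {E : Type} [NormedAddCommGroup E] (α : ℝ) (ξ : E) : ℝ := (2 * Real.pi * ‖ξ‖) ^ (2 * α)

theorem fracSymbol_pos {E : Type} [NormedAddCommGroup E] (α : ℝ) {ξ : E} (h : ξ ≠ 0) : 0 < fracSymbol α ξ := by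
  unfold fracSymbol; positivity

variable {E : Type} [NormedAddCommGroup E] [InnerProductSpace ℝ E]

theorem contDiffAt_fracSymbol (α : ℝ) {ξ : E} (h : ξ ≠ 0) : ContDiffAt ℝ ∞ (fracSymbol α) ξ := by
  have h1 : ContDiffAt ℝ ∞ (fun ξ : E => 2 * Real.pi * ‖ξ‖) ξ :=
    contDiffAt_const.mul (contDiffAt_norm ℝ h)
  exact h1.rpow_const_of_ne (by positivity)

theorem fracSymbol_smul (α : ℝ) {c : ℝ} (hc : 0 ≤ c) (ξ : E) :
    fracSymbol α (c • ξ) = c ^ (2 * α) * fracSymbol α ξ := by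
  unfold fracSymbol
  rw [norm_smul, Real.norm_of_nonneg hc, ← Real.mul_rpow hc (by positivity)]
  congr 1; ring

/-- A smooth function which is compactly supported away from the origin. -/
structure IsAnnular (χ : E → ℂ) : Prop where
  contDiff : ContDiff ℝ ∞ χ
  hasCompactSupport : HasCompactSupport χ
  zero_notMem : (0 : E) ∉ tsupport χ

theorem IsAnnular.smul_comp_contDiff {χ : E → ℂ} (hχ : IsAnnular χ) (α : ℝ) {g : ℝ → ℝ}
    (hg : ContDiff ℝ ∞ g) : ContDiff ℝ ∞ (fun ξ => g (fracSymbol α ξ) • χ ξ) := by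
  rw [contDiff_iff_contDiffAt]
  intro ξ
  by_cases hξ : ξ = 0
  · have : (fun ξ => g (fracSymbol α ξ) • χ ξ) =ᶠ[𝓝 ξ] fun _ => 0 := by
      rw [hξ]
      filter_upwards [(isClosed_tsupport χ).isOpen_compl.mem_nhds hχ.zero_notMem] with η hη
      rw [image_eq_zero_of_notMem_tsupport hη, smul_zero]
    exact contDiffAt_const.congr_of_eventuallyEq this
  · exact (hg.contDiffAt.comp ξ (contDiffAt_fracSymbol α hξ)).smul hχ.contDiff.contDiffAt

theorem IsAnnular.smul_comp_hasCompactSupport {χ : E → ℂ} (hχ : IsAnnular χ) (α : ℝ)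
    (g : ℝ → ℝ) : HasCompactSupport (fun ξ => g (fracSymbol α ξ) • χ ξ) :=
  hχ.hasCompactSupport.mono' (by
    refine Function.support_subset_iff'.2 fun ξ hξ => ?_
    rw [image_eq_zero_of_notMem_tsupport hξ, smul_zero])

/-- The Schwartz function `g ((2π|ξ|)^(2α)) χ(ξ)`. -/
def profile {χ : E → ℂ} (hχ : IsAnnular χ) (α : ℝ) {g : ℝ → ℝ} (hg : ContDiff ℝ ∞ g) : 𝓢(E, ℂ) :=
  HasCompactSupport.toSchwartzMap (f := fun ξ => g (fracSymbol α ξ) • χ ξ)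
    (hχ.smul_comp_hasCompactSupport α g) (hχ.smul_comp_contDiff α hg)

theorem profile_apply {χ : E → ℂ} (hχ : IsAnnular χ) (α : ℝ) {g : ℝ → ℝ} (hg : ContDiff ℝ ∞ g)
    (ξ : E) : profile hχ α hg ξ = g (fracSymbol α ξ) • χ ξ := rfl

/-- The chain and Leibniz rules apply on the complement of the origin, where `fracSymbol α` is
smooth. On the compact support of `χ` its values lie in an interval `[c₀, c₁]` with `c₀ > 0`. The
constants are chosen before `g`, which allows `g` to depend on time. -/
theorem norm_iteratedFDeriv_profile_le {χ : E → ℂ} (hχ : IsAnnular χ) (α : ℝ)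
    (J : ℕ) :
    ∃ C, 0 ≤ C ∧ ∃ c₀, 0 < c₀ ∧ ∃ c₁, ∀ (g : ℝ → ℝ) (hg : ContDiff ℝ ∞ g) (A : ℝ),
      (∀ i ≤ J, ∀ z, c₀ ≤ z → z ≤ c₁ → ‖iteratedFDeriv ℝ i g z‖ ≤ A) →
      ∀ j ≤ J, ∀ ξ, ‖iteratedFDeriv ℝ j (profile hχ α hg) ξ‖ ≤ C * A := by
  by_cases hne : (tsupport χ).Nonempty
  swap
  · refine ⟨0, le_rfl, 1, one_pos, 1, fun g hg A hA j _ ξ => ?_⟩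
    have h0 : χ = 0 := by
      ext ξ
      exact image_eq_zero_of_notMem_tsupport fun h => hne ⟨ξ, h⟩
    have : (profile hχ α hg : E → ℂ) = fun _ => 0 := by
      ext ξ; rw [profile_apply, h0]; simp
    rw [this]
    simp
  have hK : IsCompact (tsupport χ) := hχ.hasCompactSupport
  have hK0 : ∀ ξ ∈ tsupport χ, ξ ≠ 0 := fun ξ h h' => hχ.zero_notMem (h' ▸ h)
  set U : Set E := {0}ᶜ with hU
  have hUo : IsOpen U := isOpen_compl_singleton
  have hpU : ContDiffOn ℝ ∞ (fracSymbol α) U := fun ξ h =>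
    (contDiffAt_fracSymbol α h).contDiffWithinAt
  have hpc : ContinuousOn (fracSymbol α) (tsupport χ) := fun ξ h =>
    (contDiffAt_fracSymbol α (hK0 ξ h)).continuousAt.continuousWithinAt
  obtain ⟨ξ₀, hξ₀, hmin⟩ := hK.exists_isMinOn hne hpc
  obtain ⟨ξ₁, hξ₁, hmax⟩ := hK.exists_isMaxOn hne hpc
  have hder : ∀ i : ℕ, ∃ D, ∀ ξ ∈ tsupport χ, ‖iteratedFDerivWithin ℝ i (fracSymbol α) U ξ‖ ≤ D :=
    fun i => hK.exists_bound_of_continuousOn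
      ((hpU.continuousOn_iteratedFDerivWithin (m := i) (by exact_mod_cast le_top)
        hUo.uniqueDiffOn).mono fun ξ h => hK0 ξ h)
  have hder' : ∀ i : ℕ, ∃ D, ∀ ξ, ‖iteratedFDeriv ℝ i χ ξ‖ ≤ D :=
    fun i => (hχ.hasCompactSupport.iteratedFDeriv i).exists_bound_of_continuous
      (hχ.contDiff.continuous_iteratedFDeriv (by exact_mod_cast le_top))
  choose D hD using hder
  choose B hB using hder'
  -- The summand `1` ensures `D' ≤ D' ^ l` for `l ≥ 1`, the form in which the estimate for
  -- compositions wants its bounds.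
  set D' : ℝ := 1 + ∑ i ∈ Finset.range (J + 1), |D i|
  have hD'1 : 1 ≤ D' := by
    have : 0 ≤ ∑ i ∈ Finset.range (J + 1), |D i| := Finset.sum_nonneg fun i _ => abs_nonneg _
    simp only [D']; linarith
  have hDD : ∀ i ≤ J, D i ≤ D' := fun i hi => by
    have := Finset.single_le_sum (f := fun i => |D i|) (fun i _ => abs_nonneg _)
      (Finset.mem_range.2 (Nat.lt_succ_of_le hi))
    have h2 := le_abs_self (D i)
    simp only [D']; linarith
  set B' : ℝ := ∑ i ∈ Finset.range (J + 1), |B i|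
  have hBB : ∀ i ≤ J, B i ≤ B' := fun i hi => by
    have := Finset.single_le_sum (f := fun i => |B i|) (fun i _ => abs_nonneg _)
      (Finset.mem_range.2 (Nat.lt_succ_of_le hi))
    exact (le_abs_self _).trans this
  have hB'0 : 0 ≤ B' := Finset.sum_nonneg fun i _ => abs_nonneg _
  refine ⟨∑ i ∈ Finset.range (J + 1), (J.factorial : ℝ) * (J.factorial * D' ^ J) * B',
    by positivity, fracSymbol α ξ₀, fracSymbol_pos α (hK0 _ hξ₀), fracSymbol α ξ₁, ?_⟩
  intro g hg A hA j hj ξ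
  by_cases hξ : ξ ∈ tsupport χ
  swap
  · have hA0 : 0 ≤ A := (norm_nonneg _).trans (hA 0 (Nat.zero_le _) _ le_rfl
      (isMinOn_iff.1 hmin ξ₁ hξ₁))
    have : iteratedFDeriv ℝ j (profile hχ α hg) ξ = 0 := by
      by_contra h
      have h1 := support_iteratedFDeriv_subset j (Function.mem_support.2 h)
      exact hξ (closure_mono (Function.support_smul_subset_right (fun ξ => g (fracSymbol α ξ)) χ) h1)
    rw [this, norm_zero]
    positivity
  have hξU : ξ ∈ U := hK0 ξ hξ
  have hA0 : 0 ≤ A := (norm_nonneg _).trans (hA 0 (Nat.zero_le _) _ le_rfl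
      (isMinOn_iff.1 hmin ξ₁ hξ₁))
  rw [← iteratedFDerivWithin_of_isOpen j hUo hξU]
  have hcomp : ∀ i ≤ J, ‖iteratedFDerivWithin ℝ i (g ∘ fracSymbol α) U ξ‖
      ≤ J.factorial * A * D' ^ J := by
    intro i hi
    have h1 := norm_iteratedFDerivWithin_comp_le (𝕜 := ℝ) (g := g) (f := fracSymbol α) (n := i)
      (N := ∞) (s := U) (t := Set.univ) (C := A) (D := D') hg.contDiffOn hpU
      (by exact_mod_cast le_top)
      uniqueDiffOn_univ hUo.uniqueDiffOn (Set.mapsTo_univ _ _) hξU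
      (fun l hl => by
        rw [iteratedFDerivWithin_univ]
        exact hA l (hl.trans hi) _ (isMinOn_iff.1 hmin ξ hξ) (isMaxOn_iff.1 hmax ξ hξ))
      (fun l hl1 hl => (hD l ξ hξ).trans ((hDD l (hl.trans hi)).trans
        (le_self_pow₀ hD'1 (by omega))))
    refine h1.trans ?_
    gcongr
  have h2 := norm_iteratedFDerivWithin_smul_le (𝕜 := ℝ) (f := g ∘ fracSymbol α) (g := χ) (n := j)
    (N := ∞) (hg.comp_contDiffOn hpU) hχ.contDiff.contDiffOn hUo.uniqueDiffOn hξU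
    (by exact_mod_cast le_top)
  refine h2.trans ?_
  rw [Finset.sum_mul]
  calc _ ≤ ∑ i ∈ Finset.range (j + 1), (J.factorial : ℝ) * (J.factorial * D' ^ J) * B' * A := by
        refine Finset.sum_le_sum fun i hi => ?_
        have hi' : i ≤ j := Nat.lt_succ_iff.1 (Finset.mem_range.1 hi)
        have h3 : (j.choose i : ℝ) ≤ J.factorial := by
          have : j.choose i ≤ J.factorial := by
            refine le_trans ?_ (Nat.factorial_le hj)
            rw [Nat.choose_eq_factorial_div_factorial hi']
            exact Nat.div_le_self _ _
          exact_mod_cast this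
        have h4 : ‖iteratedFDerivWithin ℝ (j - i) χ U ξ‖ ≤ B' := by
          rw [iteratedFDerivWithin_of_isOpen _ hUo hξU]
          exact (hB _ ξ).trans (hBB _ (by omega))
        calc _ ≤ (J.factorial : ℝ) * (J.factorial * A * D' ^ J) * B' := by
              gcongr
              exact hcomp i (hi'.trans hj)
          _ = _ := by ring
    _ ≤ _ := by
        refine Finset.sum_le_sum_of_subset_of_nonneg ?_ fun i _ _ => by positivity
        exact Finset.range_subset_range.2 (by omega)

/-- A functional on Schwartz space which is bounded by finitely many seminorms. -/
def SchwartzBounded (q : 𝓢(E, ℂ) → ℝ) : Prop :=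
  ∃ (s : Finset (ℕ × ℕ)) (C : ℝ), 0 ≤ C ∧ ∀ ψ, q ψ ≤ C * ∑ m ∈ s, SchwartzMap.seminorm ℂ m.1 m.2 ψ

theorem SchwartzBounded.profile_le {q : 𝓢(E, ℂ) → ℝ} (hq : SchwartzBounded q) {χ : E → ℂ}
    (hχ : IsAnnular χ) (α : ℝ) :
    ∃ J : ℕ, ∃ C, 0 ≤ C ∧ ∃ c₀, 0 < c₀ ∧ ∃ c₁, ∀ (g : ℝ → ℝ) (hg : ContDiff ℝ ∞ g) (A : ℝ), 0 ≤ A →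
      (∀ i ≤ J, ∀ z, c₀ ≤ z → z ≤ c₁ → ‖iteratedFDeriv ℝ i g z‖ ≤ A) →
      q (profile hχ α hg) ≤ C * A := by
  obtain ⟨s, C₁, hC₁, hq⟩ := hq
  set J := s.sup Prod.snd
  obtain ⟨C, hC, c₀, hc₀, c₁, h⟩ := norm_iteratedFDeriv_profile_le hχ α J
  obtain ⟨R, hR⟩ := hχ.hasCompactSupport.isBounded.subset_closedBall (0 : E)
  refine ⟨J, C₁ * ∑ m ∈ s, |R| ^ m.1 * C, by positivity, c₀, hc₀, c₁, fun g hg A hA0 hA => ?_⟩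
  refine (hq _).trans ?_
  rw [mul_assoc, Finset.sum_mul]
  refine mul_le_mul_of_nonneg_left (Finset.sum_le_sum fun m hm => ?_) hC₁
  refine SchwartzMap.seminorm_le_bound ℂ _ _ _ (by positivity) fun ξ => ?_
  by_cases hξ : ξ ∈ tsupport χ
  · have h1 : ‖ξ‖ ≤ |R| := by
      have := hR hξ
      rw [mem_closedBall_zero_iff] at this
      exact this.trans (le_abs_self _)
    have h2 := h g hg A hA m.2 (Finset.le_sup hm) ξ
    calc _ ≤ |R| ^ m.1 * (C * A) := by gcongr
      _ = _ := by ring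
  · have : iteratedFDeriv ℝ m.2 (profile hχ α hg) ξ = 0 := by
      by_contra h
      have h1 := support_iteratedFDeriv_subset _ (Function.mem_support.2 h)
      exact hξ (closure_mono (Function.support_smul_subset_right (fun ξ => g (fracSymbol α ξ)) χ) h1)
    rw [this, norm_zero, mul_zero]
    positivity

theorem contDiff_exp_neg_mul (s : ℝ) : ContDiff ℝ ∞ (fun z : ℝ => Real.exp (-s * z)) := by
  fun_prop

theorem contDiff_exp_neg_mul_sub_one (s : ℝ) :
    ContDiff ℝ ∞ (fun z : ℝ => Real.exp (-s * z) - 1) := by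
  fun_prop

theorem norm_iteratedFDeriv_exp_neg_mul (s z : ℝ) (i : ℕ) :
    ‖iteratedFDeriv ℝ i (fun z : ℝ => Real.exp (-s * z)) z‖ = |s| ^ i * Real.exp (-s * z) := by
  rw [norm_iteratedFDeriv_eq_norm_iteratedDeriv, iteratedDeriv_exp_const_mul]
  simp

/-- One term of the exponential series, applied at `(1 + s) * c`, turns exponential decay into
polynomial decay of any order while absorbing the powers of `s` produced by differentiation. -/
theorem pow_mul_exp_neg_le {c : ℝ} (hc : 0 < c) (i N : ℕ) :
    ∃ C, 0 ≤ C ∧ ∀ s, 0 ≤ s → s ^ i * Real.exp (-s * c) ≤ C * ((1 + s) ^ N)⁻¹ := by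
  refine ⟨(i + N).factorial * (1 / c) ^ (i + N) * Real.exp c, by positivity, fun s hs => ?_⟩
  rw [← div_eq_mul_inv, le_div_iff₀ (by positivity)]
  have h1 : ((1 + s) * c) ^ (i + N) / (i + N).factorial ≤ Real.exp ((1 + s) * c) :=
    Real.pow_div_factorial_le_exp _ (by positivity) _
  have h2 : Real.exp ((1 + s) * c) = Real.exp c * Real.exp (s * c) := by
    rw [← Real.exp_add]; congr 1; ring
  have h3 : Real.exp (-s * c) = (Real.exp (s * c))⁻¹ := by rw [← Real.exp_neg]; congr 1; ring
  rw [h2, div_le_iff₀ (by positivity), mul_pow] at h1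
  rw [h3]
  have h4 : (1 + s) ^ (i + N) ≤ (i + N).factorial * (1 / c) ^ (i + N) * Real.exp c
      * Real.exp (s * c) := by
    rw [one_div, inv_pow]
    calc (1 + s) ^ (i + N) = ((1 + s) ^ (i + N) * c ^ (i + N)) * (c ^ (i + N))⁻¹ := by
          field_simp
      _ ≤ (Real.exp c * Real.exp (s * c) * (i + N).factorial) * (c ^ (i + N))⁻¹ := by gcongr
      _ = _ := by ring
  calc s ^ i * (Real.exp (s * c))⁻¹ * (1 + s) ^ N
      ≤ (1 + s) ^ i * (Real.exp (s * c))⁻¹ * (1 + s) ^ N := by gcongr; linarith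
    _ = (1 + s) ^ (i + N) * (Real.exp (s * c))⁻¹ := by ring
    _ ≤ (((i + N).factorial * (1 / c) ^ (i + N) * Real.exp c * Real.exp (s * c)))
        * (Real.exp (s * c))⁻¹ := by gcongr
    _ = _ := by field_simp

theorem SchwartzBounded.profile_exp_le {q : 𝓢(E, ℂ) → ℝ} (hq : SchwartzBounded q) {χ : E → ℂ}
    (hχ : IsAnnular χ) (α : ℝ) (N : ℕ) :
    ∃ C, 0 ≤ C ∧ ∀ s, 0 ≤ s → q (profile hχ α (contDiff_exp_neg_mul s)) ≤ C * ((1 + s) ^ N)⁻¹ := by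
  obtain ⟨J, C, hC, c₀, hc₀, c₁, h⟩ := hq.profile_le hχ α
  choose B hB0 hB using fun i => pow_mul_exp_neg_le hc₀ i N
  refine ⟨C * ∑ i ∈ Finset.range (J + 1), B i,
    mul_nonneg hC (Finset.sum_nonneg fun i _ => hB0 i), fun s hs => ?_⟩
  have hsum : 0 ≤ ∑ i ∈ Finset.range (J + 1), B i := Finset.sum_nonneg fun i _ => hB0 i
  rw [mul_assoc]
  refine h _ _ _ (by positivity) fun i hi z hz _ => ?_
  rw [norm_iteratedFDeriv_exp_neg_mul, abs_of_nonneg hs]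
  calc s ^ i * Real.exp (-s * z) ≤ s ^ i * Real.exp (-s * c₀) := by
        gcongr ?_ * Real.exp ?_
        nlinarith
    _ ≤ B i * ((1 + s) ^ N)⁻¹ := hB i s hs
    _ ≤ _ := by
        gcongr
        exact Finset.single_le_sum (f := B) (fun i _ => hB0 i)
          (Finset.mem_range.2 (Nat.lt_succ_of_le hi))

/-- The gain of one factor `s` is what makes the low-frequency part of `S(t) - 1` summable. -/
theorem SchwartzBounded.profile_exp_sub_one_le {q : 𝓢(E, ℂ) → ℝ} (hq : SchwartzBounded q)
    {χ : E → ℂ} (hχ : IsAnnular χ) (α : ℝ) :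
    ∃ C, 0 ≤ C ∧ ∀ s, 0 ≤ s → s ≤ 1 →
      q (profile hχ α (contDiff_exp_neg_mul_sub_one s)) ≤ C * s := by
  obtain ⟨J, C, hC, c₀, hc₀, c₁, h⟩ := hq.profile_le hχ α
  refine ⟨C * (1 + |c₁|), by positivity, fun s hs hs1 => ?_⟩
  rw [mul_assoc]
  refine h _ _ _ (by positivity) fun i hi z hz hz1 => ?_
  have hz0 : 0 ≤ z := hc₀.le.trans hz
  cases i with
  | zero =>
    rw [norm_iteratedFDeriv_zero, Real.norm_eq_abs, abs_sub_comm, abs_of_nonneg]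
    · have h1 := Real.add_one_le_exp (-s * z)
      have h2 : s * z ≤ s * |c₁| := by
        gcongr
        exact hz1.trans (le_abs_self _)
      nlinarith
    · have : Real.exp (-s * z) ≤ 1 := Real.exp_le_one_iff.2 (by nlinarith)
      linarith
  | succ i =>
    have h1 : ‖iteratedFDeriv ℝ (i + 1) (fun z : ℝ => Real.exp (-s * z) - 1) z‖
        = ‖iteratedFDeriv ℝ (i + 1) (fun z : ℝ => Real.exp (-s * z)) z‖ := by
      rw [norm_iteratedFDeriv_eq_norm_iteratedDeriv, norm_iteratedFDeriv_eq_norm_iteratedDeriv,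
        iteratedDeriv_succ', iteratedDeriv_succ']
      congr 2
      funext z
      exact deriv_sub_const _
    rw [h1, norm_iteratedFDeriv_exp_neg_mul, abs_of_nonneg hs, pow_succ]
    have h2 : s ^ i ≤ 1 := pow_le_one₀ hs hs1
    have h3 : Real.exp (-s * z) ≤ 1 := Real.exp_le_one_iff.2 (by nlinarith)
    calc s ^ i * s * Real.exp (-s * z) ≤ 1 * s * 1 := by gcongr
      _ ≤ _ := by nlinarith [abs_nonneg c₁]

end Profile

end

end FracNS

namespace FracNS

noncomputable section

/-! ### Functionals on Schwartz space and dilations. -/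

section Schwartz

variable {E : Type} [NormedAddCommGroup E] [InnerProductSpace ℝ E]

/-- A continuous linear map pulls continuous seminorms back to continuous ones, and these are
bounded by finitely many Schwartz seminorms. With the inverse Fourier transform as `T` it passes
from symbols to kernels. -/
theorem SchwartzBounded.comp {q : 𝓢(E, ℂ) → ℝ} (hq : SchwartzBounded q)
    (T : 𝓢(E, ℂ) →L[ℂ] 𝓢(E, ℂ)) : SchwartzBounded (fun ψ => q (T ψ)) := by
  obtain ⟨s, C, hC, h⟩ := hq
  let p : Seminorm ℂ 𝓢(E, ℂ) := (∑ m ∈ s, SchwartzMap.seminorm ℂ m.1 m.2).comp T.toLinearMap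
  have hp : ∀ ψ, p ψ = ∑ m ∈ s, SchwartzMap.seminorm ℂ m.1 m.2 (T ψ) := fun ψ => by
    simp only [p, Seminorm.comp_apply]
    change (∑ m ∈ s, SchwartzMap.seminorm ℂ m.1 m.2) (T ψ) = _
    induction s using Finset.cons_induction with
    | empty => simp
    | cons a s ha ih => simp
  have hpc : Continuous p := by
    have : (p : 𝓢(E, ℂ) → ℝ) = fun ψ => ∑ m ∈ s, SchwartzMap.seminorm ℂ m.1 m.2 (T ψ) :=
      funext hp
    rw [this]
    refine continuous_finsetSum _ fun m _ => ?_
    exact ((schwartz_withSeminorms ℂ E ℂ).continuous_seminorm m).comp T.continuous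
  obtain ⟨s', C', -, h'⟩ := Seminorm.bound_of_continuous (schwartz_withSeminorms ℂ E ℂ) p hpc
  refine ⟨s', C * C', by positivity, fun ψ => (h _).trans ?_⟩
  rw [mul_assoc]
  refine mul_le_mul_of_nonneg_left ?_ hC
  rw [← hp]
  refine (h' ψ).trans ?_
  rw [smul_apply, NNReal.smul_def, smul_eq_mul]
  refine mul_le_mul_of_nonneg_left ?_ C'.2
  refine Seminorm.finset_sup_apply_le (Finset.sum_nonneg fun i _ => apply_nonneg _ _) fun m hm => ?_
  exact Finset.single_le_sum (f := fun m => SchwartzMap.seminorm ℂ m.1 m.2 ψ)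
    (fun i _ => apply_nonneg _ _) hm

/-- The Schwartz function `ψ(c⁻¹ ξ)`. -/
def dilate (c : ℝ) (hc : c ≠ 0) (ψ : 𝓢(E, ℂ)) : 𝓢(E, ℂ) :=
  SchwartzMap.compCLMOfContinuousLinearEquiv ℂ
    (ContinuousLinearEquiv.smulLeft (Units.mk0 c⁻¹ (inv_ne_zero hc)) : E ≃L[ℝ] E) ψ

theorem dilate_apply (c : ℝ) (hc : c ≠ 0) (ψ : 𝓢(E, ℂ)) (ξ : E) :
    dilate c hc ψ ξ = ψ (c⁻¹ • ξ) := rfl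

end Schwartz

theorem integrable_tsum_of_summable_integral_norm {X : Type} [MeasurableSpace X] {μ : Measure X}
    {f : ℤ → X → ℂ} (hf : ∀ l, Integrable (f l) μ) (hs : Summable fun l => ∫ x, ‖f l x‖ ∂μ) :
    Integrable (fun x => ∑' l, f l x) μ ∧
      ∫ x, ‖∑' l, f l x‖ ∂μ ≤ ∑' l, ∫ x, ‖f l x‖ ∂μ := by
  have h1 : ∀ l, ∫⁻ x, ‖f l x‖ₑ ∂μ = ENNReal.ofReal (∫ x, ‖f l x‖ ∂μ) := fun l =>
    (ofReal_integral_norm_eq_lintegral_enorm (hf l)).symm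
  have h2 : ∫⁻ x, ∑' l, ‖f l x‖ₑ ∂μ = ENNReal.ofReal (∑' l, ∫ x, ‖f l x‖ ∂μ) := by
    rw [lintegral_tsum fun l => (hf l).1.enorm, ENNReal.ofReal_tsum_of_nonneg
      (fun l => integral_nonneg fun _ => norm_nonneg _) hs]
    exact tsum_congr h1
  have h3 : ∀ᵐ x ∂μ, Summable fun l => f l x := by
    have := ae_lt_top' (μ := μ) (f := fun x => ∑' l, ‖f l x‖ₑ)
      (AEMeasurable.tsum fun l => (hf l).1.enorm) (by rw [h2]; exact ENNReal.ofReal_ne_top)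
    filter_upwards [this] with x hx
    refine Summable.of_nnnorm ?_
    exact ENNReal.tsum_coe_ne_top_iff_summable.1 hx.ne
  have hm : AEStronglyMeasurable (fun x => ∑' l, f l x) μ := by
    refine aestronglyMeasurable_of_tendsto_ae atTop
      (f := fun (s : Finset ℤ) x => ∑ l ∈ s, f l x)
      (fun s => Finset.aestronglyMeasurable_fun_sum _ fun l _ => (hf l).1) ?_
    filter_upwards [h3] with x hx using hx.hasSum
  have h4 : ∫⁻ x, ‖∑' l, f l x‖ₑ ∂μ ≤ ENNReal.ofReal (∑' l, ∫ x, ‖f l x‖ ∂μ) := by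
    rw [← h2]
    exact lintegral_mono fun x => enorm_tsum_le_tsum_enorm
  refine ⟨⟨hm, h4.trans_lt ENNReal.ofReal_lt_top⟩, ?_⟩
  rw [integral_norm_eq_lintegral_enorm hm]
  exact ENNReal.toReal_le_of_le_ofReal
    (tsum_nonneg fun l => integral_nonneg fun _ => norm_nonneg _) h4

/-! ### `L¹` norms of kernels and kernels summed from smooth pieces. -/

section Kernels

variable {E : Type} [NormedAddCommGroup E] [InnerProductSpace ℝ E] [FiniteDimensional ℝ E]
  [MeasurableSpace E] [BorelSpace E]

/-- The `L¹` norm of the derivatives of order `k` of the inverse Fourier transform. -/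
def kernelNorm (k : ℕ) (ψ : 𝓢(E, ℂ)) : ℝ := ∫ x, ‖iteratedFDeriv ℝ k (𝓕⁻ ψ : 𝓢(E, ℂ)) x‖

theorem kernelNorm_nonneg (k : ℕ) (ψ : 𝓢(E, ℂ)) : 0 ≤ kernelNorm k ψ :=
  integral_nonneg fun _ => norm_nonneg _

theorem schwartzBounded_integral_iteratedFDeriv (k : ℕ) :
    SchwartzBounded (fun ψ : 𝓢(E, ℂ) => ∫ x, ‖iteratedFDeriv ℝ k ψ x‖) := by
  refine ⟨{(0, k), (0 + (volume : Measure E).integrablePower, k)}, 2 * (2 ^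
    (volume : Measure E).integrablePower *
      (∫ x : E, (1 + ‖x‖) ^ (- ((volume : Measure E).integrablePower : ℝ)))),
      by positivity, fun ψ => ?_⟩
  have h := SchwartzMap.integral_pow_mul_iteratedFDeriv_le ℂ (volume : Measure E) ψ 0 k
  simp only [pow_zero, one_mul] at h
  refine h.trans ?_
  have h2 : SchwartzMap.seminorm ℂ 0 k ψ +
      SchwartzMap.seminorm ℂ (0 + (volume : Measure E).integrablePower) k ψ ≤
      2 * ∑ m ∈ ({(0, k), (0 + (volume : Measure E).integrablePower, k)} : Finset (ℕ × ℕ)),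
        SchwartzMap.seminorm ℂ m.1 m.2 ψ := by
    have h3 : ∀ a ∈ ({(0, k), (0 + (volume : Measure E).integrablePower, k)} : Finset (ℕ × ℕ)),
        SchwartzMap.seminorm ℂ a.1 a.2 ψ ≤
        ∑ m ∈ ({(0, k), (0 + (volume : Measure E).integrablePower, k)} : Finset (ℕ × ℕ)),
        SchwartzMap.seminorm ℂ m.1 m.2 ψ := fun a ha => Finset.single_le_sum
      (f := fun m : ℕ × ℕ => SchwartzMap.seminorm ℂ m.1 m.2 ψ) (fun i _ => apply_nonneg _ _) ha
    have h4 := h3 (0, k) (by simp)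
    have h5 := h3 (0 + (volume : Measure E).integrablePower, k) (by simp)
    linarith
  calc _ ≤ _ := mul_le_mul_of_nonneg_left h2 (by positivity)
    _ = _ := by ring

theorem schwartzBounded_integral_norm :
    SchwartzBounded (fun ψ : 𝓢(E, ℂ) => ∫ x, ‖ψ x‖) := by
  have := schwartzBounded_integral_iteratedFDeriv (E := E) 0
  simpa using this

theorem schwartzBounded_kernelNorm (k : ℕ) : SchwartzBounded (kernelNorm (E := E) k) :=
  (schwartzBounded_integral_iteratedFDeriv k).comp (FourierTransform.fourierInvCLM ℂ 𝓢(E, ℂ))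

theorem fourierInv_dilate (c : ℝ) (hc : 0 < c) (ψ : 𝓢(E, ℂ)) (x : E) :
    (𝓕⁻ (dilate c hc.ne' ψ) : 𝓢(E, ℂ)) x
      = (c ^ Module.finrank ℝ E) • (𝓕⁻ ψ : 𝓢(E, ℂ)) (c • x) := by
  rw [SchwartzMap.fourierInv_coe, SchwartzMap.fourierInv_coe, Real.fourierInv_eq,
    Real.fourierInv_eq]
  simp only [dilate_apply]
  have h := Measure.integral_comp_inv_smul (volume : Measure E)
    (fun ξ => Real.fourierChar (inner ℝ ξ (c • x)) • ψ ξ) c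
  rw [abs_of_nonneg (by positivity)] at h
  rw [← h]
  congr 1
  funext ξ
  rw [inner_smul_left, inner_smul_right, conj_trivial, ← mul_assoc, inv_mul_cancel₀ hc.ne',
    one_mul]

theorem integral_norm_dilate (c : ℝ) (hc : 0 < c) (ψ : 𝓢(E, ℂ)) :
    ∫ ξ, ‖dilate c hc.ne' ψ ξ‖ = c ^ Module.finrank ℝ E * ∫ ξ, ‖ψ ξ‖ := by
  simp only [dilate_apply]
  have h := Measure.integral_comp_inv_smul (volume : Measure E) (fun ξ => ‖ψ ξ‖) c
  rw [abs_of_nonneg (by positivity)] at h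
  simpa using h

/-- The factor `c ^ finrank` of the dilated kernel cancels the Jacobian, and only the `k`
derivatives contribute powers of `c`. -/
theorem kernelNorm_dilate (k : ℕ) (c : ℝ) (hc : 0 < c) (ψ : 𝓢(E, ℂ)) :
    kernelNorm k (dilate c hc.ne' ψ) = c ^ k * kernelNorm k ψ := by
  unfold kernelNorm
  have h1 : ∀ x, ‖iteratedFDeriv ℝ k (𝓕⁻ (dilate c hc.ne' ψ) : 𝓢(E, ℂ)) x‖
      = c ^ Module.finrank ℝ E * (c ^ k * ‖iteratedFDeriv ℝ k (𝓕⁻ ψ : 𝓢(E, ℂ)) (c • x)‖) := by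
    intro x
    have h2 : ((𝓕⁻ (dilate c hc.ne' ψ) : 𝓢(E, ℂ)) : E → ℂ)
        = fun x => (c ^ Module.finrank ℝ E) • (𝓕⁻ ψ : 𝓢(E, ℂ)) (c • x) :=
      funext (fourierInv_dilate c hc ψ)
    have h3 : ContDiff ℝ k (𝓕⁻ ψ : 𝓢(E, ℂ)) := (𝓕⁻ ψ : 𝓢(E, ℂ)).smooth k
    rw [h2, iteratedFDeriv_const_smul_apply' (by fun_prop),
      iteratedFDeriv_comp_const_smul c h3]
    simp only [norm_smul, norm_pow, Real.norm_of_nonneg hc.le]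
  simp only [h1]
  rw [integral_const_mul, integral_const_mul, Measure.integral_comp_smul_of_nonneg volume
    (fun x => ‖iteratedFDeriv ℝ k (𝓕⁻ ψ : 𝓢(E, ℂ)) x‖) c (hR := hc.le)]
  rw [smul_eq_mul]
  field_simp

theorem kernelNorm_smul (k : ℕ) (c : ℝ) (ψ : 𝓢(E, ℂ)) :
    kernelNorm k (c • ψ) = |c| * kernelNorm k ψ := by
  unfold kernelNorm
  have h1 : (𝓕⁻ (c • ψ) : 𝓢(E, ℂ)) = c • (𝓕⁻ ψ : 𝓢(E, ℂ)) := FourierTransform.fourierInv_smul c ψ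
  rw [h1, ← integral_const_mul]
  congr 1
  funext x
  have h3 : ContDiffAt ℝ k (𝓕⁻ ψ : 𝓢(E, ℂ)) x := ((𝓕⁻ ψ : 𝓢(E, ℂ)).smooth k).contDiffAt
  rw [← Real.norm_eq_abs, ← norm_smul, ← iteratedFDeriv_const_smul_apply h3]
  rfl

/-- Convolution of a bounded function with the kernel whose symbol is a Schwartz function. -/
theorem smoothBound_convolution_fourierInv (ψ : 𝓢(E, ℂ)) {w : E → ℂ} {A : ℝ}
    (hw : AEStronglyMeasurable w volume) (hA : ∀ᵐ y, ‖w y‖ ≤ A) :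
    SmoothBound (fun x => ∫ y, (𝓕⁻ ψ : 𝓢(E, ℂ)) (x - y) * w y)
      (fun k => A * kernelNorm k ψ) := by
  have h := smoothBound_schwartz_convolution (𝓕⁻ ψ : 𝓢(E, ℂ)) hw hA
  simp only [smul_eq_mul] at h
  simp only [mul_comm _ (w _)]
  exact h

/-- A kernel, the inverse Fourier transform of `m`, which is decomposed into smooth pieces. -/
structure KernelDecomposition (m : E → ℂ) (ψ : ℤ → 𝓢(E, ℂ)) : Prop where
  hasSum : ∀ ξ, HasSum (fun l => ψ l ξ) (m ξ)
  summable : Summable fun l => ∫ ξ, ‖ψ l ξ‖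
  summable_kernelNorm : Summable fun l => kernelNorm 0 (ψ l)

theorem KernelDecomposition.fourierInv_eq {m : E → ℂ} {ψ : ℤ → 𝓢(E, ℂ)}
    (h : KernelDecomposition m ψ) (x : E) :
    HasSum (fun l => (𝓕⁻ (ψ l) : 𝓢(E, ℂ)) x) (𝓕⁻ m x) := by
  have h1 := hasSum_integral_of_summable_integral_norm (μ := volume)
    (F := fun l ξ => Real.fourierChar (inner ℝ ξ x) • ψ l ξ)
    (fun l => by
      have := (Real.fourierIntegral_convergent_iff (μ := volume) (V := E) (f := ψ l) (-x)).2
        (ψ l).integrable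
      simpa using this)
    (by simpa [Circle.norm_smul] using h.summable)
  rw [Real.fourierInv_eq]
  have h2 : ∀ ξ, ∑' l, Real.fourierChar (inner ℝ ξ x) • ψ l ξ
      = Real.fourierChar (inner ℝ ξ x) • m ξ := fun ξ =>
    ((h.hasSum ξ).const_smul (Real.fourierChar (inner ℝ ξ x))).tsum_eq
  simp only [h2] at h1
  simpa only [SchwartzMap.fourierInv_coe, Real.fourierInv_eq] using h1

theorem KernelDecomposition.integrable {m : E → ℂ} {ψ : ℤ → 𝓢(E, ℂ)}
    (h : KernelDecomposition m ψ) : Integrable (𝓕⁻ m) ∧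
      ∫ x, ‖𝓕⁻ m x‖ ≤ ∑' l, kernelNorm 0 (ψ l) := by
  have h1 := integrable_tsum_of_summable_integral_norm (μ := volume)
    (f := fun l x => (𝓕⁻ (ψ l) : 𝓢(E, ℂ)) x) (fun l => (𝓕⁻ (ψ l) : 𝓢(E, ℂ)).integrable)
    (by simpa [kernelNorm] using h.summable_kernelNorm)
  have h2 : (fun x => ∑' l, (𝓕⁻ (ψ l) : 𝓢(E, ℂ)) x) = 𝓕⁻ m :=
    funext fun x => (h.fourierInv_eq x).tsum_eq
  refine ⟨h2 ▸ h1.1, ?_⟩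
  have h3 := h1.2
  simp only [(h.fourierInv_eq _).tsum_eq] at h3
  simpa [kernelNorm] using h3

theorem KernelDecomposition.convolution_eq {m : E → ℂ} {ψ : ℤ → 𝓢(E, ℂ)}
    (h : KernelDecomposition m ψ) {w : E → ℂ} {A : ℝ} (hw : AEStronglyMeasurable w volume)
    (hA : ∀ᵐ y, ‖w y‖ ≤ A) (x : E) :
    HasSum (fun l => ∫ y, (𝓕⁻ (ψ l) : 𝓢(E, ℂ)) (x - y) * w y) (∫ y, 𝓕⁻ m (x - y) * w y) := by
  have hint : ∀ l, Integrable (fun y => (𝓕⁻ (ψ l) : 𝓢(E, ℂ)) (x - y) * w y) := fun l => by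
    simpa only [smul_eq_mul, mul_comm] using
      integrable_bounded_smul_schwartz (𝓕⁻ (ψ l) : 𝓢(E, ℂ)) hw hA x
  have h1 := hasSum_integral_of_summable_integral_norm (μ := volume) hint ?_
  · simp only [tsum_mul_right, (h.fourierInv_eq _).tsum_eq] at h1
    exact h1
  · refine Summable.of_nonneg_of_le (fun l => integral_nonneg fun _ => norm_nonneg _) (fun l => ?_)
      (h.summable_kernelNorm.mul_left A)
    have h2 : kernelNorm 0 (ψ l) = ∫ y, ‖(𝓕⁻ (ψ l) : 𝓢(E, ℂ)) (x - y)‖ := by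
      rw [integral_sub_left_eq_self (fun y => ‖(𝓕⁻ (ψ l) : 𝓢(E, ℂ)) y‖) volume x]
      simp [kernelNorm]
    rw [h2, ← integral_const_mul]
    refine integral_mono_ae (hint l).norm
      (((𝓕⁻ (ψ l) : 𝓢(E, ℂ)).integrable.comp_sub_left x).norm.const_mul A) ?_
    filter_upwards [hA] with y hy
    rw [norm_mul, mul_comm]
    gcongr

/-- Derivatives are estimated piece by piece and the convolutions are summed, so no smoothness of
the full kernel has to be established. -/
theorem KernelDecomposition.smoothBound_convolution {m : E → ℂ} {ψ : ℤ → 𝓢(E, ℂ)}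
    (h : KernelDecomposition m ψ) (hs : ∀ k, Summable fun l => kernelNorm k (ψ l)) {w : E → ℂ}
    {A : ℝ} (hw : AEStronglyMeasurable w volume) (hA : ∀ᵐ y, ‖w y‖ ≤ A) :
    SmoothBound (fun x => ∫ y, 𝓕⁻ m (x - y) * w y)
      (fun k => A * ∑' l, kernelNorm k (ψ l)) := by
  have h1 := SmoothBound.tsum (fun l => smoothBound_convolution_fourierInv (ψ l) hw hA)
    (fun k => (hs k).mul_left A)
  simp only [tsum_mul_left, (h.convolution_eq hw hA _).tsum_eq] at h1
  exact h1

/-- All derivatives fall on `w`, and the kernel enters only through its `L¹` norm. This form serves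
the Duhamel integral near the final time. -/
theorem smoothBound_convolution_of_smoothBound {K : E → ℂ} (hK : Integrable K)
    {w : E → ℂ} {M : ℕ → ℝ} (hw : SmoothBound w M) :
    SmoothBound (fun x => ∫ y, K (x - y) * w y) (fun k => (∫ y, ‖K y‖) * M k) := by
  have h1 : (fun x => ∫ y, K (x - y) * w y) = fun x => ∫ y, K y * w (x - y) := by
    funext x
    rw [← integral_sub_left_eq_self (fun y => K y * w (x - y)) volume x]
    simp
  rw [h1]
  have h2 := smoothBound_integral (μ := volume) (f := fun y x => K y * w (x - y))
    (g := fun k y => ‖K y‖ * M k) (fun x => hK.1.mul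
      (hw.1.continuous.comp (by fun_prop : Continuous fun y => x - y)).aestronglyMeasurable)
    (ae_of_all _ fun y => ?_) (fun k => hK.norm.mul_const _)
  · simpa only [integral_mul_const] using h2
  · have h3 : SmoothBound (fun x => w (x - y)) M :=
      ⟨hw.1.comp (by fun_prop), fun k x => by
        rw [iteratedFDeriv_comp_sub]; exact hw.2 k _⟩
    refine ⟨contDiff_const.mul h3.1, fun k x => ?_⟩
    have h4 : ContDiffAt ℝ k (fun x => w (x - y)) x :=
      (h3.1.of_le (by exact_mod_cast le_top)).contDiffAt
    have := iteratedFDeriv_const_smul_apply' (𝕜 := ℝ) (a := K y) h4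
    simp only [smul_eq_mul] at this
    rw [this, norm_smul]
    exact mul_le_mul_of_nonneg_left (h3.2 k x) (norm_nonneg _)

end Kernels

end

end FracNS

namespace FracNS

noncomputable section

/-! ### Sums over dyadic frequencies. -/

section DyadicSum

theorem two_rpow_pos (x : ℝ) : 0 < (2 : ℝ) ^ x := Real.rpow_pos_of_pos two_pos x

theorem summable_two_rpow {b : ℝ} (hb : b < 0) : Summable fun m : ℕ => (2 : ℝ) ^ ((m : ℝ) * b) := by
  have : (fun m : ℕ => (2 : ℝ) ^ ((m : ℝ) * b)) = fun m : ℕ => ((2 : ℝ) ^ b) ^ m := by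
    funext m
    rw [mul_comm, Real.rpow_mul two_pos.le, Real.rpow_natCast]
  rw [this]
  exact summable_geometric_of_lt_one (two_rpow_pos _).le
    (Real.rpow_lt_one_of_one_lt_of_neg one_lt_two hb)

/-- At low frequencies `β > 0` gives a geometric series; at high frequencies the decay of order `N *
c` beats the growth of order `β`. -/
theorem summable_dyadic_aux {β c : ℝ} {N : ℕ} (hβ : 0 < β) (hN : β < N * c) :
    Summable fun m : ℤ => (2 : ℝ) ^ ((m : ℝ) * β) * ((1 + (2 : ℝ) ^ (((m : ℝ) - 1) * c)) ^ N)⁻¹ := by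
  refine Summable.of_nat_of_neg ?_ ?_
  · have h := (summable_two_rpow (b := β - N * c) (by linarith)).mul_left ((2 : ℝ) ^ (N * c))
    refine Summable.of_nonneg_of_le (fun m => by positivity) (fun m => ?_) h
    have h1 : (2 : ℝ) ^ (((m : ℝ) - 1) * c * N) ≤ (1 + (2 : ℝ) ^ (((m : ℝ) - 1) * c)) ^ N := by
      rw [Real.rpow_mul two_pos.le, Real.rpow_natCast]
      gcongr
      linarith
    calc (2 : ℝ) ^ (((m : ℤ) : ℝ) * β) * ((1 + (2 : ℝ) ^ ((((m : ℤ) : ℝ) - 1) * c)) ^ N)⁻¹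
        ≤ (2 : ℝ) ^ ((m : ℝ) * β) * ((2 : ℝ) ^ (((m : ℝ) - 1) * c * N))⁻¹ := by
          push_cast
          gcongr
      _ = _ := by
          rw [← Real.rpow_neg two_pos.le, ← Real.rpow_add two_pos, ← Real.rpow_add two_pos]
          congr 1; ring
  · refine Summable.of_nonneg_of_le (fun m => by positivity) (fun m => ?_)
      (summable_two_rpow (b := -β) (by linarith))
    have h1 : ((1 + (2 : ℝ) ^ ((((-(m : ℤ) : ℤ) : ℝ) - 1) * c)) ^ N)⁻¹ ≤ 1 :=
      inv_le_one_of_one_le₀ (one_le_pow₀ (by linarith [two_rpow_pos ((((-(m : ℤ) : ℤ) : ℝ) - 1) * c)]))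
    calc _ ≤ (2 : ℝ) ^ (((-(m : ℤ) : ℤ) : ℝ) * β) * 1 := by gcongr
      _ = _ := by push_cast; rw [mul_one]; congr 1; ring

/-- Summation over the dyadic frequencies. -/
theorem exists_dyadic_sum_le {β c : ℝ} {N : ℕ} (hβ : 0 < β) (hc : 0 < c) (hN : β < N * c) :
    ∃ C, 0 ≤ C ∧ ∀ t : ℝ, 0 < t →
      Summable (fun l : ℤ => (2 : ℝ) ^ ((l : ℝ) * β) * ((1 + t * (2 : ℝ) ^ ((l : ℝ) * c)) ^ N)⁻¹) ∧
      ∑' l : ℤ, (2 : ℝ) ^ ((l : ℝ) * β) * ((1 + t * (2 : ℝ) ^ ((l : ℝ) * c)) ^ N)⁻¹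
        ≤ C * t ^ (-(β / c)) := by
  have hs := summable_dyadic_aux hβ hN
  refine ⟨∑' m : ℤ, (2 : ℝ) ^ ((m : ℝ) * β) * ((1 + (2 : ℝ) ^ (((m : ℝ) - 1) * c)) ^ N)⁻¹,
    tsum_nonneg fun m => by positivity, fun t ht => ?_⟩
  -- The sum concentrates at the frequency `2 ^ y`, where `t * 2 ^ (y * c) = 1`. Shifting the index
  -- by `⌊y⌋` compares it with a sum independent of `t`; the `m - 1` in that sum absorbs the
  -- rounding.
  · set y : ℝ := -(Real.logb 2 t / c)
    have hty : t = (2 : ℝ) ^ (-(y * c)) := by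
      have : -(y * c) = Real.logb 2 t := by simp only [y]; field_simp
      rw [this, Real.rpow_logb two_pos (by norm_num) ht]
    have htβ : t ^ (-(β / c)) = (2 : ℝ) ^ (y * β) := by
      rw [hty, ← Real.rpow_mul two_pos.le]
      congr 1; field_simp
    set l₀ : ℤ := ⌊y⌋
    have h1 : (l₀ : ℝ) ≤ y := Int.floor_le y
    have h2 : y < l₀ + 1 := Int.lt_floor_add_one y
    have hle : ∀ m : ℤ, (2 : ℝ) ^ (((m + l₀ : ℤ) : ℝ) * β) *
        ((1 + t * (2 : ℝ) ^ (((m + l₀ : ℤ) : ℝ) * c)) ^ N)⁻¹ ≤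
        ((2 : ℝ) ^ ((m : ℝ) * β) * ((1 + (2 : ℝ) ^ (((m : ℝ) - 1) * c)) ^ N)⁻¹)
          * t ^ (-(β / c)) := by
      intro m
      rw [htβ]
      have e1 : (2 : ℝ) ^ (((m + l₀ : ℤ) : ℝ) * β) ≤ (2 : ℝ) ^ ((m : ℝ) * β) * (2 : ℝ) ^ (y * β) := by
        rw [← Real.rpow_add two_pos]
        refine Real.rpow_le_rpow_of_exponent_le one_le_two ?_
        push_cast
        nlinarith
      have e2 : (2 : ℝ) ^ (((m : ℝ) - 1) * c) ≤ t * (2 : ℝ) ^ (((m + l₀ : ℤ) : ℝ) * c) := by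
        rw [hty, ← Real.rpow_add two_pos]
        refine Real.rpow_le_rpow_of_exponent_le one_le_two ?_
        push_cast
        nlinarith
      calc _ ≤ ((2 : ℝ) ^ ((m : ℝ) * β) * (2 : ℝ) ^ (y * β)) *
            ((1 + (2 : ℝ) ^ (((m : ℝ) - 1) * c)) ^ N)⁻¹ := by gcongr
        _ = _ := by ring
    have hs2 := hs.mul_right (t ^ (-(β / c)))
    have hs1 : Summable fun m : ℤ => (2 : ℝ) ^ (((m + l₀ : ℤ) : ℝ) * β) *
        ((1 + t * (2 : ℝ) ^ (((m + l₀ : ℤ) : ℝ) * c)) ^ N)⁻¹ :=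
      Summable.of_nonneg_of_le (fun m => by positivity) hle hs2
    refine ⟨(Equiv.addRight l₀).summable_iff.1 hs1, ?_⟩
    rw [← (Equiv.addRight l₀).tsum_eq, ← tsum_mul_right]
    exact hs1.tsum_le_tsum hle hs2

end DyadicSum

/-! ### The dyadic partition of unity. -/

section Dyadic

variable {n : ℕ}

theorem cutoff_eq_one {ξ : Space n} (h : ‖ξ‖ ≤ 1) : cutoff n ξ = 1 :=
  (cutoff n).one_of_mem_closedBall (by rw [mem_closedBall_zero_iff]; exact h)

theorem cutoff_eq_zero {ξ : Space n} (h : 2 ≤ ‖ξ‖) : cutoff n ξ = 0 :=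
  (cutoff n).zero_of_le_dist (by rw [dist_zero_right]; exact h)

theorem dyadic_eq_comp_smul (l : ℤ) (ξ : Space n) :
    dyadic n l ξ = dyadic n 0 (((2 : ℝ) ^ l)⁻¹ • ξ) := by
  unfold dyadic
  rw [smul_smul, smul_smul, ← zpow_neg, ← zpow_add₀ two_ne_zero, ← zpow_add₀ two_ne_zero]
  norm_num
  rw [add_comm]

theorem norm_of_dyadic_ne_zero {l : ℤ} {ξ : Space n} (h : dyadic n l ξ ≠ 0) :
    (2 : ℝ) ^ (l - 1) < ‖ξ‖ ∧ ‖ξ‖ < (2 : ℝ) ^ (l + 1) := by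
  have hn : ∀ k : ℤ, ‖((2 : ℝ) ^ k) • ξ‖ = (2 : ℝ) ^ k * ‖ξ‖ := fun k => by
    rw [norm_smul, Real.norm_of_nonneg (by positivity)]
  constructor
  · by_contra! hle
    refine h ?_
    unfold dyadic
    rw [cutoff_eq_one, cutoff_eq_one]
    · simp
    · rw [hn]
      calc (2 : ℝ) ^ (-l + 1) * ‖ξ‖ ≤ (2 : ℝ) ^ (-l + 1) * (2 : ℝ) ^ (l - 1) := by gcongr
        _ = 1 := by rw [← zpow_add₀ two_ne_zero]; norm_num
    · rw [hn]
      calc (2 : ℝ) ^ (-l) * ‖ξ‖ ≤ (2 : ℝ) ^ (-l) * (2 : ℝ) ^ (l - 1) := by gcongr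
        _ ≤ 1 := by rw [← zpow_add₀ two_ne_zero]; norm_num
  · by_contra! hle
    refine h ?_
    unfold dyadic
    rw [cutoff_eq_zero, cutoff_eq_zero]
    · simp
    · rw [hn]
      calc (2 : ℝ) ≤ (2 : ℝ) ^ (-l + 1) * (2 : ℝ) ^ (l + 1) := by
            rw [← zpow_add₀ two_ne_zero]; ring_nf; norm_num
        _ ≤ _ := by gcongr
    · rw [hn]
      calc (2 : ℝ) = (2 : ℝ) ^ (-l) * (2 : ℝ) ^ (l + 1) := by
            rw [← zpow_add₀ two_ne_zero]; norm_num
        _ ≤ _ := by gcongr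

/-- The sum telescopes to a difference of two cut-offs, of which the wider equals `1` at `ξ` and the
narrower equals `0`. -/
theorem dyadic_add_dyadic_succ {L : ℤ} {ξ : Space n} (h1 : (2 : ℝ) ^ L ≤ ‖ξ‖)
    (h2 : ‖ξ‖ < (2 : ℝ) ^ (L + 1)) : dyadic n L ξ + dyadic n (L + 1) ξ = 1 := by
  have hn : ∀ k : ℤ, ‖((2 : ℝ) ^ k) • ξ‖ = (2 : ℝ) ^ k * ‖ξ‖ := fun k => by
    rw [norm_smul, Real.norm_of_nonneg (by positivity)]
  unfold dyadic
  have e : -(L + 1) + 1 = -L := by ring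
  rw [e, cutoff_eq_zero (ξ := (2 : ℝ) ^ (-L + 1) • ξ), cutoff_eq_one (ξ := (2 : ℝ) ^ (-(L + 1)) • ξ)]
  · push_cast; ring
  · rw [hn]
    calc _ ≤ (2 : ℝ) ^ (-(L + 1)) * (2 : ℝ) ^ (L + 1) := by gcongr
      _ = 1 := by rw [← zpow_add₀ two_ne_zero]; norm_num
  · rw [hn]
    calc (2 : ℝ) = (2 : ℝ) ^ (-L + 1) * (2 : ℝ) ^ L := by
          rw [← zpow_add₀ two_ne_zero]; norm_num
      _ ≤ _ := by gcongr

theorem exists_hasSum_dyadic_mul {ξ : Space n} (hξ : ξ ≠ 0) :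
    ∃ L : ℤ, (2 : ℝ) ^ L ≤ ‖ξ‖ ∧ ‖ξ‖ < (2 : ℝ) ^ (L + 1) ∧ ∀ f : ℤ → ℂ,
      HasSum (fun l => dyadic n l ξ * f l)
        (dyadic n L ξ * f L + dyadic n (L + 1) ξ * f (L + 1)) := by
  obtain ⟨L, h1, h2⟩ := exists_mem_Ico_zpow (norm_pos_iff.2 hξ) (one_lt_two (α := ℝ))
  refine ⟨L, h1, h2, fun f => ?_⟩
  have h : HasSum (fun l => dyadic n l ξ * f l)
      (∑ l ∈ ({L, L + 1} : Finset ℤ), dyadic n l ξ * f l) := by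
    refine hasSum_sum_of_ne_finset_zero fun l hl => ?_
    by_contra hne
    obtain ⟨h3, h4⟩ := norm_of_dyadic_ne_zero (left_ne_zero_of_mul hne)
    have h5 := (zpow_lt_zpow_iff_right₀ (one_lt_two (α := ℝ))).1 (h3.trans h2)
    have h6 := (zpow_lt_zpow_iff_right₀ (one_lt_two (α := ℝ))).1 (h1.trans_lt h4)
    simp only [Finset.mem_insert, Finset.mem_singleton] at hl
    omega
  rwa [Finset.sum_pair (by omega)] at h

theorem dyadic_mul_dyadic_eq_zero {j l : ℤ} (h : 2 ≤ |j - l|) (ξ : Space n) :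
    dyadic n j ξ * dyadic n l ξ = 0 := by
  by_contra hne
  obtain ⟨h1, h2⟩ := norm_of_dyadic_ne_zero (left_ne_zero_of_mul hne)
  obtain ⟨h3, h4⟩ := norm_of_dyadic_ne_zero (right_ne_zero_of_mul hne)
  have h5 := (zpow_lt_zpow_iff_right₀ (one_lt_two (α := ℝ))).1 (h1.trans h4)
  have h6 := (zpow_lt_zpow_iff_right₀ (one_lt_two (α := ℝ))).1 (h3.trans h2)
  rw [le_abs] at h
  omega

theorem isAnnular_of_support {χ : Space n → ℂ} (h1 : ContDiff ℝ ∞ χ) (h2 : HasCompactSupport χ)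
    {r : ℝ} (hr : 0 < r) (h3 : ∀ ξ, ‖ξ‖ < r → χ ξ = 0) : IsAnnular χ := by
  refine ⟨h1, h2, ?_⟩
  rw [notMem_tsupport_iff_eventuallyEq]
  filter_upwards [Metric.ball_mem_nhds (0 : Space n) hr] with ξ hξ
  exact h3 ξ (by simpa using hξ)

theorem isAnnular_dyadic (l : ℤ) : IsAnnular (dyadic n l) :=
  isAnnular_of_support (dyadic_contDiff n l) (dyadic_hasCompactSupport n l)
    (r := (2 : ℝ) ^ (l - 1)) (by positivity) fun ξ hξ => by
      by_contra h
      exact absurd (norm_of_dyadic_ne_zero h).1 hξ.le.not_gt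

theorem IsAnnular.mul {χ a : Space n → ℂ} (hχ : IsAnnular χ)
    (ha : ∀ ξ, ξ ≠ 0 → ContDiffAt ℝ ∞ a ξ) : IsAnnular (fun ξ => χ ξ * a ξ) := by
  have h0 : ∀ᶠ ξ in 𝓝 (0 : Space n), χ ξ * a ξ = 0 := by
    filter_upwards [notMem_tsupport_iff_eventuallyEq.1 hχ.zero_notMem] with ξ hξ
    rw [hξ]; simp
  refine ⟨?_, hχ.hasCompactSupport.mul_right, notMem_tsupport_iff_eventuallyEq.2 h0⟩
  rw [contDiff_iff_contDiffAt]
  intro ξ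
  by_cases hξ : ξ = 0
  · rw [hξ]
    exact (contDiffAt_const (c := (0 : ℂ))).congr_of_eventuallyEq h0
  · exact hχ.contDiff.contDiffAt.mul (ha ξ hξ)

/-- A smooth function supported in an annulus which is `1` where `dyadic n 0` does not vanish. -/
def fatDyadic (n : ℕ) (ξ : Space n) : ℂ :=
  ((cutoff n ((2 : ℝ)⁻¹ • ξ) - cutoff n ((4 : ℝ) • ξ) : ℝ) : ℂ)

theorem isAnnular_fatDyadic : IsAnnular (fatDyadic n) := by
  have h (c : ℝ) : ContDiff ℝ ∞ (fun ξ : Space n => cutoff n (c • ξ)) :=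
    (cutoff n).contDiff.comp (contDiff_const_smul c)
  have h' (c : ℝ) (hc : c ≠ 0) : HasCompactSupport (fun ξ : Space n => cutoff n (c • ξ)) :=
    (cutoff n).hasCompactSupport.comp_smul hc
  refine isAnnular_of_support (Complex.ofRealCLM.contDiff.comp ((h _).sub (h _)))
    (((h' _ (by positivity)).sub (h' _ (by positivity))).comp_left
    (g := fun x : ℝ => (x : ℂ)) (by simp)) (r := 1 / 4) (by norm_num) fun ξ hξ => ?_
  unfold fatDyadic
  rw [cutoff_eq_one, cutoff_eq_one]
  · simp
  · rw [norm_smul]; norm_num; linarith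
  · rw [norm_smul]; norm_num; linarith

theorem fatDyadic_eq_one {ξ : Space n} (h1 : 1 / 2 ≤ ‖ξ‖) (h2 : ‖ξ‖ ≤ 2) : fatDyadic n ξ = 1 := by
  unfold fatDyadic
  rw [cutoff_eq_one, cutoff_eq_zero]
  · simp
  · rw [norm_smul]; norm_num; linarith
  · rw [norm_smul]; norm_num; linarith

theorem dyadic_mul_fatDyadic (l : ℤ) (ξ : Space n) :
    dyadic n l ξ * fatDyadic n (((2 : ℝ) ^ l)⁻¹ • ξ) = dyadic n l ξ := by
  by_cases h : dyadic n l ξ = 0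
  · simp [h]
  rw [dyadic_eq_comp_smul] at h ⊢
  obtain ⟨h1, h2⟩ := norm_of_dyadic_ne_zero h
  rw [fatDyadic_eq_one, mul_one]
  · norm_num at h1 ⊢; exact h1.le
  · norm_num at h2 ⊢; exact h2.le

end Dyadic

end

end FracNS

namespace FracNS

noncomputable section

/-! ### Dyadic pieces of the symbols of `S(t)` and `∂_k Π_ij S(t)`. -/

section Pieces

variable {n : ℕ}

theorem heatSymbol_eq (α t : ℝ) (ξ : Space n) :
    heatSymbol α t ξ = (Real.exp (-t * fracSymbol α ξ) : ℂ) := by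
  simp [heatSymbol, fracSymbol]

/-- The part near the frequency `2 ^ l` of the symbol `χ exp (-t (2π|ξ|)^(2α))`. -/
def heatPiece {χ : Space n → ℂ} (hχ : IsAnnular χ) (α t : ℝ) (l : ℤ) : 𝓢(Space n, ℂ) :=
  dilate ((2 : ℝ) ^ l) (by positivity)
    (profile hχ α (contDiff_exp_neg_mul (t * (2 : ℝ) ^ ((l : ℝ) * (2 * α)))))

/-- Rescaling the frequency by `2 ^ l` thus turns the time `t` into `t * 2 ^ (2αl)`, so every piece
is a dilate of one fixed family of profiles. -/
theorem two_rpow_mul_fracSymbol (α : ℝ) (l : ℤ) (ξ : Space n) :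
    (2 : ℝ) ^ ((l : ℝ) * (2 * α)) * fracSymbol α (((2 : ℝ) ^ l)⁻¹ • ξ) = fracSymbol α ξ := by
  rw [fracSymbol_smul _ (by positivity), ← mul_assoc, Real.rpow_mul two_pos.le, Real.rpow_intCast,
    ← Real.mul_rpow (by positivity) (by positivity), mul_inv_cancel₀ (by positivity),
    Real.one_rpow, one_mul]

theorem heatPiece_apply {χ : Space n → ℂ} (hχ : IsAnnular χ) (α t : ℝ) (l : ℤ) (ξ : Space n) :
    heatPiece hχ α t l ξ = χ (((2 : ℝ) ^ l)⁻¹ • ξ) * heatSymbol α t ξ := by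
  have h : -(t * (2 : ℝ) ^ ((l : ℝ) * (2 * α))) * fracSymbol α (((2 : ℝ) ^ l)⁻¹ • ξ)
      = -t * fracSymbol α ξ := by
    linear_combination (-t) * two_rpow_mul_fracSymbol α l ξ
  rw [heatPiece, dilate_apply, profile_apply, heatSymbol_eq, Complex.real_smul, mul_comm, h]

/-- The growth of a functional under dilations. -/
structure DilationBounded (q : 𝓢(Space n, ℂ) → ℝ) (d : ℕ) : Prop where
  nonneg : ∀ ψ, 0 ≤ q ψ
  bounded : SchwartzBounded q
  dilate : ∀ (c : ℝ) (hc : 0 < c) ψ, q (dilate c hc.ne' ψ) = c ^ d * q ψ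

theorem dilationBounded_kernelNorm (k : ℕ) : DilationBounded (kernelNorm (E := Space n) k) k :=
  ⟨kernelNorm_nonneg k, schwartzBounded_kernelNorm k, kernelNorm_dilate k⟩

theorem dilationBounded_integral_norm :
    DilationBounded (fun ψ : 𝓢(Space n, ℂ) => ∫ ξ, ‖ψ ξ‖) (Module.finrank ℝ (Space n)) :=
  ⟨fun _ => integral_nonneg fun _ => norm_nonneg _, schwartzBounded_integral_norm,
    integral_norm_dilate⟩

theorem DilationBounded.heatPiece_le {q : 𝓢(Space n, ℂ) → ℝ} {d : ℕ} (hq : DilationBounded q d)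
    {χ : Space n → ℂ} (hχ : IsAnnular χ) (α : ℝ) (N : ℕ) :
    ∃ C, 0 ≤ C ∧ ∀ t, 0 < t → ∀ l : ℤ, q (heatPiece hχ α t l) ≤
      C * ((2 : ℝ) ^ ((l : ℝ) * d) * ((1 + t * (2 : ℝ) ^ ((l : ℝ) * (2 * α))) ^ N)⁻¹) := by
  obtain ⟨C, hC, h⟩ := hq.bounded.profile_exp_le hχ α N
  refine ⟨C, hC, fun t ht l => ?_⟩
  unfold heatPiece
  have e : (2 : ℝ) ^ ((l : ℝ) * d) = ((2 : ℝ) ^ l) ^ d := by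
    rw [Real.rpow_mul two_pos.le, Real.rpow_intCast, Real.rpow_natCast]
  rw [hq.dilate _ (by positivity), e]
  calc _ ≤ ((2 : ℝ) ^ l) ^ d * (C * ((1 + t * (2 : ℝ) ^ ((l : ℝ) * (2 * α))) ^ N)⁻¹) := by
        gcongr
        exact h _ (by positivity)
    _ = _ := by ring

/-- The symbol of `∂_k Π_ij`. -/
def lerayAmp (i j k : Fin n) (ξ : Space n) : ℂ :=
  (2 * Real.pi * Complex.I * (ξ k : ℂ)) * (leraySymbol i j ξ : ℂ)

theorem contDiffAt_lerayAmp (i j k : Fin n) {ξ : Space n} (hξ : ξ ≠ 0) :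
    ContDiffAt ℝ ∞ (lerayAmp i j k) ξ := by
  have hc : ∀ i : Fin n, ContDiffAt ℝ ∞ (fun ξ : Space n => ξ i) ξ := fun i =>
    (EuclideanSpace.proj i : Space n →L[ℝ] ℝ).contDiff.contDiffAt
  have h1 : ContDiffAt ℝ ∞ (leraySymbol (n := n) i j) ξ := by
    unfold leraySymbol
    refine contDiffAt_const.sub (((hc i).mul (hc j)).div ?_ ?_)
    · exact (contDiff_norm_sq ℝ).contDiffAt
    · have : ‖ξ‖ ≠ 0 := norm_ne_zero_iff.2 hξ
      positivity
  unfold lerayAmp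
  exact (contDiffAt_const.mul (Complex.ofRealCLM.contDiff.contDiffAt.comp ξ (hc k))).mul
    (Complex.ofRealCLM.contDiff.contDiffAt.comp ξ h1)

theorem leraySymbol_smul (i j : Fin n) {c : ℝ} (hc : c ≠ 0) (ξ : Space n) :
    leraySymbol i j (c • ξ) = leraySymbol i j ξ := by
  unfold leraySymbol
  congr 1
  rw [norm_smul, mul_pow, Real.norm_eq_abs, sq_abs]
  simp only [PiLp.smul_apply, smul_eq_mul]
  rw [show c * ξ i * (c * ξ j) = c ^ 2 * (ξ i * ξ j) by ring]
  exact mul_div_mul_left _ _ (pow_ne_zero 2 hc)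

theorem lerayAmp_smul (i j k : Fin n) {c : ℝ} (hc : c ≠ 0) (ξ : Space n) :
    lerayAmp i j k (c • ξ) = c * lerayAmp i j k ξ := by
  unfold lerayAmp
  rw [leraySymbol_smul i j hc]
  simp only [PiLp.smul_apply, smul_eq_mul]
  push_cast
  ring

theorem isAnnular_lerayAmp (i j k : Fin n) :
    IsAnnular (fun ξ : Space n => dyadic n 0 ξ * lerayAmp i j k ξ) :=
  (isAnnular_dyadic 0).mul fun _ => contDiffAt_lerayAmp i j k

/-- The dyadic pieces of the symbol of `∂_k Π_ij S(t)`. -/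
def lerayPiece (α t : ℝ) (i j k : Fin n) (l : ℤ) : 𝓢(Space n, ℂ) :=
  ((2 : ℝ) ^ l) • heatPiece (isAnnular_lerayAmp i j k) α t l

theorem lerayPiece_apply (α t : ℝ) (i j k : Fin n) (l : ℤ) (ξ : Space n) :
    lerayPiece α t i j k l ξ = dyadic n l ξ * (lerayAmp i j k ξ * heatSymbol α t ξ) := by
  change ((2 : ℝ) ^ l) • heatPiece (isAnnular_lerayAmp i j k) α t l ξ = _
  rw [heatPiece_apply, lerayAmp_smul i j k (by positivity), ← dyadic_eq_comp_smul,
    Complex.real_smul]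
  have : (((2 : ℝ) ^ l : ℝ) : ℂ) ≠ 0 := by
    exact_mod_cast (show (2 : ℝ) ^ l ≠ 0 by positivity)
  rw [Complex.ofReal_inv]
  field_simp

/-- The amplitude is homogeneous of degree one, so each piece gains a factor `2 ^ l`; this makes the
low frequencies summable although the Leray symbol is singular at the origin. Since `2α > 1`, decay
of order `N = d + 1` suffices at high frequencies. -/
theorem DilationBounded.lerayPiece_le {q : 𝓢(Space n, ℂ) → ℝ} {d : ℕ} (hq : DilationBounded q d)
    (hsmul : ∀ (c : ℝ) ψ, q (c • ψ) = |c| * q ψ) {α : ℝ} (hα : 1 / 2 < α) (i j k : Fin n) :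
    ∃ C, 0 ≤ C ∧ ∀ t, 0 < t → Summable (fun l => q (lerayPiece α t i j k l)) ∧
      ∑' l, q (lerayPiece α t i j k l) ≤ C * t ^ (-(((d : ℝ) + 1) / (2 * α))) := by
  obtain ⟨C₁, hC₁, h₁⟩ := hq.heatPiece_le (isAnnular_lerayAmp i j k) α (d + 1)
  obtain ⟨C₂, hC₂, h₂⟩ := exists_dyadic_sum_le (β := (d : ℝ) + 1) (c := 2 * α) (N := d + 1)
    (by positivity) (by linarith) (by
      push_cast
      have : (0 : ℝ) < (d : ℝ) + 1 := by positivity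
      nlinarith)
  refine ⟨C₁ * C₂, by positivity, fun t ht => ?_⟩
  obtain ⟨h₃, h₄⟩ := h₂ t ht
  have hle : ∀ l, q (lerayPiece α t i j k l) ≤ C₁ * ((2 : ℝ) ^ ((l : ℝ) * ((d : ℝ) + 1)) *
      ((1 + t * (2 : ℝ) ^ ((l : ℝ) * (2 * α))) ^ (d + 1))⁻¹) := fun l => by
    unfold lerayPiece
    rw [hsmul, abs_of_nonneg (by positivity)]
    calc _ ≤ (2 : ℝ) ^ l * (C₁ * ((2 : ℝ) ^ ((l : ℝ) * d) *
          ((1 + t * (2 : ℝ) ^ ((l : ℝ) * (2 * α))) ^ (d + 1))⁻¹)) := by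
          gcongr
          exact h₁ t ht l
      _ = _ := by
          rw [mul_add (l : ℝ), Real.rpow_add two_pos, mul_one, Real.rpow_intCast]
          ring
  have hs := Summable.of_nonneg_of_le (fun l => hq.nonneg _) hle (h₃.mul_left C₁)
  refine ⟨hs, (hs.tsum_le_tsum hle (h₃.mul_left C₁)).trans ?_⟩
  rw [tsum_mul_left, mul_assoc]
  gcongr

theorem integral_norm_smul (c : ℝ) (ψ : 𝓢(Space n, ℂ)) :
    ∫ ξ, ‖(c • ψ) ξ‖ = |c| * ∫ ξ, ‖ψ ξ‖ := by
  rw [← integral_const_mul]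
  congr 1
  funext ξ
  rw [← Real.norm_eq_abs, ← norm_smul]
  rfl

theorem kernelDecomposition_leray {α t : ℝ} (hα : 1 / 2 < α) (ht : 0 < t) (i j k : Fin n) :
    KernelDecomposition (fun ξ : Space n => lerayAmp i j k ξ * heatSymbol α t ξ)
      (lerayPiece α t i j k) := by
  refine ⟨fun ξ => ?_, ?_, ?_⟩
  · simp only [lerayPiece_apply]
    by_cases hξ : ξ = 0
    · have : lerayAmp i j k ξ = 0 := by simp [lerayAmp, hξ]
      simp only [this, zero_mul, mul_zero]
      exact hasSum_zero
    · obtain ⟨L, h1, h2, h3⟩ := exists_hasSum_dyadic_mul hξ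
      have := h3 fun _ => lerayAmp i j k ξ * heatSymbol α t ξ
      rwa [← add_mul, dyadic_add_dyadic_succ h1 h2, one_mul] at this
  · obtain ⟨C, -, h⟩ := dilationBounded_integral_norm.lerayPiece_le integral_norm_smul hα i j k
    exact (h t ht).1
  · obtain ⟨C, -, h⟩ := (dilationBounded_kernelNorm 0).lerayPiece_le (kernelNorm_smul 0) hα i j k
    exact (h t ht).1

/-- The smoothing estimate for `∂_k Π_ij S(t)` on bounded functions. -/
theorem exists_smoothBound_leray {α : ℝ} (hα : 1 / 2 < α) (i j k : Fin n) :
    ∃ C : ℕ → ℝ, (∀ m, 0 ≤ C m) ∧ ∀ t, 0 < t → ∀ (w : Space n → ℂ) (A : ℝ), 0 ≤ A →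
      AEStronglyMeasurable w volume → (∀ᵐ y, ‖w y‖ ≤ A) →
      SmoothBound (fun x => ∫ y, lerayHeatKernel α t i j k (x - y) * w y)
        (fun m => C m * t ^ (-(((m : ℝ) + 1) / (2 * α))) * A) := by
  choose C hC h using fun m : ℕ =>
    (dilationBounded_kernelNorm (n := n) m).lerayPiece_le (kernelNorm_smul m) hα i j k
  refine ⟨C, hC, fun t ht w A hA0 hw hA => ?_⟩
  have h1 := (kernelDecomposition_leray hα ht i j k).smoothBound_convolution
    (fun m => (h m t ht).1) hw hA
  refine h1.mono fun m => ?_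
  rw [mul_comm]
  exact mul_le_mul_of_nonneg_right (h m t ht).2 hA0

theorem exists_integral_leray_le {α : ℝ} (hα : 1 / 2 < α) (i j k : Fin n) :
    ∃ C, 0 ≤ C ∧ ∀ t, 0 < t → Integrable (lerayHeatKernel α t i j k) ∧
      ∫ x, ‖lerayHeatKernel α t i j k x‖ ≤ C * t ^ (-(1 / (2 * α))) := by
  obtain ⟨C, hC, h⟩ :=
    (dilationBounded_kernelNorm (n := n) 0).lerayPiece_le (kernelNorm_smul 0) hα i j k
  refine ⟨C, hC, fun t ht => ?_⟩
  have h1 := (kernelDecomposition_leray hα ht i j k).integrable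
  refine ⟨h1.1, h1.2.trans ?_⟩
  simpa using (h t ht).2

/-- The dyadic pieces of the symbol of `S(t)`, with the low frequencies of the identity removed. -/
def lowHeatPiece (n : ℕ) (α t : ℝ) (l : ℤ) : 𝓢(Space n, ℂ) :=
  if l ≤ 0 then dilate ((2 : ℝ) ^ l) (by positivity) (profile (isAnnular_dyadic 0) α
    (contDiff_exp_neg_mul_sub_one (t * (2 : ℝ) ^ ((l : ℝ) * (2 * α)))))
  else heatPiece (isAnnular_dyadic 0) α t l

theorem lowHeatPiece_apply (α t : ℝ) (l : ℤ) (ξ : Space n) :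
    lowHeatPiece n α t l ξ = dyadic n l ξ * (heatSymbol α t ξ - if l ≤ 0 then 1 else 0) := by
  unfold lowHeatPiece
  split_ifs with h
  · have h : -(t * (2 : ℝ) ^ ((l : ℝ) * (2 * α))) * fracSymbol α (((2 : ℝ) ^ l)⁻¹ • ξ)
        = -t * fracSymbol α ξ := by
      linear_combination (-t) * two_rpow_mul_fracSymbol α l ξ
    rw [dilate_apply, profile_apply, heatSymbol_eq, Complex.real_smul, mul_comm,
      ← dyadic_eq_comp_smul, h, Complex.ofReal_sub, Complex.ofReal_one]
  · rw [heatPiece_apply, ← dyadic_eq_comp_smul, sub_zero]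

/-- For `d = 0` the pieces of `S(t)` itself need not be summable as `l → -∞`. With the identity
removed they are of size `t * 2 ^ (2αl)` there. -/
theorem DilationBounded.summable_lowHeatPiece {q : 𝓢(Space n, ℂ) → ℝ} {d : ℕ}
    (hq : DilationBounded q d) {α t : ℝ} (hα : 1 / 2 < α) (ht : 0 < t) :
    Summable fun l => q (lowHeatPiece n α t l) := by
  refine Summable.of_nat_of_neg ?_ ?_
  · obtain ⟨C₁, hC₁, h₁⟩ := hq.heatPiece_le (isAnnular_dyadic 0) α (d + 1)
    obtain ⟨C₂, hC₂, h₂⟩ := exists_dyadic_sum_le (β := (d : ℝ) + 1) (c := 2 * α) (N := d + 1)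
      (by positivity) (by linarith) (by
        push_cast
        have : (0 : ℝ) < (d : ℝ) + 1 := by positivity
        nlinarith)
    have h3 := ((h₂ t ht).1.mul_left C₁).comp_injective (i := fun m : ℕ => (m : ℤ))
      Nat.cast_injective
    refine Summable.of_norm_bounded_eventually_nat h3 ?_
    filter_upwards [eventually_ge_atTop 1] with m hm
    have hm' : ¬ ((m : ℤ) ≤ 0) := by omega
    rw [Real.norm_of_nonneg (hq.nonneg _)]
    unfold lowHeatPiece
    rw [if_neg hm']
    refine (h₁ t ht m).trans ?_
    simp only [Function.comp_apply]
    have : (0 : ℝ) ≤ (m : ℝ) := by positivity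
    gcongr
    · exact one_le_two
    · linarith
  · obtain ⟨C, hC, h⟩ := hq.bounded.profile_exp_sub_one_le (isAnnular_dyadic (n := n) 0) α
    have hs := ((summable_two_rpow (b := -(2 * α)) (by linarith)).mul_left t).mul_left C
    have ht0 := (summable_two_rpow (b := -(2 * α)) (by linarith)).mul_left t |>.tendsto_atTop_zero
    refine Summable.of_norm_bounded_eventually_nat hs ?_
    filter_upwards [ht0.eventually_le_const one_pos] with m hm
    have hm' : (-(m : ℤ) ≤ 0) := by omega
    rw [Real.norm_of_nonneg (hq.nonneg _)]
    unfold lowHeatPiece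
    rw [if_pos hm', hq.dilate _ (by positivity)]
    have e : t * (2 : ℝ) ^ (((-(m : ℤ) : ℤ) : ℝ) * (2 * α))
        = t * (2 : ℝ) ^ ((m : ℝ) * -(2 * α)) := by
      push_cast; ring_nf
    have h1 : ((2 : ℝ) ^ (-(m : ℤ))) ^ d ≤ 1 :=
      pow_le_one₀ (by positivity) (zpow_le_one_of_nonpos₀ one_le_two hm')
    calc _ ≤ 1 * q (profile (isAnnular_dyadic 0) α
          (contDiff_exp_neg_mul_sub_one (t * (2 : ℝ) ^ (((-(m : ℤ) : ℤ) : ℝ) * (2 * α))))) := by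
          gcongr
          exact hq.nonneg _
      _ ≤ C * (t * (2 : ℝ) ^ (((-(m : ℤ) : ℤ) : ℝ) * (2 * α))) := by
          rw [one_mul]
          exact h _ (by positivity) (by rw [e]; exact hm)
      _ = _ := by rw [e]

/-- Away from the origin the dyadic functions with `l ≤ 0` telescope to `cutoff n`, which is what
the removed identities add up to; at the origin both sides vanish. -/
theorem kernelDecomposition_heat_sub_cutoff {α t : ℝ} (hα : 1 / 2 < α) (ht : 0 < t) :
    KernelDecomposition (fun ξ : Space n => heatSymbol α t ξ - (cutoff n ξ : ℂ))
      (lowHeatPiece n α t) := by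
  refine ⟨fun ξ => ?_, dilationBounded_integral_norm.summable_lowHeatPiece hα ht,
    (dilationBounded_kernelNorm 0).summable_lowHeatPiece hα ht⟩
  simp only [lowHeatPiece_apply]
  by_cases hξ : ξ = 0
  · have h1 : heatSymbol α t ξ = 1 := by
      have : (2 * α) ≠ 0 := by linarith
      simp [heatSymbol, hξ, Real.zero_rpow this]
    have h2 : cutoff n ξ = 1 := cutoff_eq_one (by simp [hξ])
    have h3 : ∀ l, dyadic n l ξ = 0 := fun l => by
      by_contra h
      have := (norm_of_dyadic_ne_zero h).1
      rw [hξ, norm_zero] at this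
      exact absurd this (by positivity : (0 : ℝ) < 2 ^ (l - 1)).le.not_gt
    simp only [h1, h2, h3, zero_mul]
    simp only [Complex.ofReal_one, sub_self]
    exact hasSum_zero
  · obtain ⟨L, h1, h2, h3⟩ := exists_hasSum_dyadic_mul hξ
    have h4 := h3 fun l => heatSymbol α t ξ - if l ≤ 0 then 1 else 0
    have h5 := dyadic_add_dyadic_succ h1 h2
    convert h4 using 1
    rcases lt_trichotomy L 0 with hL | hL | hL
    · rw [if_pos hL.le, if_pos (by omega), ← add_mul, h5, cutoff_eq_one]
      · simp
      · refine h2.le.trans (zpow_le_one_of_nonpos₀ one_le_two (by omega))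
    · subst hL
      have h6 : dyadic n 0 ξ = cutoff n ξ := by
        unfold dyadic
        rw [cutoff_eq_zero (ξ := (2 : ℝ) ^ (-0 + 1 : ℤ) • ξ)]
        · simp
        · rw [norm_smul]; norm_num at h1 ⊢; exact h1
      rw [if_pos le_rfl, if_neg (by omega), ← h6]
      linear_combination (-heatSymbol α t ξ) * h5
    · rw [if_neg (by omega), if_neg (by omega), ← add_mul, h5, cutoff_eq_zero]
      · simp
      · refine le_trans ?_ h1
        calc (2 : ℝ) = 2 ^ (1 : ℤ) := by norm_num
          _ ≤ _ := zpow_le_zpow_right₀ one_le_two (by omega)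

end Pieces

end

end FracNS

namespace FracNS

noncomputable section

/-! ### Real-valuedness of kernels and blocks. -/

section Conjugation

variable {n : ℕ}

theorem fourierInv_im_eq_zero {f : Space n → ℂ} (hf : ∀ ξ, (starRingEnd ℂ) (f ξ) = f (-ξ))
    (x : Space n) : (𝓕⁻ f x).im = 0 := by
  rw [← Complex.conj_eq_iff_im, Real.fourierInv_eq', ← integral_conj,
    ← integral_neg_eq_self (μ := volume)]
  congr 1
  funext ξ
  have h2 : (starRingEnd ℂ) 2 = 2 := map_ofNat _ 2
  rw [smul_eq_mul, smul_eq_mul, map_mul, hf, ← Complex.exp_conj, neg_neg, inner_neg_left]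
  simp [h2]

theorem conj_fourierInv {f : Space n → ℂ} (hf : ∀ x, (f x).im = 0) (ξ : Space n) :
    (starRingEnd ℂ) (𝓕⁻ f ξ) = 𝓕⁻ f (-ξ) := by
  rw [Real.fourierInv_eq', Real.fourierInv_eq', ← integral_conj]
  congr 1
  funext x
  rw [smul_eq_mul, smul_eq_mul, map_mul, Complex.conj_eq_iff_im.2 (hf x), ← Complex.exp_conj,
    inner_neg_right]
  have h2 : (starRingEnd ℂ) 2 = 2 := map_ofNat _ 2
  simp [h2]

theorem conj_dyadic (l : ℤ) (ξ : Space n) :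
    (starRingEnd ℂ) (dyadic n l ξ) = dyadic n l (-ξ) := by
  unfold dyadic
  rw [Complex.conj_ofReal, smul_neg, smul_neg, (cutoff n).neg, (cutoff n).neg]

theorem conj_heatSymbol (α t : ℝ) (ξ : Space n) :
    (starRingEnd ℂ) (heatSymbol α t ξ) = heatSymbol α t (-ξ) := by
  unfold heatSymbol
  rw [Complex.conj_ofReal, norm_neg]

theorem conj_lerayAmp (i j k : Fin n) (ξ : Space n) :
    (starRingEnd ℂ) (lerayAmp i j k ξ) = lerayAmp i j k (-ξ) := by
  have h := lerayAmp_smul i j k (c := -1) (by norm_num) ξ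
  rw [neg_one_smul] at h
  have h2 : (starRingEnd ℂ) 2 = 2 := map_ofNat _ 2
  rw [h, lerayAmp]
  simp [h2]

theorem heatKernel_im (α t : ℝ) (x : Space n) : (heatKernel α t x).im = 0 :=
  fourierInv_im_eq_zero (conj_heatSymbol α t) x

theorem lerayHeatKernel_im (α t : ℝ) (i j k : Fin n) (x : Space n) :
    (lerayHeatKernel α t i j k x).im = 0 :=
  fourierInv_im_eq_zero (fun ξ => by rw [map_mul, conj_heatSymbol, ← lerayAmp, conj_lerayAmp]; rfl) x

/-- The dyadic symbol is real and even, so the multiplier maps real test functions to real test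
functions. -/
theorem IsReal.block {h : 𝓢'(Space n, ℂ)} (hh : IsReal h) (j : ℤ) : IsReal (block j h) := by
  intro g hg
  have hd : (dyadic n j).HasTemperateGrowth :=
    ((dyadic_hasCompactSupport n j).toSchwartzMap (dyadic_contDiff n j)).hasTemperateGrowth
  unfold FracNS.block
  rw [TemperedDistribution.fourierMultiplierCLM_apply_apply]
  refine hh _ fun x => ?_
  rw [SchwartzMap.fourier_coe]
  have h1 := fourierInv_im_eq_zero
    (f := SchwartzMap.smulLeftCLM ℂ (dyadic n j) (𝓕⁻ g : 𝓢(Space n, ℂ))) (fun ξ => by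
      rw [SchwartzMap.smulLeftCLM_apply_apply hd, SchwartzMap.smulLeftCLM_apply_apply hd,
        SchwartzMap.fourierInv_coe, smul_eq_mul, smul_eq_mul, map_mul, conj_dyadic,
        conj_fourierInv hg]) (-x)
  rwa [Real.fourierInv_eq_fourier_neg, neg_neg] at h1

end Conjugation

/-! ### Bounded representatives of blocks and multipliers acting on them. -/

section Blocks

variable {n : ℕ}

theorem toTemperedDistribution_injective :
    Function.Injective (fun f : Lp ℂ ⊤ (volume : Measure (Space n)) =>
      (Lp.toTemperedDistribution f : 𝓢'(Space n, ℂ))) := by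
  have h := Lp.ker_toTemperedDistributionCLM_eq_bot (E := Space n) (F := ℂ)
    (μ := volume) (p := ⊤)
  exact LinearMap.ker_eq_bot.1 h

theorem ae_norm_le_of_besovNorm_le {α b : ℝ} (hb0 : 0 ≤ b) {h : 𝓢'(Space n, ℂ)}
    (hb : besovNorm α h ≤ ENNReal.ofReal b) (j : ℤ) :
    Lp.toTemperedDistribution (blockFun j h) = block j h ∧
      ∀ᵐ y, ‖blockFun j h y‖ ≤ b * (2 : ℝ) ^ ((j : ℝ) * (2 * α - 1)) := by
  have h1 : ENNReal.ofReal ((2 : ℝ) ^ ((j : ℝ) * (1 - 2 * α))) * linftyNorm (block j h)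
      ≤ ENNReal.ofReal b := (le_iSup (fun j : ℤ =>
        ENNReal.ofReal ((2 : ℝ) ^ ((j : ℝ) * (1 - 2 * α))) * linftyNorm (block j h)) j).trans hb
  have hpos : 0 < (2 : ℝ) ^ ((j : ℝ) * (1 - 2 * α)) := Real.rpow_pos_of_pos two_pos _
  have hpos' : 0 < (2 : ℝ) ^ ((j : ℝ) * (2 * α - 1)) := Real.rpow_pos_of_pos two_pos _
  have h2 : linftyNorm (block j h) ≤ ENNReal.ofReal (b * (2 : ℝ) ^ ((j : ℝ) * (2 * α - 1))) := by
    have e : (1 : ℝ≥0∞) = ENNReal.ofReal ((2 : ℝ) ^ ((j : ℝ) * (2 * α - 1))) *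
        ENNReal.ofReal ((2 : ℝ) ^ ((j : ℝ) * (1 - 2 * α))) := by
      rw [← ENNReal.ofReal_mul hpos'.le, ← Real.rpow_add two_pos]
      ring_nf
      simp
    calc linftyNorm (block j h) = 1 * linftyNorm (block j h) := (one_mul _).symm
      _ = ENNReal.ofReal ((2 : ℝ) ^ ((j : ℝ) * (2 * α - 1))) *
        (ENNReal.ofReal ((2 : ℝ) ^ ((j : ℝ) * (1 - 2 * α))) * linftyNorm (block j h)) := by
          rw [e, mul_assoc]
      _ ≤ ENNReal.ofReal ((2 : ℝ) ^ ((j : ℝ) * (2 * α - 1))) * ENNReal.ofReal b := by gcongr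
      _ = _ := by rw [mul_comm b, ENNReal.ofReal_mul hpos'.le]
  have hex : ∃ f : Lp ℂ ⊤ (volume : Measure (Space n)),
      Lp.toTemperedDistribution f = block j h := by
    -- Without a representative the infimum in `linftyNorm` runs over an empty family and equals
    -- `⊤`.
    by_contra! hne
    have : linftyNorm (block j h) = ⊤ := by
      unfold linftyNorm
      simp [hne]
    rw [this] at h2
    exact absurd h2 (by simp)
  have h3 : Lp.toTemperedDistribution (blockFun j h) = block j h := by
    unfold blockFun
    rw [dif_pos hex]
    exact hex.choose_spec
  refine ⟨h3, ?_⟩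
  have h4 : ‖blockFun j h‖ₑ ≤ linftyNorm (block j h) := by
    unfold linftyNorm
    refine le_iInf₂ fun f hf => ?_
    have : f = blockFun j h := toTemperedDistribution_injective (hf.trans h3.symm)
    rw [this]
  have h5 : eLpNormEssSup (blockFun j h) volume
      ≤ ENNReal.ofReal (b * (2 : ℝ) ^ ((j : ℝ) * (2 * α - 1))) := by
    rw [← eLpNorm_exponent_top, ← Lp.enorm_def]
    exact h4.trans h2
  filter_upwards [ae_le_eLpNormEssSup (f := (blockFun j h : Space n → ℂ)) (μ := volume)] with y hy
  have := hy.trans h5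
  rwa [← ofReal_norm, ENNReal.ofReal_le_ofReal_iff (by positivity)] at this

theorem aestronglyMeasurable_blockFun (j : ℤ) (h : 𝓢'(Space n, ℂ)) :
    AEStronglyMeasurable (blockFun j h : Space n → ℂ) volume := Lp.aestronglyMeasurable _

theorem exists_ae_norm_le (f : Lp ℂ ⊤ (volume : Measure (Space n))) :
    ∃ A, 0 ≤ A ∧ ∀ᵐ y, ‖f y‖ ≤ A := by
  refine ⟨‖f‖, norm_nonneg _, ?_⟩
  have h5 : eLpNormEssSup f volume ≤ ENNReal.ofReal ‖f‖ := by
    rw [← eLpNorm_exponent_top, ← Lp.enorm_def, ofReal_norm]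
  filter_upwards [ae_le_eLpNormEssSup (f := (f : Space n → ℂ)) (μ := volume)] with y hy
  have := hy.trans h5
  rwa [← ofReal_norm, ENNReal.ofReal_le_ofReal_iff (norm_nonneg _)] at this

/-- The imaginary part integrates to zero against every real test function, because the block is a
real distribution; hence it vanishes almost everywhere. -/
theorem blockFun_im {h : 𝓢'(Space n, ℂ)} (hh : IsReal h) (j : ℤ) :
    ∀ᵐ y, (blockFun j h y).im = 0 := by
  by_cases hex : ∃ f : Lp ℂ ⊤ (volume : Measure (Space n)),
      Lp.toTemperedDistribution f = block j h
  swap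
  · unfold blockFun
    rw [dif_neg hex]
    filter_upwards [Lp.coeFn_zero ℂ ⊤ (volume : Measure (Space n))] with y hy
    rw [hy]; rfl
  have h3 : Lp.toTemperedDistribution (blockFun j h) = block j h := by
    unfold blockFun
    rw [dif_pos hex]
    exact hex.choose_spec
  have hloc : LocallyIntegrable (blockFun j h : Space n → ℂ) volume :=
    (Lp.memLp (blockFun j h)).locallyIntegrable le_top
  have hlocim : LocallyIntegrable (fun y => (blockFun j h y).im) volume := fun x => by
    obtain ⟨s, hs, hi⟩ := hloc x
    exact ⟨s, hs, hi.im⟩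
  refine ae_eq_zero_of_integral_contDiff_smul_eq_zero hlocim fun g hg hgs => ?_
  have hg1 : HasCompactSupport (Complex.ofRealCLM ∘ g) := hgs.comp_left rfl
  have hg2 : ContDiff ℝ ∞ (Complex.ofRealCLM ∘ g) := by fun_prop
  have h4 := hh.block j (hg1.toSchwartzMap hg2) (fun x => by simp)
  rw [← h3, Lp.toTemperedDistribution_apply] at h4
  obtain ⟨A, -, hA⟩ := exists_ae_norm_le (blockFun j h)
  have hint : Integrable (fun y => (hg1.toSchwartzMap hg2) y • blockFun j h y) := by
    have := ((hg1.toSchwartzMap hg2).integrable (μ := volume)).bdd_smul A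
      (aestronglyMeasurable_blockFun j h) hA
    refine this.congr (ae_of_all _ fun y => ?_)
    simp [mul_comm]
  have h5 := Complex.imCLM.integral_comp_comm hint
  simp only [Complex.imCLM_apply] at h5
  rw [h4] at h5
  rw [← h5]
  congr 1
  funext y
  simp

/-- The convolution of a bounded function with the kernel whose symbol is a Schwartz function. -/
def multiplierAt (f : Lp ℂ ⊤ (volume : Measure (Space n))) (x : Space n) :
    𝓢(Space n, ℂ) →ₗ[ℂ] ℂ where
  toFun σ := ∫ y, (𝓕⁻ σ : 𝓢(Space n, ℂ)) (x - y) * f y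
  map_add' σ τ := by
    obtain ⟨A, -, hA⟩ := exists_ae_norm_le f
    have hint : ∀ σ : 𝓢(Space n, ℂ), Integrable (fun y => (𝓕⁻ σ : 𝓢(Space n, ℂ)) (x - y) * f y) :=
      fun σ => by
        simpa only [smul_eq_mul, mul_comm] using
          integrable_bounded_smul_schwartz (𝓕⁻ σ : 𝓢(Space n, ℂ)) (Lp.aestronglyMeasurable f) hA x
    rw [← integral_add (hint σ) (hint τ)]
    congr 1
    funext y
    rw [FourierTransform.fourierInv_add, add_apply, add_mul]
  map_smul' c σ := by
    rw [RingHom.id_apply, smul_eq_mul, ← integral_const_mul]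
    congr 1
    funext y
    rw [FourierTransform.fourierInv_smul, smul_apply, smul_eq_mul, mul_assoc]

theorem multiplierAt_apply (f : Lp ℂ ⊤ (volume : Measure (Space n))) (x : Space n)
    (σ : 𝓢(Space n, ℂ)) :
    multiplierAt f x σ = ∫ y, (𝓕⁻ σ : 𝓢(Space n, ℂ)) (x - y) * f y := rfl

/-- The Schwartz function `y ↦ (𝓕⁻ σ) (x - y)`. -/
def reflectedKernel (σ : 𝓢(Space n, ℂ)) (x : Space n) : 𝓢(Space n, ℂ) :=
  SchwartzMap.compSubConstCLM ℂ x (SchwartzMap.compCLMOfContinuousLinearEquiv ℂ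
    (ContinuousLinearEquiv.neg ℝ : Space n ≃L[ℝ] Space n) (𝓕⁻ σ : 𝓢(Space n, ℂ)))

theorem reflectedKernel_apply (σ : 𝓢(Space n, ℂ)) (x y : Space n) :
    reflectedKernel σ x y = (𝓕⁻ σ : 𝓢(Space n, ℂ)) (x - y) := by
  simp [reflectedKernel]

theorem fourierInv_reflectedKernel (σ : 𝓢(Space n, ℂ)) (x ξ : Space n) :
    (𝓕⁻ (reflectedKernel σ x) : 𝓢(Space n, ℂ)) ξ
      = (Real.fourierChar (inner ℝ x ξ) : ℂ) * σ ξ := by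
  rw [SchwartzMap.fourierInv_coe, Real.fourierInv_eq]
  simp only [reflectedKernel_apply]
  rw [← integral_sub_left_eq_self _ volume x]
  simp only [sub_sub_cancel]
  have h1 : ∀ z : Space n, Real.fourierChar (inner ℝ (x - z) ξ) • (𝓕⁻ σ : 𝓢(Space n, ℂ)) z
      = (Real.fourierChar (inner ℝ x ξ) : ℂ) *
        (Real.fourierChar (-inner ℝ z ξ) • (𝓕⁻ σ : 𝓢(Space n, ℂ)) z) := fun z => by
    rw [inner_sub_left, sub_eq_add_neg, AddChar.map_add_eq_mul, Circle.smul_def, Circle.smul_def,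
      Circle.coe_mul, smul_eq_mul, smul_eq_mul, mul_assoc]
  simp only [h1]
  rw [integral_const_mul, ← Real.fourier_eq, ← SchwartzMap.fourier_coe,
    FourierTransform.fourier_fourierInv_eq]

/-- A multiplier acts on the block `P_j h` only through the values of its symbol where the
`j`-th function of the dyadic partition does not vanish. -/
theorem multiplierAt_eq_zero {f : Lp ℂ ⊤ (volume : Measure (Space n))} {h : 𝓢'(Space n, ℂ)} {j : ℤ}
    (hf : Lp.toTemperedDistribution f = block j h) {σ : 𝓢(Space n, ℂ)}
    (hσ : ∀ ξ, dyadic n j ξ * σ ξ = 0) (x : Space n) : multiplierAt f x σ = 0 := by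
  have hd : (dyadic n j).HasTemperateGrowth :=
    ((dyadic_hasCompactSupport n j).toSchwartzMap (dyadic_contDiff n j)).hasTemperateGrowth
  have h1 : multiplierAt f x σ = Lp.toTemperedDistribution f (reflectedKernel σ x) := by
    rw [Lp.toTemperedDistribution_apply, multiplierAt_apply]
    simp only [reflectedKernel_apply, smul_eq_mul]
  rw [h1, hf, block, TemperedDistribution.fourierMultiplierCLM_apply_apply]
  -- The inverse transform of the reflected kernel is `σ` times a character, so multiplication by
  -- `dyadic n j` annihilates it.
  have h2 : SchwartzMap.smulLeftCLM ℂ (dyadic n j) (𝓕⁻ (reflectedKernel σ x) : 𝓢(Space n, ℂ))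
      = 0 := by
    ext ξ
    rw [SchwartzMap.smulLeftCLM_apply_apply hd, fourierInv_reflectedKernel, smul_eq_mul,
      mul_left_comm, hσ, mul_zero]
    rfl
  rw [h2, FourierTransform.fourier_zero, map_zero]

end Blocks

end

end FracNS

namespace FracNS

noncomputable section

/-! ### The linear flow on the homogeneous Besov space. -/

section HeatFlow

variable {n : ℕ}

theorem KernelDecomposition.integrable_symbol {m : Space n → ℂ} {ψ : ℤ → 𝓢(Space n, ℂ)}
    (h : KernelDecomposition m ψ) : Integrable m := by
  have := (integrable_tsum_of_summable_integral_norm (μ := volume) (f := fun l ξ => ψ l ξ)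
    (fun l => (ψ l).integrable) h.summable).1
  simpa only [(h.hasSum _).tsum_eq] using this

/-- The cut-off as a Schwartz function. -/
def cutoffSchwartz (n : ℕ) : 𝓢(Space n, ℂ) :=
  HasCompactSupport.toSchwartzMap (f := fun ξ => (cutoff n ξ : ℂ))
    ((cutoff n).hasCompactSupport.comp_left (g := fun x : ℝ => (x : ℂ)) (by simp))
    (Complex.ofRealCLM.contDiff.comp (cutoff n).contDiff)

theorem cutoffSchwartz_apply (ξ : Space n) : cutoffSchwartz n ξ = (cutoff n ξ : ℂ) := rfl

theorem heatKernel_eq_add {α t : ℝ} (hα : 1 / 2 < α) (ht : 0 < t) (x : Space n) :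
    heatKernel α t x = 𝓕⁻ (fun ξ : Space n => heatSymbol α t ξ - (cutoff n ξ : ℂ)) x
      + (𝓕⁻ (cutoffSchwartz n) : 𝓢(Space n, ℂ)) x := by
  have hi : ∀ {f : Space n → ℂ}, Integrable f →
      Integrable fun ξ => Real.fourierChar (inner ℝ ξ x) • f ξ := fun {f} hf => by
    have := (Real.fourierIntegral_convergent_iff (μ := volume) (V := Space n) (f := f) (-x)).2 hf
    simpa using this
  have h1 := (kernelDecomposition_heat_sub_cutoff (n := n) hα ht).integrable_symbol
  rw [heatKernel, SchwartzMap.fourierInv_coe, Real.fourierInv_eq, Real.fourierInv_eq,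
    Real.fourierInv_eq, ← integral_add (hi h1) (hi (cutoffSchwartz n).integrable)]
  congr 1
  funext ξ
  rw [← smul_add, cutoffSchwartz_apply, sub_add_cancel]

/-- `S(t)` acts on the block `P_j h` through a kernel with a localized symbol. -/
theorem integral_heatKernel_mul_eq {α t : ℝ} (hα : 1 / 2 < α) (ht : 0 < t)
    {f : Lp ℂ ⊤ (volume : Measure (Space n))} {h : 𝓢'(Space n, ℂ)} {j : ℤ}
    (hf : Lp.toTemperedDistribution f = block j h) (x : Space n) :
    ∫ y, heatKernel α t (x - y) * f y
      = ∫ y, (𝓕⁻ (heatPiece isAnnular_fatDyadic α t j) : 𝓢(Space n, ℂ)) (x - y) * f y := by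
  obtain ⟨A, -, hA⟩ := exists_ae_norm_le f
  have hm := Lp.aestronglyMeasurable f
  have hK := kernelDecomposition_heat_sub_cutoff (n := n) hα ht
  have hS : HasSum (fun l => multiplierAt f x (lowHeatPiece n α t l))
      (∫ y, 𝓕⁻ (fun ξ : Space n => heatSymbol α t ξ - (cutoff n ξ : ℂ)) (x - y) * f y) :=
    hK.convolution_eq hm hA x
  -- Only neighbouring pieces overlap the `j`-th dyadic function, so the series collapses to a
  -- single Schwartz symbol that can be compared with `heatPiece`.
  set s : Finset ℤ := {j - 1, j, j + 1}
  have hfar : ∀ l ∉ s, 2 ≤ |j - l| := fun l hl => by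
    simp only [s, Finset.mem_insert, Finset.mem_singleton, not_or] at hl
    rw [le_abs]
    omega
  have hfar' : ∀ l ∉ s, ∀ ξ, dyadic n j ξ * lowHeatPiece n α t l ξ = 0 := fun l hl ξ => by
    rw [lowHeatPiece_apply, ← mul_assoc, dyadic_mul_dyadic_eq_zero (hfar l hl), zero_mul]
  have h1 : ∫ y, 𝓕⁻ (fun ξ : Space n => heatSymbol α t ξ - (cutoff n ξ : ℂ)) (x - y) * f y
      = ∑ l ∈ s, multiplierAt f x (lowHeatPiece n α t l) :=
    hS.unique (hasSum_sum_of_ne_finset_zero fun l hl => multiplierAt_eq_zero hf (hfar' l hl) x)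
  have h2 : ∫ y, heatKernel α t (x - y) * f y
      = multiplierAt f x (∑ l ∈ s, lowHeatPiece n α t l + cutoffSchwartz n) := by
    rw [map_add, map_sum, ← h1, multiplierAt_apply, ← integral_add]
    · congr 1
      funext y
      rw [← add_mul, heatKernel_eq_add hα ht]
    · have := ((hK.integrable.1.comp_sub_left x).bdd_smul A hm hA)
      refine this.congr (ae_of_all _ fun y => ?_)
      simp [mul_comm]
    · have := integrable_bounded_smul_schwartz (𝓕⁻ (cutoffSchwartz n) : 𝓢(Space n, ℂ)) hm hA x
      simpa only [smul_eq_mul, mul_comm] using this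
  rw [h2, ← multiplierAt_apply, ← sub_eq_zero, ← map_sub]
  refine multiplierAt_eq_zero hf (fun ξ => ?_) x
  have h3 : dyadic n j ξ * (heatSymbol α t ξ - (cutoff n ξ : ℂ))
      = dyadic n j ξ * (∑ l ∈ s, lowHeatPiece n α t l) ξ := by
    have h4 := (hK.hasSum ξ).mul_left (dyadic n j ξ)
    have h5 := h4.unique (hasSum_sum_of_ne_finset_zero fun l hl => hfar' l hl ξ)
    rw [h5, sum_apply, Finset.mul_sum]
  have h6 : dyadic n j ξ * heatPiece isAnnular_fatDyadic α t j ξ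
      = dyadic n j ξ * heatSymbol α t ξ := by
    rw [heatPiece_apply, ← mul_assoc, dyadic_mul_fatDyadic]
  change dyadic n j ξ * ((∑ l ∈ s, lowHeatPiece n α t l) ξ + cutoffSchwartz n ξ
    - heatPiece isAnnular_fatDyadic α t j ξ) = 0
  rw [mul_sub, mul_add, ← h3, h6, cutoffSchwartz_apply]
  ring

/-- The smoothing estimate for `S(t)` on the homogeneous Besov space. -/
theorem exists_smoothBound_heatFlow (n : ℕ) {α : ℝ} (hα : 1 / 2 < α) :
    ∃ C : ℕ → ℝ, (∀ k, 0 ≤ C k) ∧ ∀ (h : 𝓢'(Space n, ℂ)) (b : ℝ), 0 ≤ b →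
      besovNorm α h ≤ ENNReal.ofReal b → ∀ t, 0 < t →
      SmoothBound (heatFlow α t h)
        (fun k => C k * t ^ (-((1 - 1 / (2 * α)) + k / (2 * α))) * b) ∧
      ∀ x, Summable fun j => ∫ y, heatKernel α t (x - y) * blockFun j h y := by
  choose C₁ hC₁ h₁ using fun k : ℕ => (dilationBounded_kernelNorm (n := n) k).heatPiece_le
    (isAnnular_fatDyadic (n := n)) α (k + 2)
  have hβ : ∀ k : ℕ, (0 : ℝ) < (2 * α - 1) + k := fun k => by
    have : (0 : ℝ) ≤ k := by positivity
    linarith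
  -- The block contributes the growth exponent `2α - 1` and the derivatives contribute `k`. The
  -- total is positive, and decay of order `k + 2` beats it.
  choose C₂ hC₂ h₂ using fun k : ℕ => exists_dyadic_sum_le (β := (2 * α - 1) + k) (c := 2 * α)
    (N := k + 2) (hβ k) (by linarith) (by
      push_cast
      have : (0 : ℝ) ≤ k := by positivity
      nlinarith)
  refine ⟨fun k => C₁ k * C₂ k, fun k => mul_nonneg (hC₁ k) (hC₂ k), fun h b hb hB t ht => ?_⟩
  have hterm : ∀ j, SmoothBound (fun x => ∫ y, heatKernel α t (x - y) * blockFun j h y)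
      (fun k => C₁ k * b * ((2 : ℝ) ^ ((j : ℝ) * ((2 * α - 1) + k)) *
        ((1 + t * (2 : ℝ) ^ ((j : ℝ) * (2 * α))) ^ (k + 2))⁻¹)) := by
    intro j
    obtain ⟨hf, hA⟩ := ae_norm_le_of_besovNorm_le hb hB j
    have := smoothBound_convolution_fourierInv (heatPiece isAnnular_fatDyadic α t j)
      (aestronglyMeasurable_blockFun j h) hA
    simp only [← integral_heatKernel_mul_eq hα ht hf] at this
    refine this.mono fun k => ?_
    calc _ ≤ b * (2 : ℝ) ^ ((j : ℝ) * (2 * α - 1)) * (C₁ k * ((2 : ℝ) ^ ((j : ℝ) * k) *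
          ((1 + t * (2 : ℝ) ^ ((j : ℝ) * (2 * α))) ^ (k + 2))⁻¹)) := by
          gcongr
          exact h₁ k t ht j
      _ = _ := by
          rw [mul_add (j : ℝ) (2 * α - 1), Real.rpow_add two_pos]
          ring
  have hsum : ∀ k, Summable fun j : ℤ => C₁ k * b * ((2 : ℝ) ^ ((j : ℝ) * ((2 * α - 1) + k)) *
        ((1 + t * (2 : ℝ) ^ ((j : ℝ) * (2 * α))) ^ (k + 2))⁻¹) := fun k =>
    (h₂ k t ht).1.mul_left _
  refine ⟨(SmoothBound.tsum hterm hsum).mono fun k => ?_, fun x =>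
    Summable.of_norm_bounded (hsum 0) fun j => (hterm j).norm_le x⟩
  rw [tsum_mul_left]
  calc _ ≤ C₁ k * b * (C₂ k * t ^ (-(((2 * α - 1) + k) / (2 * α)))) := by
        gcongr
        · exact mul_nonneg (hC₁ k) hb
        · exact (h₂ k t ht).2
    _ = _ := by
        have e : -(((2 * α - 1) + k) / (2 * α)) = -((1 - 1 / (2 * α)) + (k : ℝ) / (2 * α)) := by
          field_simp
        rw [e]; ring

theorem heatFlow_im {h : 𝓢'(Space n, ℂ)} (hh : IsReal h) (α t : ℝ) (x : Space n) :
    (heatFlow α t h x).im = 0 := by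
  have h1 : ∀ j, ∫ y, heatKernel α t (x - y) * blockFun j h y
      = ((∫ y, (heatKernel α t (x - y)).re * (blockFun j h y).re : ℝ) : ℂ) := fun j => by
    rw [← integral_complex_ofReal]
    refine integral_congr_ae ?_
    filter_upwards [blockFun_im hh j] with y hy
    apply Complex.ext
    · simp [hy]
    · simp [hy, heatKernel_im]
  unfold heatFlow
  simp only [h1]
  rw [← Complex.ofReal_tsum, Complex.ofReal_im]

theorem stronglyMeasurable_heatKernel (α : ℝ) :
    StronglyMeasurable fun p : ℝ × Space n => heatKernel α p.1 p.2 := by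
  unfold heatKernel
  simp only [Real.fourierInv_eq']
  refine StronglyMeasurable.integral_prod_right (f := fun (p : ℝ × Space n) (ξ : Space n) =>
    Complex.exp (((2 * Real.pi * inner ℝ ξ p.2 : ℝ) : ℂ) * Complex.I) • heatSymbol α p.1 ξ) ?_
  refine Measurable.stronglyMeasurable ?_
  unfold heatSymbol
  simp only [Function.uncurry_def]
  fun_prop

theorem stronglyMeasurable_lerayHeatKernel (α : ℝ) (i j k : Fin n) :
    StronglyMeasurable fun p : ℝ × Space n => lerayHeatKernel α p.1 i j k p.2 := by
  unfold lerayHeatKernel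
  simp only [Real.fourierInv_eq']
  refine StronglyMeasurable.integral_prod_right (f := fun (p : ℝ × Space n) (ξ : Space n) =>
    Complex.exp (((2 * Real.pi * inner ℝ ξ p.2 : ℝ) : ℂ) * Complex.I) •
      (2 * Real.pi * Complex.I * (ξ k : ℂ) * (leraySymbol i j ξ : ℂ) * heatSymbol α p.1 ξ)) ?_
  refine Measurable.stronglyMeasurable ?_
  unfold heatSymbol leraySymbol
  simp only [Function.uncurry_def]
  fun_prop

/-- The flow is a pointwise limit of finite partial sums. Convergence is known only for positive
times, hence the truncation. -/
theorem measurable_heatFlow {α b : ℝ} (hα : 1 / 2 < α) {h : 𝓢'(Space n, ℂ)} (hb : 0 ≤ b)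
    (hB : besovNorm α h ≤ ENNReal.ofReal b) :
    Measurable fun p : ℝ × Space n => if 0 < p.1 then heatFlow α p.1 h p.2 else 0 := by
  obtain ⟨C, -, hC⟩ := exists_smoothBound_heatFlow n hα
  have hs : MeasurableSet {p : ℝ × Space n | 0 < p.1} :=
    measurableSet_lt measurable_const measurable_fst
  have hterm : ∀ j, Measurable fun p : ℝ × Space n =>
      ∫ y, heatKernel α p.1 (p.2 - y) * blockFun j h y := fun j => by
    have hm := aestronglyMeasurable_blockFun j h
    have e : (fun p : ℝ × Space n => ∫ y, heatKernel α p.1 (p.2 - y) * blockFun j h y)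
        = fun p : ℝ × Space n => ∫ y, heatKernel α p.1 (p.2 - y) * hm.mk _ y := by
      funext p
      refine integral_congr_ae ?_
      filter_upwards [hm.ae_eq_mk] with y hy
      rw [← hy]
    rw [e]
    refine (StronglyMeasurable.integral_prod_right (f := fun (p : ℝ × Space n) (y : Space n) =>
      heatKernel α p.1 (p.2 - y) * hm.mk _ y) ?_).measurable
    have h1 : Measurable fun q : (ℝ × Space n) × Space n => (q.1.1, q.1.2 - q.2) := by fun_prop
    exact ((stronglyMeasurable_heatKernel α).comp_measurable h1).mul
      (hm.stronglyMeasurable_mk.comp_measurable measurable_snd)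
  refine measurable_of_tendsto_metrizable' (atTop : Filter (Finset ℤ))
    (f := fun (s : Finset ℤ) (p : ℝ × Space n) => if 0 < p.1 then
      ∑ j ∈ s, ∫ y, heatKernel α p.1 (p.2 - y) * blockFun j h y else 0)
    (fun s => Measurable.ite hs (Finset.measurable_fun_sum _ fun j _ => hterm j) measurable_const) ?_
  rw [tendsto_pi_nhds]
  intro p
  by_cases hp : 0 < p.1
  · simp only [hp, if_true]
    exact ((hC h b hb hB p.1 hp).2 p.2).hasSum
  · simp only [hp, if_false]
    exact tendsto_const_nhds

end HeatFlow

end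

end FracNS

namespace FracNS

noncomputable section

/-! ### Beta-type integrals in time. -/

section TimeIntegrals

theorem integrableOn_rpow_sub_left {t p : ℝ} (ht : 0 ≤ t) (hp : -1 < p) :
    IntegrableOn (fun s : ℝ => (t - s) ^ p) (Set.Ioc 0 t) := by
  have h := (intervalIntegral.intervalIntegrable_rpow' (a := 0) (b := t) hp).comp_sub_left t
  simp only [sub_zero, sub_self] at h
  exact (intervalIntegrable_iff_integrableOn_Ioc_of_le ht).1 h.symm

theorem setIntegral_rpow_sub_left {t c p : ℝ} (hct : c ≤ t) (hp : -1 < p) :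
    ∫ s in Set.Ioc c t, (t - s) ^ p = (t - c) ^ (p + 1) / (p + 1) := by
  rw [← intervalIntegral.integral_of_le hct,
    intervalIntegral.integral_comp_sub_left (fun s : ℝ => s ^ p) t, sub_self,
    integral_rpow (Or.inl hp), Real.zero_rpow (by linarith), sub_zero]

theorem integrableOn_rpow_Ioc {t p : ℝ} (ht : 0 ≤ t) (hp : -1 < p) :
    IntegrableOn (fun s : ℝ => s ^ p) (Set.Ioc 0 t) :=
  (intervalIntegrable_iff_integrableOn_Ioc_of_le ht).1 (intervalIntegral.intervalIntegrable_rpow' hp)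

theorem setIntegral_rpow_Ioc {t p : ℝ} (ht : 0 ≤ t) (hp : -1 < p) :
    ∫ s in Set.Ioc 0 t, s ^ p = t ^ (p + 1) / (p + 1) := by
  rw [← intervalIntegral.integral_of_le ht, integral_rpow (Or.inl hp),
    Real.zero_rpow (by linarith), sub_zero]

/-- A majorant of `(t - s) ^ (-r) * s ^ (-q)` with an explicit integral. -/
def betaMajorant (r q t s : ℝ) : ℝ :=
  (t / 2) ^ (-r) * s ^ (-q) + (t / 2) ^ (-q) * (t - s) ^ (-r)

theorem le_betaMajorant {r q t s : ℝ} (hr : 0 ≤ r) (hq : 0 ≤ q) (hs : 0 < s) (hst : s < t) :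
    (t - s) ^ (-r) * s ^ (-q) ≤ betaMajorant r q t s := by
  unfold betaMajorant
  have h1 : 0 < t - s := by linarith
  rcases le_total s (t / 2) with h | h
  · have h2 : (t - s) ^ (-r) ≤ (t / 2) ^ (-r) :=
      Real.rpow_le_rpow_of_nonpos (by linarith) (by linarith) (by linarith)
    have : 0 ≤ (t / 2) ^ (-q) * (t - s) ^ (-r) := by
      have : 0 < t / 2 := by linarith
      positivity
    have h3 : (t - s) ^ (-r) * s ^ (-q) ≤ (t / 2) ^ (-r) * s ^ (-q) := by gcongr
    linarith
  · have h2 : s ^ (-q) ≤ (t / 2) ^ (-q) :=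
      Real.rpow_le_rpow_of_nonpos (by linarith) (by linarith) (by linarith)
    have : 0 ≤ (t / 2) ^ (-r) * s ^ (-q) := by
      have : 0 < t / 2 := by linarith
      positivity
    have h3 : (t - s) ^ (-r) * s ^ (-q) ≤ (t - s) ^ (-r) * (t / 2) ^ (-q) := by gcongr
    linarith

theorem integrableOn_betaMajorant {r q t : ℝ} (hr : r < 1) (hq : q < 1) (ht : 0 ≤ t) :
    IntegrableOn (betaMajorant r q t) (Set.Ioc 0 t) :=
  ((integrableOn_rpow_Ioc ht (by linarith)).const_mul _).add
    ((integrableOn_rpow_sub_left ht (by linarith)).const_mul _)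

/-- It is applied with `r = 1/(2α)` and `q = 2(1 - r)`: the two conditions become `α > 1/2` and `α <
1`, and the resulting exponent `1 - r - q` is `-(1 - r)`, the weight of the solution space. -/
theorem exists_setIntegral_betaMajorant_eq {r q : ℝ} (hr : r < 1) (hq : q < 1) :
    ∃ B, 0 ≤ B ∧ ∀ t, 0 < t → ∫ s in Set.Ioc 0 t, betaMajorant r q t s = B * t ^ (1 - r - q) := by
  refine ⟨2 ^ r / (1 - q) + 2 ^ q / (1 - r), ?_, fun t ht => ?_⟩
  · have h1 : 0 < 1 - q := by linarith
    have h2 : 0 < 1 - r := by linarith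
    positivity
  · unfold betaMajorant
    rw [integral_add ((integrableOn_rpow_Ioc ht.le (by linarith)).const_mul _)
      ((integrableOn_rpow_sub_left ht.le (by linarith)).const_mul _), integral_const_mul,
      integral_const_mul, setIntegral_rpow_Ioc ht.le (by linarith),
      setIntegral_rpow_sub_left ht.le (by linarith), sub_zero,
      Real.div_rpow ht.le two_pos.le, Real.div_rpow ht.le two_pos.le,
      Real.rpow_neg two_pos.le, Real.rpow_neg two_pos.le]
    have e1 : t ^ (-r) * t ^ (-q + 1) = t ^ (1 - r - q) := by
      rw [← Real.rpow_add ht]; ring_nf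
    have e2 : t ^ (-q) * t ^ (-r + 1) = t ^ (1 - r - q) := by
      rw [← Real.rpow_add ht]; ring_nf
    calc _ = 2 ^ r * (t ^ (-r) * t ^ (-q + 1)) / (1 - q)
          + 2 ^ q * (t ^ (-q) * t ^ (-r + 1)) / (1 - r) := by
          rw [div_inv_eq_mul, div_inv_eq_mul]
          ring_nf
      _ = _ := by rw [e1, e2]; ring

end TimeIntegrals

/-! ### Sup-norm and smoothing estimates for the Duhamel operator. -/

section Duhamel

variable {n : ℕ}

/-- The operator `∫₀ᵗ ∂_k Π_ij S(t - s) w(s) ds`. -/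
def lerayDuhamel (α : ℝ) (i j k : Fin n) (w : ℝ → Space n → ℂ) (t : ℝ) (x : Space n) : ℂ :=
  ∫ s in (0 : ℝ)..t, ∫ y, lerayHeatKernel α (t - s) i j k (x - y) * w s y

theorem stronglyMeasurable_lerayConvolution (α : ℝ) (i j k : Fin n) {w : ℝ → Space n → ℂ}
    (hw : Measurable (Function.uncurry w)) :
    StronglyMeasurable fun q : (ℝ × Space n) × ℝ =>
      ∫ y, lerayHeatKernel α (q.1.1 - q.2) i j k (q.1.2 - y) * w q.2 y := by
  refine StronglyMeasurable.integral_prod_right (f := fun (q : (ℝ × Space n) × ℝ) (y : Space n) =>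
      lerayHeatKernel α (q.1.1 - q.2) i j k (q.1.2 - y) * w q.2 y) ?_
  have h1 : Measurable fun q : ((ℝ × Space n) × ℝ) × Space n =>
      (q.1.1.1 - q.1.2, q.1.1.2 - q.2) := by fun_prop
  have h2 : Measurable fun q : ((ℝ × Space n) × ℝ) × Space n => (q.1.2, q.2) := by fun_prop
  exact ((stronglyMeasurable_lerayHeatKernel α i j k).comp_measurable h1).mul
    (hw.comp h2).stronglyMeasurable

theorem aestronglyMeasurable_lerayConvolution (α : ℝ) (i j k : Fin n) {w : ℝ → Space n → ℂ}
    (hw : Measurable (Function.uncurry w)) (t : ℝ) (x : Space n) (μ : Measure ℝ) :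
    AEStronglyMeasurable (fun s => ∫ y, lerayHeatKernel α (t - s) i j k (x - y) * w s y) μ :=
  ((stronglyMeasurable_lerayConvolution α i j k hw).comp_measurable
    (by fun_prop : Measurable fun s : ℝ => ((t, x), s))).aestronglyMeasurable

theorem lerayDuhamel_eq {α : ℝ} {i j k : Fin n} {w : ℝ → Space n → ℂ} {t : ℝ} (ht : 0 < t)
    (x : Space n) : lerayDuhamel α i j k w t x
      = ∫ s in Set.Ioc 0 t, ∫ y, lerayHeatKernel α (t - s) i j k (x - y) * w s y := by
  rw [lerayDuhamel, intervalIntegral.integral_of_le ht.le]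

theorem measurable_lerayDuhamel (α : ℝ) (i j k : Fin n) {w : ℝ → Space n → ℂ}
    (hw : Measurable (Function.uncurry w)) :
    Measurable fun p : ℝ × Space n => if 0 < p.1 then lerayDuhamel α i j k w p.1 p.2 else 0 := by
  have hs : MeasurableSet {p : ℝ × Space n | 0 < p.1} :=
    measurableSet_lt measurable_const measurable_fst
  have hs2 : MeasurableSet {q : (ℝ × Space n) × ℝ | 0 < q.2 ∧ q.2 ≤ q.1.1} :=
    (measurableSet_lt measurable_const measurable_snd).inter
      (measurableSet_le measurable_snd (measurable_fst.comp measurable_fst))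
  have h1 : StronglyMeasurable fun p : ℝ × Space n => ∫ s, (if 0 < s ∧ s ≤ p.1 then
      ∫ y, lerayHeatKernel α (p.1 - s) i j k (p.2 - y) * w s y else 0) := by
    refine StronglyMeasurable.integral_prod_right (f := fun (p : ℝ × Space n) (s : ℝ) =>
      if 0 < s ∧ s ≤ p.1 then
        ∫ y, lerayHeatKernel α (p.1 - s) i j k (p.2 - y) * w s y else 0) ?_
    exact StronglyMeasurable.ite hs2 (stronglyMeasurable_lerayConvolution α i j k hw)
      stronglyMeasurable_const
  have h2 : (fun p : ℝ × Space n => if 0 < p.1 then lerayDuhamel α i j k w p.1 p.2 else 0)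
      = fun p : ℝ × Space n => if 0 < p.1 then ∫ s, (if 0 < s ∧ s ≤ p.1 then
      ∫ y, lerayHeatKernel α (p.1 - s) i j k (p.2 - y) * w s y else 0) else 0 := by
    funext p
    by_cases hp : 0 < p.1
    · rw [if_pos hp, if_pos hp, lerayDuhamel_eq hp, ← integral_indicator measurableSet_Ioc]
      congr 1 with s
      simp only [Set.indicator_apply, Set.mem_Ioc]
    · rw [if_neg hp, if_neg hp]
  rw [h2]
  exact Measurable.ite hs h1.measurable measurable_const

variable {α : ℝ}

theorem half_lt_one_div (hα' : α < 1) (hα : 1 / 2 < α) : 1 / 2 < 1 / (2 * α) := by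
  rw [div_lt_div_iff₀ two_pos (by linarith)]; linarith

theorem one_div_lt_one (hα : 1 / 2 < α) : 1 / (2 * α) < 1 := by
  rw [div_lt_one (by linarith)]; linarith

/-- The endpoint `s = t` is discarded because the kernel estimates need the positive time `t - s`.
-/
theorem ae_restrict_Ioc_lt {t : ℝ} {P : ℝ → Prop} (h : ∀ s, 0 < s → s < t → P s) :
    ∀ᵐ s ∂(volume.restrict (Set.Ioc 0 t)), P s := by
  rw [ae_restrict_iff' measurableSet_Ioc]
  have h1 : ∀ᵐ s : ℝ, s ≠ t := by simp [ae_iff, measure_singleton]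
  filter_upwards [h1] with s hs hst
  exact h s hst.1 (lt_of_le_of_ne hst.2 hs)

/-- The `L^∞` estimate for the Duhamel operator. -/
theorem exists_lerayDuhamel_le (hα : 1 / 2 < α) (hα' : α < 1) (i j k : Fin n) :
    ∃ C, 0 ≤ C ∧ ∀ (w : ℝ → Space n → ℂ) (A : ℝ), 0 ≤ A → Measurable (Function.uncurry w) →
      (∀ s, 0 < s → ∀ y, ‖w s y‖ ≤ A * s ^ (-(2 * (1 - 1 / (2 * α))))) → ∀ t, 0 < t → ∀ x,
      IntegrableOn (fun s => ∫ y, lerayHeatKernel α (t - s) i j k (x - y) * w s y) (Set.Ioc 0 t) ∧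
      ‖lerayDuhamel α i j k w t x‖ ≤ C * A * t ^ (-(1 - 1 / (2 * α))) := by
  have hr1 := one_div_lt_one hα
  have hr2 := half_lt_one_div hα' hα
  obtain ⟨C, hC, h⟩ := exists_smoothBound_leray (n := n) hα i j k
  obtain ⟨B, hB, hBt⟩ := exists_setIntegral_betaMajorant_eq (r := 1 / (2 * α))
    (q := 2 * (1 - 1 / (2 * α))) hr1 (by linarith)
  refine ⟨C 0 * B, mul_nonneg (hC 0) hB, fun w A hA hw hwA t ht x => ?_⟩
  have hbd : ∀ᵐ s ∂(volume.restrict (Set.Ioc 0 t)),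
      ‖∫ y, lerayHeatKernel α (t - s) i j k (x - y) * w s y‖ ≤
      C 0 * A * betaMajorant (1 / (2 * α)) (2 * (1 - 1 / (2 * α))) t s := by
    refine ae_restrict_Ioc_lt fun s hs hst => ?_
    have h1 := (h (t - s) (by linarith) (w s) (A * s ^ (-(2 * (1 - 1 / (2 * α)))))
      (by positivity) (hw.of_uncurry_left.aestronglyMeasurable)
      (ae_of_all _ (hwA s hs))).norm_le x
    refine h1.trans ?_
    have h2 := le_betaMajorant (r := 1 / (2 * α)) (q := 2 * (1 - 1 / (2 * α))) (by linarith)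
      (by linarith) hs hst
    calc _ = C 0 * A * ((t - s) ^ (-(1 / (2 * α))) * s ^ (-(2 * (1 - 1 / (2 * α))))) := by
          simp only [Nat.cast_zero, zero_add]; ring
      _ ≤ _ := mul_le_mul_of_nonneg_left h2 (mul_nonneg (hC 0) hA)
  have hint := (integrableOn_betaMajorant (r := 1 / (2 * α)) (q := 2 * (1 - 1 / (2 * α)))
    hr1 (by linarith) ht.le).const_mul (C 0 * A)
  refine ⟨Integrable.mono' hint (aestronglyMeasurable_lerayConvolution α i j k hw t x _) hbd, ?_⟩
  rw [lerayDuhamel_eq ht]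
  refine (norm_integral_le_of_norm_le hint hbd).trans (le_of_eq ?_)
  rw [integral_const_mul, hBt t ht]
  have e : 1 - 1 / (2 * α) - 2 * (1 - 1 / (2 * α)) = -(1 - 1 / (2 * α)) := by ring
  rw [e]; ring

theorem exists_pos_mul_rpow_le {K κ a : ℝ} (hκ : 0 < κ) (ha : 0 < a) :
    ∃ η, 0 < η ∧ η ≤ 1 / 2 ∧ K * η ^ a ≤ κ := by
  have h1 : Tendsto (fun η : ℝ => K * η ^ a) (𝓝[>] 0) (𝓝 (K * 0 ^ a)) :=
    ((Real.continuousAt_rpow_const 0 a (Or.inr ha.le)).continuousWithinAt.tendsto).const_mul K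
  rw [Real.zero_rpow ha.ne', mul_zero] at h1
  have h2 := h1.eventually_le_const hκ
  have h3 : ∀ᶠ η : ℝ in 𝓝[>] 0, η ≤ 1 / 2 :=
    mem_nhdsWithin_of_mem_nhds (Iic_mem_nhds (by norm_num))
  obtain ⟨η, h4, h5, h6⟩ := (h2.and (h3.and self_mem_nhdsWithin)).exists
  exact ⟨η, h6, h5, h4⟩

/-- The smoothing estimate for the Duhamel operator: the coefficient of the derivatives of the
highest order can be made arbitrarily small. -/
theorem exists_smoothBound_lerayDuhamel (hα : 1 / 2 < α) (hα' : α < 1) (i j k : Fin n) {κ : ℝ}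
    (hκ : 0 < κ) :
    ∃ C : ℕ → ℝ, (∀ m, 0 ≤ C m) ∧ ∀ (w : ℝ → Space n → ℂ) (M : ℕ → ℝ), (∀ m, 0 ≤ M m) →
      Measurable (Function.uncurry w) →
      (∀ s, 0 < s → SmoothBound (w s)
        (fun m => M m * s ^ (-(2 * (1 - 1 / (2 * α)) + m / (2 * α))))) → ∀ t, 0 < t →
      SmoothBound (lerayDuhamel α i j k w t)
        (fun m => (C m * M 0 + κ * M m) * t ^ (-((1 - 1 / (2 * α)) + m / (2 * α)))) := by
  set r := 1 / (2 * α) with hr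
  have hr1 : r < 1 := one_div_lt_one hα
  have hr2 : 1 / 2 < r := half_lt_one_div hα' hα
  have hmr : ∀ m : ℕ, (m : ℝ) / (2 * α) = m * r := fun m => by rw [hr]; ring
  simp only [hmr]
  obtain ⟨C, hC, h⟩ := exists_smoothBound_leray (n := n) hα i j k
  obtain ⟨C', hC', h'⟩ := exists_integral_leray_le (n := n) hα i j k
  obtain ⟨B, hB, hBt⟩ := exists_setIntegral_betaMajorant_eq (r := r)
    (q := 2 * (1 - r)) hr1 (by linarith)
  -- `η m` is the fraction of `[0, t]` next to `t` on which derivatives fall on `w`. It depends on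
  -- `κ` and on the order `m`, but not on `t` or `w`; `η ≤ 1/2` keeps `s ≥ t/2` there.
  have hη : ∀ m : ℕ, ∃ η, 0 < η ∧ η ≤ 1 / 2 ∧
      (C' * 2 ^ (2 * (1 - r) + m * r) / (1 - r)) * η ^ (1 - r) ≤ κ := fun m =>
    exists_pos_mul_rpow_le hκ (by linarith)
  choose η hη0 hη1 hηκ using hη
  refine ⟨fun m => C m * B * η m ^ (-(m * r)), fun m => ?_, fun w M hM hw hwM t ht => ?_⟩
  · have := hC m
    have := (hη0 m).le
    positivity
  set c₁ : ℕ → ℝ := fun m => C m * M 0 * (η m * t) ^ (-(m * r))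
  set c₂ : ℕ → ℝ := fun m => C' * M m * (t / 2) ^ (-(2 * (1 - r) + m * r))
  have hc₁ : ∀ m, 0 ≤ c₁ m := fun m => by
    have := hC m
    have := hM 0
    have := (hη0 m).le
    positivity
  have hc₂ : ∀ m, 0 ≤ c₂ m := fun m => by
    have := hM m
    positivity
  set g : ℕ → ℝ → ℝ := fun m s => c₁ m * betaMajorant r (2 * (1 - r)) t s
    + c₂ m * (Set.Ioc ((1 - η m) * t) t).indicator (fun s => (t - s) ^ (-r)) s
  have hg : ∀ m, Integrable (g m) (volume.restrict (Set.Ioc 0 t)) := fun m =>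
    ((integrableOn_betaMajorant hr1 (by linarith) ht.le).const_mul _).add
      (((integrableOn_rpow_sub_left ht.le (by linarith)).indicator measurableSet_Ioc).const_mul _)
  have hgt : ∀ m, ∫ s in Set.Ioc 0 t, g m s
      ≤ (C m * B * η m ^ (-(m * r)) * M 0 + κ * M m) * t ^ (-((1 - r) + m * r)) := by
    intro m
    have hη2 : 0 ≤ (1 - η m) * t := mul_nonneg (by linarith [hη1 m]) ht.le
    have hη3 : (1 - η m) * t ≤ t := by nlinarith [hη0 m]
    have e0 : ∫ s in Set.Ioc 0 t,
        (Set.Ioc ((1 - η m) * t) t).indicator (fun s => (t - s) ^ (-r)) s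
        = (η m * t) ^ (1 - r) / (1 - r) := by
      rw [setIntegral_indicator measurableSet_Ioc, Set.inter_eq_self_of_subset_right
        (Set.Ioc_subset_Ioc_left hη2), setIntegral_rpow_sub_left hη3 (by linarith)]
      have : t - (1 - η m) * t = η m * t := by ring
      rw [this]
      ring_nf
    simp only [g]
    rw [integral_add ((integrableOn_betaMajorant hr1 (by linarith) ht.le).const_mul _)
      (((integrableOn_rpow_sub_left ht.le (by linarith)).indicator measurableSet_Ioc).const_mul _),
      integral_const_mul, integral_const_mul, hBt t ht, e0]
    simp only [c₁, c₂]
    rw [Real.mul_rpow (hη0 m).le ht.le, Real.mul_rpow (hη0 m).le ht.le,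
      Real.div_rpow ht.le two_pos.le, Real.rpow_neg two_pos.le, div_inv_eq_mul]
    have e1 : t ^ (-(m * r)) * t ^ (1 - r - 2 * (1 - r)) = t ^ (-((1 - r) + m * r)) := by
      rw [← Real.rpow_add ht]; congr 1; ring
    have e2 : t ^ (-(2 * (1 - r) + m * r)) * t ^ (1 - r) = t ^ (-((1 - r) + m * r)) := by
      rw [← Real.rpow_add ht]; congr 1; ring
    calc _ = C m * B * η m ^ (-(m * r)) * M 0 * (t ^ (-(m * r)) * t ^ (1 - r - 2 * (1 - r)))
          + (C' * 2 ^ (2 * (1 - r) + m * r) / (1 - r)) * η m ^ (1 - r) * M m *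
            (t ^ (-(2 * (1 - r) + m * r)) * t ^ (1 - r)) := by ring
      _ = (C m * B * η m ^ (-(m * r)) * M 0 +
          (C' * 2 ^ (2 * (1 - r) + m * r) / (1 - r)) * η m ^ (1 - r) * M m) *
            t ^ (-((1 - r) + m * r)) := by rw [e1, e2]; ring
      _ ≤ _ := by
          have := hM m
          have := hηκ m
          gcongr
  have hsm : ∀ᵐ s ∂(volume.restrict (Set.Ioc 0 t)),
      SmoothBound (fun x => ∫ y, lerayHeatKernel α (t - s) i j k (x - y) * w s y)
        (fun m => g m s) := by
    refine ae_restrict_Ioc_lt fun s hs hst => ?_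
    have hts : 0 < t - s := by linarith
    have hA : ∀ y, ‖w s y‖ ≤ M 0 * s ^ (-(2 * (1 - r))) := fun y => by
      simpa using (hwM s hs).norm_le y
    have h1 := h (t - s) hts (w s) (M 0 * s ^ (-(2 * (1 - r))))
      (mul_nonneg (hM 0) (by positivity)) hw.of_uncurry_left.aestronglyMeasurable (ae_of_all _ hA)
    have h2 := smoothBound_convolution_of_smoothBound (h' (t - s) hts).1 (hwM s hs)
    -- Two bounds hold for the same function: `h1` puts the derivatives on the kernel, `h2` puts
    -- them on `w`. For each `m` the better one is used, according to the side of `(1 - η m) * t` on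
    -- which `s` lies.
    refine ⟨h1.1, fun m x => ?_⟩
    have hind : 0 ≤ (Set.Ioc ((1 - η m) * t) t).indicator (fun s => (t - s) ^ (-r)) s :=
      Set.indicator_nonneg (fun s hs => Real.rpow_nonneg (by linarith [hs.2]) _) s
    have hbeta := le_betaMajorant (r := r) (q := 2 * (1 - r)) (by linarith) (by linarith) hs hst
    have hbeta0 : 0 ≤ (t - s) ^ (-r) * s ^ (-(2 * (1 - r))) := by positivity
    rcases le_or_gt s ((1 - η m) * t) with hcase | hcase
    · have hηt : η m * t ≤ t - s := by nlinarith
      have hηt0 : 0 < η m * t := mul_pos (hη0 m) ht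
      have h3 : (t - s) ^ (-(m * r)) ≤ (η m * t) ^ (-(m * r)) :=
        Real.rpow_le_rpow_of_nonpos hηt0 hηt (by
          have : 0 ≤ (m : ℝ) * r := by positivity
          linarith)
      have e : (t - s) ^ (-(((m : ℝ) + 1) / (2 * α))) = (t - s) ^ (-(m * r)) * (t - s) ^ (-r) := by
        rw [← Real.rpow_add hts, hr]; congr 1; ring
      calc _ ≤ C m * (t - s) ^ (-(((m : ℝ) + 1) / (2 * α))) * (M 0 * s ^ (-(2 * (1 - r)))) :=
            h1.2 m x
        _ = (C m * M 0) * (t - s) ^ (-(m * r)) * ((t - s) ^ (-r) * s ^ (-(2 * (1 - r)))) := by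
            rw [e]; ring
        _ ≤ (C m * M 0) * (η m * t) ^ (-(m * r)) * ((t - s) ^ (-r) * s ^ (-(2 * (1 - r)))) := by
            have := mul_nonneg (hC m) (hM 0)
            gcongr
        _ ≤ c₁ m * betaMajorant r (2 * (1 - r)) t s := mul_le_mul_of_nonneg_left hbeta (hc₁ m)
        _ ≤ _ := le_add_of_nonneg_right (mul_nonneg (hc₂ m) hind)
    · have h3 : s ^ (-(2 * (1 - r) + m * r)) ≤ (t / 2) ^ (-(2 * (1 - r) + m * r)) :=
        Real.rpow_le_rpow_of_nonpos (by linarith) (by nlinarith [hη1 m]) (by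
          have : 0 ≤ (m : ℝ) * r := by positivity
          linarith)
      have h4 : (Set.Ioc ((1 - η m) * t) t).indicator (fun s => (t - s) ^ (-r)) s
          = (t - s) ^ (-r) := Set.indicator_of_mem
          (show s ∈ Set.Ioc ((1 - η m) * t) t from ⟨hcase, hst.le⟩) _
      calc _ ≤ (∫ y, ‖lerayHeatKernel α (t - s) i j k y‖) * (M m * s ^ (-(2 * (1 - r) + m * r))) :=
            h2.2 m x
        _ ≤ (C' * (t - s) ^ (-r)) * (M m * (t / 2) ^ (-(2 * (1 - r) + m * r))) := by
            have := hM m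
            gcongr
            exact (h' (t - s) hts).2
        _ = c₂ m * (t - s) ^ (-r) := by simp only [c₂]; ring
        _ ≤ _ := by
            simp only [g]
            rw [h4]
            exact le_add_of_nonneg_left (mul_nonneg (hc₁ m) (hbeta0.trans hbeta))
  have hfin := smoothBound_integral (fun x => aestronglyMeasurable_lerayConvolution α i j k hw t x _)
    hsm hg
  simp only [← lerayDuhamel_eq ht] at hfin
  exact hfin.mono hgt

end Duhamel

end

end FracNS

namespace FracNS

noncomputable section

/-! ### The quadratic term. -/

section Bilinear

variable {n : ℕ} {α : ℝ}

theorem norm_le_sum_abs (v : Space n) : ‖v‖ ≤ ∑ i, |v i| := by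
  conv_lhs => rw [← (EuclideanSpace.basisFun (Fin n) ℝ).sum_repr v]
  refine (norm_sum_le _ _).trans (Finset.sum_le_sum fun i _ => ?_)
  rw [norm_smul, OrthonormalBasis.norm_eq_one, mul_one]
  simp

theorem abs_apply_le_norm (v : Space n) (i : Fin n) : |v i| ≤ ‖v‖ := by
  simpa using PiLp.norm_apply_le v i

/-- `u` is a measurable field bounded by `m t ^ (-(1 - 1/(2α)))`. -/
def Admissible (α m : ℝ) (u : ℝ → Space n → Space n) : Prop :=
  Measurable (Function.uncurry u) ∧ ∀ t, 0 < t → ∀ x, ‖u t x‖ ≤ m * t ^ (-(1 - 1 / (2 * α)))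

/-- The entries of `u ⊗ u`. -/
def tensorSq (u : ℝ → Space n → Space n) (j k : Fin n) (s : ℝ) (y : Space n) : ℂ :=
  ((u s y j * u s y k : ℝ) : ℂ)

theorem rpow_neg_sq {s a : ℝ} (hs : 0 < s) : s ^ (-a) * s ^ (-a) = s ^ (-(2 * a)) := by
  rw [← Real.rpow_add hs]; ring_nf

theorem Admissible.measurable_apply {m : ℝ} {u : ℝ → Space n → Space n} (hu : Admissible α m u)
    (j : Fin n) : Measurable fun p : ℝ × Space n => u p.1 p.2 j := by
  have h : Continuous fun v : Space n => v j := by fun_prop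
  exact h.measurable.comp hu.1

theorem Admissible.measurable_tensorSq {m : ℝ} {u : ℝ → Space n → Space n}
    (hu : Admissible α m u) (j k : Fin n) : Measurable (Function.uncurry (tensorSq u j k)) :=
  Complex.measurable_ofReal.comp ((hu.measurable_apply j).mul (hu.measurable_apply k))

theorem Admissible.norm_tensorSq_sub_le {m D : ℝ} {u v : ℝ → Space n → Space n}
    (hu : Admissible α m u) (hv : Admissible α m v)
    (hD : ∀ t, 0 < t → ∀ x, ‖u t x - v t x‖ ≤ D * t ^ (-(1 - 1 / (2 * α)))) (j k : Fin n)
    {s : ℝ} (hs : 0 < s) (y : Space n) : ‖tensorSq u j k s y - tensorSq v j k s y‖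
      ≤ 2 * m * D * s ^ (-(2 * (1 - 1 / (2 * α)))) := by
  -- The polarization `ab - a'b' = a(b - b') + (a - a')b'` produces the factor `2 * m * D`.
  have e : tensorSq u j k s y - tensorSq v j k s y
      = ((u s y j * (u s y - v s y) k + (u s y - v s y) j * v s y k : ℝ) : ℂ) := by
    unfold tensorSq
    rw [← Complex.ofReal_sub]
    congr 1
    simp only [PiLp.sub_apply]
    ring
  rw [e, Complex.norm_real, Real.norm_eq_abs, ← rpow_neg_sq hs]
  refine (abs_add_le _ _).trans ?_
  rw [abs_mul, abs_mul]
  have h1 := (abs_apply_le_norm (u s y) j).trans (hu.2 s hs y)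
  have h2 := (abs_apply_le_norm (v s y) k).trans (hv.2 s hs y)
  have h3 := fun l => (abs_apply_le_norm (u s y - v s y) l).trans (hD s hs y)
  have h4 := mul_le_mul h1 (h3 k) (abs_nonneg _) ((abs_nonneg _).trans h1)
  have h5 := mul_le_mul (h3 j) h2 (abs_nonneg _) ((abs_nonneg _).trans (h3 j))
  nlinarith [h4, h5]

theorem admissible_zero {m : ℝ} (hm : 0 ≤ m) :
    Admissible α m (fun _ _ => (0 : Space n)) :=
  ⟨measurable_const, fun t ht x => by rw [norm_zero]; positivity⟩

theorem Admissible.norm_tensorSq_le {m : ℝ} (hm : 0 ≤ m) {u : ℝ → Space n → Space n}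
    (hu : Admissible α m u) (j k : Fin n) {s : ℝ} (hs : 0 < s) (y : Space n) :
    ‖tensorSq u j k s y‖ ≤ 2 * m * m * s ^ (-(2 * (1 - 1 / (2 * α)))) := by
  have := hu.norm_tensorSq_sub_le (admissible_zero hm) (D := m)
    (fun t ht x => by simpa using hu.2 t ht x) j k hs y
  simpa [tensorSq] using this

theorem integrable_lerayHeatKernel_mul (hα : 1 / 2 < α) {t : ℝ} (ht : 0 < t) (i j k : Fin n)
    {w : Space n → ℂ} {A : ℝ} (hw : AEStronglyMeasurable w volume) (hA : ∀ y, ‖w y‖ ≤ A)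
    (x : Space n) : Integrable fun y => lerayHeatKernel α t i j k (x - y) * w y := by
  obtain ⟨C, -, h⟩ := exists_integral_leray_le (n := n) hα i j k
  exact ((h t ht).1.comp_sub_left x).mul_bdd hw (ae_of_all _ hA)

theorem duhamel_eq_sum (hα : 1 / 2 < α) (hα' : α < 1) {m : ℝ} (hm : 0 ≤ m)
    {u : ℝ → Space n → Space n} (hu : Admissible α m u) {t : ℝ} (ht : 0 < t) (x : Space n)
    (i : Fin n) :
    duhamel α u t x i = ∑ j, ∑ k, lerayDuhamel α i j k (tensorSq u j k) t x := by
  have h1 : duhamel α u t x i = ∫ s in Set.Ioc 0 t, ∑ j, ∑ k,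
      ∫ y, lerayHeatKernel α (t - s) i j k (x - y) * tensorSq u j k s y := by
    rw [duhamel, intervalIntegral.integral_of_le ht.le]
    refine integral_congr_ae (ae_restrict_Ioc_lt fun s hs hst => ?_)
    have hi := fun j k => integrable_lerayHeatKernel_mul hα (sub_pos.2 hst) i j k
      (hu.measurable_tensorSq j k).of_uncurry_left.aestronglyMeasurable
      (hu.norm_tensorSq_le hm j k hs) x
    change ∫ y, ∑ j, ∑ k, lerayHeatKernel α (t - s) i j k (x - y) * tensorSq u j k s y = _
    rw [integral_finsetSum _ fun j _ => integrable_finsetSum _ fun k _ => hi j k]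
    exact Finset.sum_congr rfl fun j _ => integral_finsetSum _ fun k _ => hi j k
  have hi : ∀ j k, IntegrableOn (fun s =>
      ∫ y, lerayHeatKernel α (t - s) i j k (x - y) * tensorSq u j k s y) (Set.Ioc 0 t) :=
    fun j k => by
      obtain ⟨C, -, h⟩ := exists_lerayDuhamel_le (n := n) hα hα' i j k
      exact (h _ (2 * m * m) (by positivity) (hu.measurable_tensorSq j k)
        (fun s hs y => hu.norm_tensorSq_le hm j k hs y) t ht x).1
  rw [h1, integral_finsetSum _ fun j _ => integrable_finsetSum _ fun k _ => hi j k]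
  refine Finset.sum_congr rfl fun j _ => ?_
  rw [integral_finsetSum _ fun k _ => hi j k]
  exact Finset.sum_congr rfl fun k _ => (lerayDuhamel_eq ht x).symm

theorem lerayDuhamel_sub (hα : 1 / 2 < α) (hα' : α < 1) {A : ℝ} (hA : 0 ≤ A)
    {w w' : ℝ → Space n → ℂ} (hw : Measurable (Function.uncurry w))
    (hw' : Measurable (Function.uncurry w'))
    (hwA : ∀ s, 0 < s → ∀ y, ‖w s y‖ ≤ A * s ^ (-(2 * (1 - 1 / (2 * α)))))
    (hwA' : ∀ s, 0 < s → ∀ y, ‖w' s y‖ ≤ A * s ^ (-(2 * (1 - 1 / (2 * α))))) (i j k : Fin n)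
    {t : ℝ} (ht : 0 < t) (x : Space n) :
    lerayDuhamel α i j k w t x - lerayDuhamel α i j k w' t x
      = lerayDuhamel α i j k (fun s y => w s y - w' s y) t x := by
  obtain ⟨C, -, h⟩ := exists_lerayDuhamel_le (n := n) hα hα' i j k
  rw [lerayDuhamel_eq ht, lerayDuhamel_eq ht, lerayDuhamel_eq ht,
    ← integral_sub (h w A hA hw hwA t ht x).1 (h w' A hA hw' hwA' t ht x).1]
  refine integral_congr_ae (ae_restrict_Ioc_lt fun s hs hst => ?_)
  have h1 := integrable_lerayHeatKernel_mul hα (sub_pos.2 hst) i j k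
    hw.of_uncurry_left.aestronglyMeasurable (hwA s hs) x
  have h2 := integrable_lerayHeatKernel_mul hα (sub_pos.2 hst) i j k
    hw'.of_uncurry_left.aestronglyMeasurable (hwA' s hs) x
  simp only [mul_sub]
  exact (integral_sub h1 h2).symm

/-- The Duhamel term is a bounded bilinear operator. -/
theorem exists_duhamel_sub_le (n : ℕ) (hα : 1 / 2 < α) (hα' : α < 1) :
    ∃ C, 0 ≤ C ∧ ∀ (u v : ℝ → Space n → Space n) (m D : ℝ), 0 ≤ m → 0 ≤ D → Admissible α m u →
      Admissible α m v → (∀ t, 0 < t → ∀ x, ‖u t x - v t x‖ ≤ D * t ^ (-(1 - 1 / (2 * α)))) →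
      ∀ t, 0 < t → ∀ x, ∑ i, ‖duhamel α u t x i - duhamel α v t x i‖
        ≤ C * (m * D) * t ^ (-(1 - 1 / (2 * α))) := by
  choose C hC h using fun i j k : Fin n => exists_lerayDuhamel_le hα hα' i j k
  refine ⟨∑ i, ∑ j, ∑ k, C i j k * 2, Finset.sum_nonneg fun i _ => Finset.sum_nonneg fun j _ =>
    Finset.sum_nonneg fun k _ => mul_nonneg (hC i j k) two_pos.le,
    fun u v m D hm hD hu hv hDuv t ht x => ?_⟩
  rw [Finset.sum_mul, Finset.sum_mul]
  refine Finset.sum_le_sum fun i _ => ?_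
  rw [duhamel_eq_sum hα hα' hm hu ht, duhamel_eq_sum hα hα' hm hv ht, ← Finset.sum_sub_distrib,
    Finset.sum_mul, Finset.sum_mul]
  refine (norm_sum_le _ _).trans (Finset.sum_le_sum fun j _ => ?_)
  rw [← Finset.sum_sub_distrib, Finset.sum_mul, Finset.sum_mul]
  refine (norm_sum_le _ _).trans (Finset.sum_le_sum fun k _ => ?_)
  rw [lerayDuhamel_sub hα hα' (by positivity : 0 ≤ 2 * m * m) (hu.measurable_tensorSq j k)
    (hv.measurable_tensorSq j k) (fun s hs y => hu.norm_tensorSq_le hm j k hs y)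
    (fun s hs y => hv.norm_tensorSq_le hm j k hs y) i j k ht]
  refine (h i j k (fun s y => tensorSq u j k s y - tensorSq v j k s y) (2 * m * D) (by positivity)
    ((hu.measurable_tensorSq j k).sub (hv.measurable_tensorSq j k))
    (fun s hs y => hu.norm_tensorSq_sub_le hv hDuv j k hs y) t ht x).2.trans (le_of_eq ?_)
  ring

theorem duhamel_im (u : ℝ → Space n → Space n) (t : ℝ) (x : Space n) (i : Fin n) :
    (duhamel α u t x i).im = 0 := by
  have h : duhamel α u t x i = ((∫ s in (0 : ℝ)..t, ∫ y, ∑ j, ∑ k,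
      (lerayHeatKernel α (t - s) i j k (x - y)).re * (u s y j * u s y k) : ℝ) : ℂ) := by
    rw [duhamel, ← intervalIntegral.integral_ofReal]
    congr 1
    funext s
    rw [← integral_complex_ofReal]
    congr 1
    funext y
    push_cast
    refine Finset.sum_congr rfl fun j _ => Finset.sum_congr rfl fun k _ => ?_
    congr 1
    exact Complex.ext (by simp) (by simp [lerayHeatKernel_im])
  rw [h, Complex.ofReal_im]

theorem duhamel_congr {u v : ℝ → Space n → Space n} (h : ∀ᵐ s, 0 < s → u s =ᵐ[volume] v s)
    {t : ℝ} (ht : 0 < t) (x : Space n) (i : Fin n) : duhamel α u t x i = duhamel α v t x i := by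
  rw [duhamel, duhamel, intervalIntegral.integral_of_le ht.le,
    intervalIntegral.integral_of_le ht.le]
  refine integral_congr_ae ?_
  filter_upwards [ae_restrict_of_ae h, ae_restrict_mem measurableSet_Ioc] with s hs hst
  refine integral_congr_ae ?_
  filter_upwards [hs hst.1] with y hy
  rw [hy]

theorem measurable_duhamel (hα : 1 / 2 < α) (hα' : α < 1) {m : ℝ} (hm : 0 ≤ m)
    {u : ℝ → Space n → Space n} (hu : Admissible α m u) (i : Fin n) :
    Measurable fun p : ℝ × Space n => if 0 < p.1 then duhamel α u p.1 p.2 i else 0 := by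
  have h : (fun p : ℝ × Space n => if 0 < p.1 then duhamel α u p.1 p.2 i else 0)
      = fun p => ∑ j, ∑ k,
        if 0 < p.1 then lerayDuhamel α i j k (tensorSq u j k) p.1 p.2 else 0 := by
    funext p
    by_cases hp : 0 < p.1
    · simp only [if_pos hp]
      exact duhamel_eq_sum hα hα' hm hu hp _ i
    · simp [if_neg hp]
  rw [h]
  exact Finset.measurable_fun_sum _ fun j _ => Finset.measurable_fun_sum _ fun k _ =>
    measurable_lerayDuhamel α i j k (hu.measurable_tensorSq j k)

/-- The Duhamel term is tame on smooth functions: the highest derivatives enter with a small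
coefficient. -/
theorem exists_smoothBound_duhamel (n : ℕ) (hα : 1 / 2 < α) (hα' : α < 1) {κ : ℝ} (hκ : 0 < κ) :
    ∃ C : ℕ → ℝ, (∀ k, 0 ≤ C k) ∧ ∀ (u : ℝ → Space n → Space n) (m : ℝ) (P : ℕ → ℝ), 0 ≤ m →
      (∀ k, 0 ≤ P k) → Admissible α m u →
      (∀ s, 0 < s → ∀ j, SmoothBound (fun x => u s x j)
        (fun k => P k * s ^ (-((1 - 1 / (2 * α)) + k / (2 * α))))) → ∀ t, 0 < t → ∀ i,
      SmoothBound (fun x => duhamel α u t x i) (fun k => (C k * (P 0 * P 0)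
        + κ * ∑ l ∈ Finset.range (k + 1), (k.choose l : ℝ) * P l * P (k - l))
          * t ^ (-((1 - 1 / (2 * α)) + k / (2 * α)))) := by
  -- The budget `κ` is shared among the `n²` pairs of indices; the added `1` keeps the denominator
  -- positive.
  have hκ' : 0 < κ / ((n : ℝ) * n + 1) := by positivity
  choose C hC h using fun i j k : Fin n => exists_smoothBound_lerayDuhamel hα hα' i j k hκ'
  refine ⟨fun k => ∑ i, ∑ j, ∑ l, C i j l k, fun k => Finset.sum_nonneg fun i _ =>
    Finset.sum_nonneg fun j _ => Finset.sum_nonneg fun l _ => hC i j l k,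
    fun u m P hm hP hu hsm t ht i => ?_⟩
  set W : ℕ → ℝ := fun k => ∑ l ∈ Finset.range (k + 1), (k.choose l : ℝ) * P l * P (k - l) with hW
  have hW0 : ∀ k, 0 ≤ W k := fun k => Finset.sum_nonneg fun l _ =>
    mul_nonneg (mul_nonneg (by positivity) (hP _)) (hP _)
  have hW00 : W 0 = P 0 * P 0 := by simp [hW]
  have htens : ∀ j l s, 0 < s → SmoothBound (tensorSq u j l s)
      (fun k => W k * s ^ (-(2 * (1 - 1 / (2 * α)) + k / (2 * α)))) := by
    intro j l s hs
    have h1 := ((hsm s hs j).mul (hsm s hs l)).clm_comp Complex.ofRealCLM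
    refine h1.mono fun k => ?_
    rw [Complex.ofRealCLM_norm, one_mul, hW, Finset.sum_mul]
    refine Finset.sum_le_sum fun p hp => le_of_eq ?_
    have hpk : p ≤ k := Nat.lt_succ_iff.1 (Finset.mem_range.1 hp)
    have e : s ^ (-(2 * (1 - 1 / (2 * α)) + (k : ℝ) / (2 * α)))
        = s ^ (-((1 - 1 / (2 * α)) + (p : ℝ) / (2 * α)))
          * s ^ (-((1 - 1 / (2 * α)) + ((k - p : ℕ) : ℝ) / (2 * α))) := by
      rw [← Real.rpow_add hs, Nat.cast_sub hpk]
      congr 1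
      ring
    rw [e]
    ring
  have h1 := SmoothBound.sum Finset.univ fun j _ => SmoothBound.sum Finset.univ fun l _ =>
    h i j l (tensorSq u j l) W hW0 (hu.measurable_tensorSq j l) (htens j l) t ht
  have e : (fun x => duhamel α u t x i)
      = fun x => ∑ j, ∑ l, lerayDuhamel α i j l (tensorSq u j l) t x :=
    funext fun x => duhamel_eq_sum hα hα' hm hu ht x i
  rw [e]
  refine h1.mono fun k => ?_
  simp only [← Finset.sum_mul]
  refine mul_le_mul_of_nonneg_right ?_ (by positivity)
  simp only [Finset.sum_add_distrib, Finset.sum_const, Finset.card_univ, Fintype.card_fin,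
    nsmul_eq_mul, ← Finset.sum_mul, hW00]
  refine add_le_add ?_ ?_
  · refine mul_le_mul_of_nonneg_right ?_ (mul_nonneg (hP 0) (hP 0))
    exact Finset.single_le_sum (f := fun i => ∑ j, ∑ l, C i j l k) (fun i _ =>
      Finset.sum_nonneg fun j _ => Finset.sum_nonneg fun l _ => hC i j l k) (Finset.mem_univ i)
  · have : (n : ℝ) * (n * (κ / ((n : ℝ) * n + 1))) ≤ κ := by
      rw [← mul_assoc, mul_div_assoc', div_le_iff₀ (by positivity)]
      nlinarith
    calc _ = (n : ℝ) * (n * (κ / ((n : ℝ) * n + 1))) * W k := by ring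
      _ ≤ _ := mul_le_mul_of_nonneg_right this (hW0 k)

end Bilinear

/-! ### Derivative bounds that are stable under iteration. -/

/-- A solution of the recursive inequality for the bounds of the derivatives of the Picard
iterates. -/
def majorantSeq (A : ℕ → ℝ) (κ δ : ℝ) : ℕ → ℝ
  | 0 => δ
  | k + 1 => 2 * (A (k + 1) + κ * ∑ l : Fin k,
      ((k + 1).choose (l + 1) : ℝ) * majorantSeq A κ δ (l + 1) * majorantSeq A κ δ (k - l))

theorem majorantSeq_nonneg {A : ℕ → ℝ} {κ δ : ℝ} (hA : ∀ k, 0 ≤ A k) (hκ : 0 ≤ κ) (hδ : 0 ≤ δ)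
    (k : ℕ) : 0 ≤ majorantSeq A κ δ k := by
  induction k using Nat.strong_induction_on with
  | _ k ih =>
    cases k with
    | zero => rwa [majorantSeq]
    | succ k =>
      rw [majorantSeq]
      refine mul_nonneg two_pos.le (add_nonneg (hA _) (mul_nonneg hκ (Finset.sum_nonneg
        fun l _ => mul_nonneg (mul_nonneg (by positivity) (ih _ (by omega))) (ih _ (by omega)))))

/-- The terms `l = 0` and `l = k` together contribute `2κδ` times the bound of order `k`, at most
half of it. The factor `2` in the recursion makes everything else equal to the other half. -/
theorem le_majorantSeq {A : ℕ → ℝ} {κ δ : ℝ} (hA : ∀ k, 0 ≤ A k) (hκ : 0 ≤ κ) (hδ : 0 ≤ δ)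
    (hκδ : κ * δ ≤ 1 / 4) {k : ℕ} (hk : k ≠ 0) :
    A k + κ * ∑ l ∈ Finset.range (k + 1), (k.choose l : ℝ) * majorantSeq A κ δ l
      * majorantSeq A κ δ (k - l) ≤ majorantSeq A κ δ k := by
  obtain ⟨k, rfl⟩ := Nat.exists_eq_succ_of_ne_zero hk
  have h0 : majorantSeq A κ δ 0 = δ := by rw [majorantSeq]
  have hP := majorantSeq_nonneg hA hκ hδ (k + 1)
  have h1 : majorantSeq A κ δ (k + 1) = 2 * (A (k + 1) + κ * ∑ l ∈ Finset.range k,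
      ((k + 1).choose (l + 1) : ℝ) * majorantSeq A κ δ (l + 1) * majorantSeq A κ δ (k - l)) := by
    rw [majorantSeq, Finset.sum_range]
  rw [Finset.sum_range_succ, Finset.sum_range_succ']
  simp only [Nat.succ_eq_add_one, Nat.add_sub_add_right, Nat.choose_zero_right, Nat.choose_self,
    Nat.sub_self, Nat.sub_zero, h0, Nat.cast_one, one_mul]
  nlinarith

end

end FracNS

namespace FracNS

noncomputable section

/-! ### The mild map and its relation to the norms of the statement. -/

variable {n : ℕ} {α : ℝ}

/-- The right-hand side of the mild formulation. -/
def mildMap (α : ℝ) (u₀ : Fin n → 𝓢'(Space n, ℂ)) (u : ℝ → Space n → Space n) (t : ℝ)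
    (x : Space n) : Space n :=
  if 0 < t then WithLp.toLp 2 fun i => (heatFlow α t (u₀ i) x - duhamel α u t x i).re else 0

theorem mildMap_apply {u₀ : Fin n → 𝓢'(Space n, ℂ)} (u : ℝ → Space n → Space n) {t : ℝ}
    (ht : 0 < t) (x : Space n) (i : Fin n) :
    mildMap α u₀ u t x i = (heatFlow α t (u₀ i) x - duhamel α u t x i).re := by
  rw [mildMap, if_pos ht]

/-- For real data both terms are real, so passing to the real part in `mildMap` loses nothing. -/
theorem ofReal_mildMap_apply {u₀ : Fin n → 𝓢'(Space n, ℂ)} (hr : ∀ i, IsReal (u₀ i))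
    (u : ℝ → Space n → Space n) {t : ℝ} (ht : 0 < t) (x : Space n) (i : Fin n) :
    (mildMap α u₀ u t x i : ℂ) = heatFlow α t (u₀ i) x - duhamel α u t x i := by
  rw [mildMap_apply u ht]
  exact Complex.ext (by simp) (by simp [heatFlow_im (hr i), duhamel_im])

theorem mildMap_congr {u₀ : Fin n → 𝓢'(Space n, ℂ)} {u v : ℝ → Space n → Space n}
    (h : ∀ᵐ s, 0 < s → u s =ᵐ[volume] v s) : mildMap α u₀ u = mildMap α u₀ v := by
  funext t x
  unfold mildMap
  split_ifs with ht
  · simp only [duhamel_congr h ht]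
  · rfl

theorem measurable_mildMap (hα : 1 / 2 < α) (hα' : α < 1) {m b : ℝ} (hm : 0 ≤ m) (hb : 0 ≤ b)
    {u₀ : Fin n → 𝓢'(Space n, ℂ)} (hu₀ : ∀ i, besovNorm α (u₀ i) ≤ ENNReal.ofReal b)
    {u : ℝ → Space n → Space n} (hu : Admissible α m u) :
    Measurable (Function.uncurry (mildMap α u₀ u)) := by
  have h : Function.uncurry (mildMap α u₀ u) = fun p : ℝ × Space n => WithLp.toLp 2 fun i =>
      ((if 0 < p.1 then heatFlow α p.1 (u₀ i) p.2 else 0)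
        - (if 0 < p.1 then duhamel α u p.1 p.2 i else 0)).re := by
    funext p
    simp only [Function.uncurry, mildMap]
    split_ifs
    · rfl
    · ext i; simp
  rw [h]
  refine (PiLp.continuous_toLp 2 _).measurable.comp (measurable_pi_lambda _ fun i => ?_)
  exact Complex.measurable_re.comp
    ((measurable_heatFlow hα hb (hu₀ i)).sub (measurable_duhamel hα hα' hm hu i))

theorem norm_mildMap_sub_le {u₀ : Fin n → 𝓢'(Space n, ℂ)} (u v : ℝ → Space n → Space n)
    {t : ℝ} (ht : 0 < t) (x : Space n) : ‖mildMap α u₀ u t x - mildMap α u₀ v t x‖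
      ≤ ∑ i, ‖duhamel α u t x i - duhamel α v t x i‖ := by
  refine (norm_le_sum_abs _).trans (Finset.sum_le_sum fun i _ => ?_)
  rw [PiLp.sub_apply, mildMap_apply u ht, mildMap_apply v ht, ← Complex.sub_re,
    sub_sub_sub_cancel_left, norm_sub_rev]
  exact Complex.abs_re_le_norm _

theorem smoothBound_apply_to_norm {f : Space n → Space n} {M : ℕ → ℝ}
    (h : ∀ i, SmoothBound (fun x => f x i) M) : SmoothBound f (fun k => n * M k) := by
  have h1 := SmoothBound.sum Finset.univ fun i _ =>
    (h i).clm_comp (ContinuousLinearMap.toSpanSingleton ℝ (basisVec i))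
  have e : f = fun x => ∑ i, ContinuousLinearMap.toSpanSingleton ℝ (basisVec i) (f x i) := by
    funext x
    conv_lhs => rw [← (EuclideanSpace.basisFun (Fin n) ℝ).sum_repr (f x)]
    simp
  rw [e]
  refine h1.mono fun k => le_of_eq ?_
  simp [ContinuousLinearMap.norm_toSpanSingleton]

theorem normGX_le {u : ℝ → Space n → Space n} {k : ℕ} {M : ℝ}
    (h : ∀ t, 0 < t → ∀ x, ‖iteratedFDeriv ℝ k (u t) x‖
      ≤ M * t ^ (-((1 - 1 / (2 * α)) + k / (2 * α)))) : normGX α k u ≤ ENNReal.ofReal M := by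
  refine iSup_le fun β => iSup_le fun t => iSup_le fun ht => ?_
  have h1 : eLpNorm (fun x => iteratedFDeriv ℝ k (u t) x (fun l => basisVec (β l))) ⊤ volume
      ≤ ENNReal.ofReal (M * t ^ (-((1 - 1 / (2 * α)) + k / (2 * α)))) := by
    rw [eLpNorm_exponent_top]
    refine eLpNormEssSup_le_of_ae_bound (ae_of_all _ fun x => ?_)
    refine ((iteratedFDeriv ℝ k (u t) x).le_opNorm _).trans ?_
    simpa using h t ht x
  refine (mul_le_mul_right h1 _).trans ?_
  rw [← ENNReal.ofReal_mul (by positivity), Real.rpow_neg ht.le]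
  have := Real.rpow_pos_of_pos ht ((1 - 1 / (2 * α)) + k / (2 * α))
  refine ENNReal.ofReal_le_ofReal (le_of_eq ?_)
  field_simp

theorem ae_norm_le_of_normGX_zero_le {v : ℝ → Space n → Space n} {δ : ℝ}
    (hδ : 0 ≤ δ) (h : normGX α 0 v ≤ ENNReal.ofReal δ) {t : ℝ} (ht : 0 < t) :
    ∀ᵐ x, ‖v t x‖ ≤ δ * t ^ (-(1 - 1 / (2 * α))) := by
  have h1 := (le_iSup₂_of_le (f := fun (β : Fin 0 → Fin n) (t : ℝ) => ⨆ (_ : 0 < t),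
    ENNReal.ofReal (t ^ ((1 - 1 / (2 * α)) + (0 : ℕ) / (2 * α))) *
      eLpNorm (fun x => iteratedFDeriv ℝ 0 (v t) x (fun l => basisVec (β l))) ⊤ volume)
    Fin.elim0 t (le_iSup_of_le ht le_rfl)).trans h
  simp only [iteratedFDeriv_zero_apply, eLpNorm_exponent_top, Nat.cast_zero, zero_div,
    add_zero] at h1
  have hp := Real.rpow_pos_of_pos ht (1 - 1 / (2 * α))
  filter_upwards [ae_le_eLpNormEssSup (f := v t) (μ := volume)] with x hx
  have h2 := (mul_le_mul_right hx (ENNReal.ofReal (t ^ (1 - 1 / (2 * α))))).trans h1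
  rw [← ofReal_norm, ← ENNReal.ofReal_mul hp.le] at h2
  rw [Real.rpow_neg ht.le, ← div_eq_mul_inv, le_div_iff₀ hp, mul_comm]
  exact (ENNReal.ofReal_le_ofReal_iff hδ).1 h2

end

end FracNS

namespace FracNS

noncomputable section

/-! ### Contraction, fixed point and uniqueness. -/

variable {n : ℕ} {α : ℝ}

/-- The bounds `P k t ^ (-(1 - 1/(2α) + k/(2α)))` for the derivatives of order `k` of the components
of `u(t)`. -/
def SmoothField (α : ℝ) (P : ℕ → ℝ) (u : ℝ → Space n → Space n) : Prop :=
  ∀ t, 0 < t → ∀ j, SmoothBound (fun x => u t x j)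
    (fun k => P k * t ^ (-((1 - 1 / (2 * α)) + k / (2 * α))))

/-- `Φ` halves the distances of admissible fields. -/
def HalvesDistances (α δ : ℝ) (Φ : (ℝ → Space n → Space n) → ℝ → Space n → Space n) : Prop :=
  ∀ (u v : ℝ → Space n → Space n) (D : ℝ), 0 ≤ D → Admissible α δ u → Admissible α δ v →
    (∀ t, 0 < t → ∀ x, ‖u t x - v t x‖ ≤ D * t ^ (-(1 - 1 / (2 * α)))) →
    ∀ t, 0 < t → ∀ x, ‖Φ u t x - Φ v t x‖ ≤ D / 2 * t ^ (-(1 - 1 / (2 * α)))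

theorem exists_mildMap_contraction (n : ℕ) (hα : 1 / 2 < α) (hα' : α < 1) :
    ∃ ε : ℝ, 0 < ε ∧ ∃ δ : ℝ, 0 < δ ∧ ∃ P : ℕ → ℝ, (∀ k, 0 ≤ P k) ∧
      ∀ u₀ : Fin n → 𝓢'(Space n, ℂ), (∀ i, besovNorm α (u₀ i) ≤ ENNReal.ofReal ε) →
        (∀ u, Admissible α δ u → Admissible α δ (mildMap α u₀ u)) ∧
        HalvesDistances α δ (mildMap α u₀) ∧
        ∀ u, Admissible α δ u → SmoothField α P u → SmoothField α P (mildMap α u₀ u) := by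
  obtain ⟨H, hH, hheat⟩ := exists_smoothBound_heatFlow n hα
  obtain ⟨C, hC, hduh⟩ := exists_duhamel_sub_le n hα hα'
  -- From `C * δ ≤ 1/2` follow both the contraction factor `1/2` and a Duhamel term of at most
  -- `δ/2`. The choice of `ε` leaves the other `δ/2` to the linear flow, and `κ = 1/(4δ)` meets the
  -- absorption condition of `le_majorantSeq`.
  set δ : ℝ := 1 / (2 * (C + 1)) with hδ
  have hδ0 : 0 < δ := by positivity
  have hCδ : C * δ ≤ 1 / 2 := by
    rw [hδ, mul_one_div, div_le_iff₀ (by positivity)]; linarith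
  set ε : ℝ := δ / (2 * (n * H 0 + 1)) with hε
  have hnH : 0 ≤ n * H 0 := mul_nonneg (by positivity) (hH 0)
  have hε0 : 0 < ε := by positivity
  have hHε : n * H 0 * ε ≤ δ / 2 := by
    rw [hε, mul_div_assoc', div_le_iff₀ (by positivity)]; nlinarith
  set κ : ℝ := 1 / (4 * δ) with hκ
  have hκ0 : 0 < κ := by positivity
  have hκδ : κ * δ ≤ 1 / 4 := by rw [hκ]; field_simp; exact le_rfl
  obtain ⟨K, hK, hsm⟩ := exists_smoothBound_duhamel n hα hα' hκ0
  set A : ℕ → ℝ := fun k => H k * ε + K k * (δ * δ) with hA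
  have hA0 : ∀ k, 0 ≤ A k := fun k => by have := hH k; have := hK k; positivity
  have hP0 : majorantSeq A κ δ 0 = δ := by rw [majorantSeq]
  have hPn := majorantSeq_nonneg hA0 hκ0.le hδ0.le
  refine ⟨ε, hε0, δ, hδ0, majorantSeq A κ δ, hPn, fun u₀ hu₀ => ?_⟩
  have hadm : ∀ u, Admissible α δ u → Admissible α δ (mildMap α u₀ u) := by
    intro u hu
    refine ⟨measurable_mildMap hα hα' hδ0.le hε0.le hu₀ hu, fun t ht x => ?_⟩
    have h1 := norm_mildMap_sub_le (α := α) (u₀ := u₀) u (fun _ _ => 0) ht x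
    have h2 := hduh u (fun _ _ => 0) δ δ hδ0.le hδ0.le hu (admissible_zero hδ0.le)
      (fun t ht x => by simpa using hu.2 t ht x) t ht x
    have h3 : ‖mildMap α u₀ (fun _ _ => 0) t x‖ ≤ n * H 0 * ε * t ^ (-(1 - 1 / (2 * α))) := by
      refine (norm_le_sum_abs _).trans ?_
      have : ∀ i, |mildMap α u₀ (fun _ _ => 0) t x i| ≤ H 0 * ε * t ^ (-(1 - 1 / (2 * α))) := by
        intro i
        rw [mildMap_apply _ ht]
        have h0 : duhamel α (fun _ _ => (0 : Space n)) t x i = 0 := by simp [duhamel]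
        rw [h0, sub_zero]
        refine (Complex.abs_re_le_norm _).trans
          (((hheat (u₀ i) ε hε0.le (hu₀ i) t ht).1.norm_le x).trans (le_of_eq ?_))
        simp only [Nat.cast_zero, zero_div, add_zero]
        ring
      refine (Finset.sum_le_sum fun i _ => this i).trans (le_of_eq ?_)
      simp only [Finset.sum_const, Finset.card_univ, Fintype.card_fin, nsmul_eq_mul]
      ring
    have h4 : ‖mildMap α u₀ u t x‖ ≤ ‖mildMap α u₀ u t x - mildMap α u₀ (fun _ _ => 0) t x‖
        + ‖mildMap α u₀ (fun _ _ => 0) t x‖ := norm_le_norm_sub_add _ _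
    have h5 : C * (δ * δ) ≤ δ / 2 := by nlinarith
    have h6 : 0 ≤ t ^ (-(1 - 1 / (2 * α))) := by positivity
    calc _ ≤ C * (δ * δ) * t ^ (-(1 - 1 / (2 * α)))
          + n * H 0 * ε * t ^ (-(1 - 1 / (2 * α))) := by linarith
      _ = (C * (δ * δ) + n * H 0 * ε) * t ^ (-(1 - 1 / (2 * α))) := by ring
      _ ≤ _ := mul_le_mul_of_nonneg_right (by linarith) h6
  refine ⟨hadm, fun u v D hD hu hv huv t ht x => ?_, fun u hu hs t ht i => ?_⟩
  · refine (norm_mildMap_sub_le u v ht x).trans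
      ((hduh u v δ D hδ0.le hD hu hv huv t ht x).trans ?_)
    refine mul_le_mul_of_nonneg_right ?_ (by positivity)
    nlinarith
  · have h1 := (((hheat (u₀ i) ε hε0.le (hu₀ i) t ht).1).sub
      (hsm u δ _ hδ0.le hPn hu hs t ht i)).clm_comp Complex.reCLM
    have e : (fun x => mildMap α u₀ u t x i)
        = fun x => Complex.reCLM (heatFlow α t (u₀ i) x - duhamel α u t x i) :=
      funext fun x => mildMap_apply u ht x i
    rw [← e] at h1
    refine ⟨h1.1, fun k x => ?_⟩
    -- The recursion covers only positive orders; at order zero the bound `δ` comes from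
    -- admissibility of the image.
    rcases eq_or_ne k 0 with rfl | hk
    · simp only [norm_iteratedFDeriv_zero, hP0, Nat.cast_zero, zero_div, add_zero]
      exact (abs_apply_le_norm _ i).trans ((hadm u hu).2 t ht x)
    · refine (h1.2 k x).trans ?_
      simp only [Complex.reCLM_norm, one_mul, hP0]
      have h2 := le_majorantSeq hA0 hκ0.le hδ0.le hκδ hk
      have h3 : 0 ≤ t ^ (-((1 - 1 / (2 * α)) + k / (2 * α))) := by positivity
      refine le_trans (le_of_eq ?_) (mul_le_mul_of_nonneg_right h2 h3)
      simp only [hA]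
      ring

theorem tendsto_mul_half_pow_mul (a b : ℝ) :
    Tendsto (fun N : ℕ => a * (1 / 2 : ℝ) ^ N * b) atTop (𝓝 0) := by
  have := ((tendsto_pow_atTop_nhds_zero_of_lt_one (r := (1 / 2 : ℝ)) (by norm_num)
    (by norm_num)).const_mul a).mul_const b
  simpa using this

/-- The trivial bound `2δ` on the weighted distance is halved repeatedly. -/
theorem HalvesDistances.fixedPoint_unique {δ : ℝ} (hδ : 0 ≤ δ)
    {Φ : (ℝ → Space n → Space n) → ℝ → Space n → Space n} (hΦ : HalvesDistances α δ Φ)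
    {u v : ℝ → Space n → Space n} (hu : Admissible α δ u) (hv : Admissible α δ v)
    (hfu : ∀ t, 0 < t → Φ u t = u t) (hfv : ∀ t, 0 < t → Φ v t = v t) {t : ℝ} (ht : 0 < t) :
    u t = v t := by
  have h : ∀ N : ℕ, ∀ t, 0 < t → ∀ x,
      ‖u t x - v t x‖ ≤ 2 * δ * (1 / 2 : ℝ) ^ N * t ^ (-(1 - 1 / (2 * α))) := by
    intro N
    induction N with
    | zero =>
      intro t ht x
      have := norm_sub_le (u t x) (v t x)
      linarith [hu.2 t ht x, hv.2 t ht x]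
    | succ N ih =>
      intro t ht x
      have := hΦ u v _ (by positivity) hu hv ih t ht x
      rw [hfu t ht, hfv t ht] at this
      refine this.trans (le_of_eq ?_)
      rw [pow_succ]
      ring
  funext x
  refine sub_eq_zero.1 (norm_le_zero_iff.1 ?_)
  exact ge_of_tendsto (tendsto_mul_half_pow_mul _ _) (Eventually.of_forall fun N => h N t ht x)

theorem HalvesDistances.exists_fixedPoint {δ : ℝ} (hδ : 0 ≤ δ) {P : ℕ → ℝ} (hP : ∀ k, 0 ≤ P k)
    {Φ : (ℝ → Space n → Space n) → ℝ → Space n → Space n} (hΦ : HalvesDistances α δ Φ)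
    (hadm : ∀ u, Admissible α δ u → Admissible α δ (Φ u))
    (hsm : ∀ u, Admissible α δ u → SmoothField α P u → SmoothField α P (Φ u))
    (h0 : ∀ u t, t ≤ 0 → Φ u t = 0) :
    ∃ u, Admissible α δ u ∧ SmoothField α P u ∧ ∀ t, 0 < t → Φ u t = u t := by
  set U : ℕ → ℝ → Space n → Space n := fun N => Φ^[N] (fun _ _ => 0) with hU
  have hU1 : ∀ N, U (N + 1) = Φ (U N) := fun N => Function.iterate_succ_apply' _ _ _
  have hUadm : ∀ N, Admissible α δ (U N) := by
    intro N
    induction N with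
    | zero => exact admissible_zero hδ
    | succ N ih => rw [hU1]; exact hadm _ ih
  have hUsm : ∀ N, SmoothField α P (U N) := by
    intro N
    induction N with
    | zero =>
      intro t ht j
      exact smoothBound_zero.mono fun k => mul_nonneg (hP k) (by positivity)
    | succ N ih => rw [hU1]; exact hsm _ (hUadm N) ih
  -- With the iterates fixed at nonpositive times, the limit exists at every point, so it is
  -- measurable on all of space-time.
  have hUneg : ∀ N t, t ≤ 0 → U N t = 0 := by
    intro N t ht
    cases N with
    | zero => rfl
    | succ N => rw [hU1, h0 _ t ht]
  have hstep : ∀ N t, 0 < t → ∀ x, ‖U N t x - U (N + 1) t x‖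
      ≤ δ * (1 / 2 : ℝ) ^ N * t ^ (-(1 - 1 / (2 * α))) := by
    intro N
    induction N with
    | zero =>
      intro t ht x
      rw [norm_sub_rev]
      simpa [hU] using (hUadm 1).2 t ht x
    | succ N ih =>
      intro t ht x
      have := hΦ _ _ _ (by positivity) (hUadm N) (hUadm (N + 1)) ih t ht x
      rw [← hU1, ← hU1] at this
      refine this.trans (le_of_eq ?_)
      rw [pow_succ]
      ring
  have hgeo : ∀ t, 0 < t → ∀ x N, dist (U N t x) (U (N + 1) t x)
      ≤ δ * t ^ (-(1 - 1 / (2 * α))) * (1 / 2 : ℝ) ^ N := fun t ht x N => by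
    rw [dist_eq_norm]
    exact (hstep N t ht x).trans (le_of_eq (by ring))
  have hlim : ∀ t x, ∃ L, Tendsto (fun N => U N t x) atTop (𝓝 L) := fun t x => by
    rcases lt_or_ge 0 t with ht | ht
    · exact cauchySeq_tendsto_of_complete
        (cauchySeq_of_le_geometric _ _ (by norm_num) (hgeo t ht x))
    · exact ⟨0, by simp only [hUneg _ t ht]; exact tendsto_const_nhds⟩
  choose u hu using hlim
  have hrate : ∀ N t, 0 < t → ∀ x, ‖U N t x - u t x‖
      ≤ 2 * δ * (1 / 2 : ℝ) ^ N * t ^ (-(1 - 1 / (2 * α))) := fun N t ht x => by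
    have := dist_le_of_le_geometric_of_tendsto _ _ (by norm_num) (hgeo t ht x) (hu t x) N
    rw [dist_eq_norm] at this
    refine this.trans (le_of_eq ?_)
    ring
  have huadm : Admissible α δ u := by
    refine ⟨measurable_of_tendsto_metrizable (fun N => (hUadm N).1)
      (tendsto_pi_nhds.2 fun p => hu p.1 p.2), fun t ht x => ?_⟩
    exact le_of_tendsto (hu t x).norm (Eventually.of_forall fun N => (hUadm N).2 t ht x)
  refine ⟨u, huadm, fun t ht j => ?_, fun t ht => funext fun x => ?_⟩
  · refine smoothBound_of_tendsto (fun N => hUsm N t ht j)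
      (tendsto_mul_half_pow_mul (2 * δ) (t ^ (-(1 - 1 / (2 * α))))) fun N x => ?_
    exact (abs_apply_le_norm (U N t x - u t x) j).trans (hrate N t ht x)
  · have h1 : Tendsto (fun N => U (N + 1) t x) atTop (𝓝 (u t x)) :=
      (hu t x).comp (tendsto_add_atTop_nat 1)
    refine tendsto_nhds_unique ?_ h1
    rw [tendsto_iff_norm_sub_tendsto_zero]
    refine squeeze_zero (fun _ => norm_nonneg _) (fun N => ?_)
      (tendsto_mul_half_pow_mul (2 * δ / 2) (t ^ (-(1 - 1 / (2 * α)))))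
    rw [hU1]
    exact (hΦ _ _ _ (by positivity) (hUadm N) huadm (hrate N) t ht x).trans (le_of_eq (by ring))

/-- A small mild solution is the image under the mild map of an admissible field which agrees with
it almost everywhere. -/
theorem IsMildSolution.exists_admissible {u₀ : Fin n → 𝓢'(Space n, ℂ)} {δ : ℝ} (hδ : 0 ≤ δ)
    {v : ℝ → Space n → Space n} (hv : IsMildSolution α u₀ v)
    (hvδ : normGX α 0 v ≤ ENNReal.ofReal δ) :
    ∃ w, Admissible α δ w ∧ (∀ᵐ s, 0 < s → w s =ᵐ[volume] v s) ∧
      ∀ t, 0 < t → v t = mildMap α u₀ w t := by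
  obtain ⟨v₁, hv₁, h1⟩ := hv.measurable
  have hm₁ : Measurable v₁ := hv₁.measurable
  -- Cutting the measurable representative off outside `S` makes the bound hold everywhere; at
  -- almost every time it changes the field only on a null set.
  set S : Set (ℝ × Space n) := {p | 0 < p.1 ∧ ‖v₁ p‖ ≤ δ * p.1 ^ (-(1 - 1 / (2 * α)))} with hS
  have hSm : MeasurableSet S := (measurableSet_lt measurable_const measurable_fst).inter
    (measurableSet_le hm₁.norm ((measurable_fst.pow_const _).const_mul δ))
  have hae : ∀ᵐ s, 0 < s → (fun y => v₁ (s, y)) =ᵐ[volume] v s := by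
    rw [Measure.volume_eq_prod, ← Measure.prod_restrict, Measure.restrict_univ] at h1
    have h2 := Measure.ae_ae_of_ae_prod h1
    rw [ae_restrict_iff' measurableSet_Ioi] at h2
    filter_upwards [h2] with s hs hs0
    filter_upwards [hs hs0] with y hy
    exact hy.symm
  have hw : ∀ᵐ s, 0 < s → (fun y => S.indicator v₁ (s, y)) =ᵐ[volume] v s := by
    filter_upwards [hae] with s hs hs0
    filter_upwards [hs hs0, ae_norm_le_of_normGX_zero_le hδ hvδ hs0] with y hy hy'
    rw [Set.indicator_of_mem (show (s, y) ∈ S from ⟨hs0, by rw [hy]; exact hy'⟩), hy]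
  refine ⟨fun s y => S.indicator v₁ (s, y), ⟨hm₁.indicator hSm, fun t ht x => ?_⟩, hw,
    fun t ht => ?_⟩
  · simp only [Set.indicator_apply]
    split_ifs with h
    · exact h.2
    · rw [norm_zero]; positivity
  · rw [mildMap_congr hw]
    funext x
    ext i
    rw [mildMap_apply v ht, ← hv.eqn t ht x i, Complex.ofReal_re]

end

end FracNS

theorem theorem4 (n : ℕ) (hn : 1 ≤ n) (α : ℝ) (hα : 1 / 2 < α) (hα' : α < 1) :
    ∃ ε : ℝ, 0 < ε ∧ ∃ δ : ℝ, 0 < δ ∧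
      ∀ u₀ : Fin n → 𝓢'(FracNS.Space n, ℂ),
        (∀ i, FracNS.IsReal (u₀ i)) → FracNS.IsDivFree u₀ → FracNS.MemB α u₀ →
        FracNS.normB α u₀ < ENNReal.ofReal ε →
        ∃ u : ℝ → FracNS.Space n → FracNS.Space n,
          FracNS.IsMildSolution α u₀ u ∧ FracNS.normGX α 0 u ≤ ENNReal.ofReal δ ∧
          (∀ v : ℝ → FracNS.Space n → FracNS.Space n, FracNS.IsMildSolution α u₀ v →
            FracNS.normGX α 0 v ≤ ENNReal.ofReal δ → ∀ t, 0 < t → v t = u t) ∧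
          ∀ k : ℕ, FracNS.MemGX α k u := by
  obtain ⟨ε, hε, δ, hδ, P, hP, h⟩ := FracNS.exists_mildMap_contraction n hα hα'
  refine ⟨ε, hε, δ, hδ, fun u₀ hr _ _ hB => ?_⟩
  obtain ⟨hadm, hcon, hsm⟩ := h u₀ fun i => (le_iSup _ i).trans hB.le
  obtain ⟨u, hu, hus, hfix⟩ := hcon.exists_fixedPoint hδ.le hP hadm hsm
    fun u t ht => funext fun x => if_neg ht.not_gt
  have hus' : ∀ t, 0 < t → FracNS.SmoothBound (u t) _ := fun t ht =>
    FracNS.smoothBound_apply_to_norm (hus t ht)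
  have h0 : FracNS.normGX α 0 u ≤ ENNReal.ofReal δ := FracNS.normGX_le fun t ht x => by
    simpa using hu.2 t ht x
  have hmeas : AEStronglyMeasurable (fun p : ℝ × FracNS.Space n => u p.1 p.2)
      (volume.restrict (Set.Ioi (0 : ℝ) ×ˢ Set.univ)) := hu.1.aestronglyMeasurable
  refine ⟨u, ⟨hmeas, h0.trans_lt ENNReal.ofReal_lt_top, fun t ht x i => ?_⟩, h0,
    fun v hv hvδ t ht => ?_, fun k => ⟨hmeas, fun t ht => (hus' t ht).1.of_le
      (by exact_mod_cast le_top), lt_of_le_of_lt (FracNS.normGX_le (M := n * P k)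
        fun t ht x => ((hus' t ht).2 k x).trans (le_of_eq (by ring))) ENNReal.ofReal_lt_top⟩⟩
  · rw [← FracNS.ofReal_mildMap_apply hr u ht, hfix t ht]
  · obtain ⟨w, hw, hwv, hvw⟩ := hv.exists_admissible hδ.le hvδ
    -- `v` equals the image of `w` at every positive time and agrees with `w` almost everywhere,
    -- while the mild map ignores such changes; so this image is an admissible fixed point and
    -- uniqueness holds pointwise.
    have hw' : FracNS.mildMap α u₀ (FracNS.mildMap α u₀ w) = FracNS.mildMap α u₀ w := by
      refine FracNS.mildMap_congr ?_
      filter_upwards [hwv] with s hs hs0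
      rw [← hvw s hs0]
      exact (hs hs0).symm
    rw [hvw t ht]
    exact hcon.fixedPoint_unique hδ.le (hadm w hw) hu (fun t _ => congrFun hw' t) hfix ht
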